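/- Let $f:\mathbb R^2\to\mathbb R$ and $g:\mathbb R\to\mathbb R$ be $C^\infty$, with $g$ periodic of period $T>0$, and let $c\in\mathbb R$. Consider the impact oscillator $\ddot x+f(x,\dot x)=g(t)$ constrained to $x\ge c$, with restitution rule $\dot x\mapsto\rho(\dot x)$ at $x=c$, where $\rho:\mathbb R\to\mathbb R$ is $C^\infty$, $\rho(0)=0$, $\rho(v)>0$ for $v<0$, and $\rho'(0)=-r$ with $0<r<1$. For $(\tau,v)\in\mathbb R^2$ let $t\mapsto x_c(\tau,v;t)$ be the solution, as a function of the elapsed time $t$, with $(x,\dot x)=(c,v)$ at the instant $\tau$ (defined on its maximal interval of existence). Put $\Pi^+=\{(\tau,v):v>0\}$, $\Pi_0=\{(\tau,v):v=0\}$, $\Pi_0^+=\Pi^+\cup\Pi_0$, and $a(\tau)=\ddot x_c(\tau,0;0)=g(\tau)-f(c,0)$. The impact map $G$ is the partial map of $\Pi_0^+$ to itself given as follows. If $v>0$, or if $v=0$ and $x_c(\tau,0;t)>c$ for all sufficiently small $t>0$, then $G(\tau,v)=(\tau+t_1,\rho(\dot x_c(\tau,v;t_1)))$, where $t_1>0$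 is the first positive time with $x_c(\tau,v;t_1)=c$ ($G$ is undefined if there is no such time). All other points $(\tau,0)$ are fixed by $G$. The stable manifold $W^s_\tau$ of $(\tau,0)$ is the set of points $w\in\Pi_0^+$ for which all iterates $G^n(w)$, $n\ge0$, are defined and $G^n(w)\to(\tau,0)$. **Theorem 4.7.** Let $w_*=(\tau_*,0)$ be a tangency point with $a'(\tau_*)<0$, that is, $a(\tau_*)=0$ and $a'(\tau_*)<0$. Then there is a neighbourhood $U$ of $w_*$ in $\Pi_0^+$ such that $U^+:=U\cap\Pi^+$ is smoothly foliated by arcs of stable manifolds of points $(\tau,0)$ with $\tau>\tau_*$, each arc having its end-points on $\Pi_0$ on opposite sides of $\tau_*$. Precisely: there are $\tau_1>\tau_*$ and a map $\Phi:(\tau_*,\tau_1)\times[0,1]\to\Pi_0^+$ whose restriction to $(\tau_*,\tau_1)\times(0,1)$ is a $C^\infty$ diffeomorphism onto $U^+$, such that for each $\tau\in(\tau_*,\tau_1)$: 1. $\Phi(\{\tau\}\times(0,1))=U^+\cap W^s_\tau$; 2. $\Phi(\{\tau\}\times[0,1])\subset W^s_\tau$; 3. $s\mapsto\Phi(\tau,s)$,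 $s\in[0,1]$, is an injective $C^\infty$ curve with nowhere vanishing derivative, with $\Phi(\tau,0)=(\tau,0)$ and $\Phi(\tau,1)=(\tau',0)$ for some $\tau'<\tau_*$. -/

import Mathlib

open Set Filter Topology
open scoped ContDiff

namespace ImpactOscillator

/-- The right-hand side of `ẍ + f(x, ẋ) = g(t)` as a first-order system in `(x, ẋ)`. -/
def field (f : ℝ → ℝ → ℝ) (g : ℝ → ℝ) (t : ℝ) (z : ℝ × ℝ) : ℝ × ℝ :=
  (z.2, g t - f z.1 z.2)

/-- `z = (x, ẋ)`, as a function of the time elapsed since the instant `τ`, solves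
`ẍ + f(x, ẋ) = g` on the closed interval between the elapsed times `0` and `t`
(in either order), with `(x, ẋ) = (c, v)` at the instant `τ`. -/
def IsMotion (f : ℝ → ℝ → ℝ) (g : ℝ → ℝ) (c τ v t : ℝ) (z : ℝ → ℝ × ℝ) : Prop :=
  z 0 = (c, v) ∧
    ∀ s ∈ uIcc 0 t, HasDerivWithinAt z (field f g (τ + s) (z s)) (uIcc 0 t) s

/-- Solutions are unique. -/
theorem IsMotion.eqOn {f : ℝ → ℝ → ℝ} {g : ℝ → ℝ} (hf : ContDiff ℝ ∞ (Function.uncurry f))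
    {c τ v t : ℝ} {z w : ℝ → ℝ × ℝ} (hz : IsMotion f g c τ v t z)
    (hw : IsMotion f g c τ v t w) : EqOn z w (uIcc 0 t) := by
  have hzc : ContinuousOn z (uIcc 0 t) := fun s hs => (hz.2 s hs).continuousWithinAt
  have hwc : ContinuousOn w (uIcc 0 t) := fun s hs => (hw.2 s hs).continuousWithinAt
  set S : Set (ℝ × ℝ) := z '' uIcc 0 t ∪ w '' uIcc 0 t
  have hS : IsCompact S :=
    (isCompact_uIcc.image_of_continuousOn hzc).union (isCompact_uIcc.image_of_continuousOn hwc)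
  have hfl : LocallyLipschitz (Function.uncurry f) := (hf.of_le (by simp)).locallyLipschitz
  obtain ⟨K, hK⟩ := (hfl.locallyLipschitzOn (s := S)).exists_lipschitzOnWith_of_compact hS
  have hv : ∀ s, LipschitzOnWith (max 1 K) (field f g s) S := by
    intro s
    have h1 : LipschitzOnWith 1 (fun z : ℝ × ℝ => z.2) S := LipschitzWith.prod_snd.lipschitzOnWith
    have h2 : LipschitzOnWith K (fun z : ℝ × ℝ => g s - f z.1 z.2) S := by
      intro a ha b hb
      have := hK ha hb
      have e : ∀ x y : ℝ, |g s - x - (g s - y)| = |x - y| := fun x y => by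
        rw [sub_sub_sub_cancel_left, abs_sub_comm]
      simp only [edist_dist, Real.dist_eq, e] at this ⊢
      exact this
    intro a ha b hb
    have h1 := h1 ha hb
    have h2 := h2 ha hb
    rw [Prod.edist_eq]
    refine max_le (h1.trans ?_) (h2.trans ?_)
    · gcongr; exact le_max_left _ _
    · gcongr; exact le_max_right _ _
  have hzS : ∀ s ∈ uIcc 0 t, z s ∈ S := fun s hs => Or.inl ⟨s, hs, rfl⟩
  have hwS : ∀ s ∈ uIcc 0 t, w s ∈ S := fun s hs => Or.inr ⟨s, hs, rfl⟩
  have h0 : z 0 = w 0 := hz.1.trans hw.1.symm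
  rcases le_total 0 t with ht | ht
  · have hd : ∀ u : ℝ → ℝ × ℝ, IsMotion f g c τ v t u → ∀ s ∈ Ico 0 t,
        HasDerivWithinAt u (field f g (τ + s) (u s)) (Ici s) s := by
      intro u hu s hs
      have h := hu.2 s (by rw [uIcc_of_le ht]; exact Ico_subset_Icc_self hs)
      rw [uIcc_of_le ht] at h
      exact h.mono_of_mem_nhdsWithin (Icc_mem_nhdsGE_of_mem hs)
    rw [uIcc_of_le ht] at *
    exact ODE_solution_unique_of_mem_Icc_right (v := fun s => field f g (τ + s))
      (s := fun _ => S) (fun s _ => hv _) hzc (hd z hz) (fun s hs => hzS s (Ico_subset_Icc_self hs))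
      hwc (hd w hw) (fun s hs => hwS s (Ico_subset_Icc_self hs)) h0
  · have hd : ∀ u : ℝ → ℝ × ℝ, IsMotion f g c τ v t u → ∀ s ∈ Ioc t 0,
        HasDerivWithinAt u (field f g (τ + s) (u s)) (Iic s) s := by
      intro u hu s hs
      have h := hu.2 s (by rw [uIcc_of_ge ht]; exact Ioc_subset_Icc_self hs)
      rw [uIcc_of_ge ht] at h
      exact h.mono_of_mem_nhdsWithin (Icc_mem_nhdsLE_of_mem hs)
    rw [uIcc_of_ge ht] at *
    exact ODE_solution_unique_of_mem_Icc_left (v := fun s => field f g (τ + s))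
      (s := fun _ => S) (fun s _ => hv _) hzc (hd z hz) (fun s hs => hzS s (Ioc_subset_Icc_self hs))
      hwc (hd w hw) (fun s hs => hwS s (Ioc_subset_Icc_self hs)) h0

open Classical in
/-- `(x_c(τ, v; t), ẋ_c(τ, v; t))`, the state at elapsed time `t` of the solution that starts from
`(c, v)` at the instant `τ`. The value is `(0, 0)` if that solution does not exist up to elapsed
time `t`. -/
noncomputable def state (f : ℝ → ℝ → ℝ) (g : ℝ → ℝ) (c τ v t : ℝ) : ℝ × ℝ :=
  if h : ∃ z, IsMotion f g c τ v t z then h.choose t else 0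

theorem IsMotion.state_eq {f : ℝ → ℝ → ℝ} {g : ℝ → ℝ} (hf : ContDiff ℝ ∞ (Function.uncurry f))
    {c τ v t : ℝ} {z : ℝ → ℝ × ℝ} (hz : IsMotion f g c τ v t z) :
    state f g c τ v t = z t := by
  have h : ∃ z, IsMotion f g c τ v t z := ⟨z, hz⟩
  rw [state, dif_pos h]
  exact h.choose_spec.eqOn hf hz right_mem_uIcc

/-- The impact surface `V_c`: the points `(τ, v; t)` at which `x_c(τ, v; t)` is defined and equal
to `c`. -/
def impactSurface (f : ℝ → ℝ → ℝ) (g : ℝ → ℝ) (c : ℝ) : Set (ℝ × ℝ × ℝ) :=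
  {q | (∃ z, IsMotion f g c q.1 q.2.1 q.2.2 z) ∧ (state f g c q.1 q.2.1 q.2.2).1 = c}

/-- The initial acceleration `a_c(τ) = ẍ_c(τ, 0; 0)`, as the differential equation gives it. -/
def initialAcceleration (f : ℝ → ℝ → ℝ) (g : ℝ → ℝ) (c τ : ℝ) : ℝ := g τ - f c 0

theorem IsMotion.hasDerivWithinAt_velocity {f : ℝ → ℝ → ℝ} {g : ℝ → ℝ} {c τ t : ℝ}
    {z : ℝ → ℝ × ℝ} (hz : IsMotion f g c τ 0 t z) :
    HasDerivWithinAt (fun s => (z s).2) (initialAcceleration f g c τ) (uIcc 0 t) 0 := by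
  have h := (ContinuousLinearMap.snd ℝ ℝ ℝ).hasFDerivAt.comp_hasDerivWithinAt 0
    (hz.2 0 left_mem_uIcc)
  have e : (ContinuousLinearMap.snd ℝ ℝ ℝ) (field f g (τ + 0) (z 0)) =
      initialAcceleration f g c τ := by
    simp [field, hz.1, initialAcceleration]
  rw [e] at h
  exact h

/-- A tangency point `(τ, 0)`: `a_c(τ) = 0` and `a_c'(τ) ≠ 0`. -/
def IsTangencyPoint (f : ℝ → ℝ → ℝ) (g : ℝ → ℝ) (c τ : ℝ) : Prop :=
  initialAcceleration f g c τ = 0 ∧ deriv (initialAcceleration f g c) τ ≠ 0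

/-- The open half-plane `Π⁺` of points `(τ, v)` with `v > 0`. -/
def upperHalf : Set (ℝ × ℝ) := {w | 0 < w.2}

/-- The closed half-plane `Π₀⁺` of points `(τ, v)` with `v ≥ 0`. -/
def closedUpperHalf : Set (ℝ × ℝ) := {w | 0 ≤ w.2}

/-- The motion with initial data `w = (τ, v)` satisfies `x_c(τ, v; t) > c` for all sufficiently
small `t > 0`. -/
def LiftsOff (f : ℝ → ℝ → ℝ) (g : ℝ → ℝ) (c : ℝ) (w : ℝ × ℝ) : Prop :=
  ∀ᶠ t in 𝓝[>] 0, (∃ z, IsMotion f g c w.1 w.2 t z) ∧ c < (state f g c w.1 w.2 t).1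

/-- The positive elapsed times at which the motion with initial data `w = (τ, v)` meets `x = c`. -/
def hitTimes (f : ℝ → ℝ → ℝ) (g : ℝ → ℝ) (c : ℝ) (w : ℝ × ℝ) : Set ℝ :=
  {t | 0 < t ∧ (w.1, w.2, t) ∈ impactSurface f g c}

open Classical in
/-- The first-hit map `F_c : Π₀⁺ → V_c`. From data with `v > 0`, or with `v = 0` when the motion
lifts off, it goes to the first later point of `V_c`; all other points `(τ, 0)` stay at rest.
It is meaningful on `returnDomain`. -/
noncomputable def firstHit (f : ℝ → ℝ → ℝ) (g : ℝ → ℝ) (c : ℝ) (w : ℝ × ℝ) : ℝ × ℝ × ℝ :=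
  if 0 < w.2 ∨ LiftsOff f g c w then (w.1, w.2, sInf (hitTimes f g c w)) else (w.1, w.2, 0)

/-- The points of `Π₀⁺` where the first-hit map is defined: if the motion leaves `x = c`, then it
hits `x = c` again. -/
def returnDomain (f : ℝ → ℝ → ℝ) (g : ℝ → ℝ) (c : ℝ) : Set (ℝ × ℝ) :=
  {w | w ∈ closedUpperHalf ∧ (0 < w.2 ∨ LiftsOff f g c w → (hitTimes f g c w).Nonempty)}

/-- The re-set map `φ_c : (τ, v; t) ↦ (τ + t, ẋ_c(τ, v; t))`. -/
noncomputable def reset (f : ℝ → ℝ → ℝ) (g : ℝ → ℝ) (c : ℝ) (q : ℝ × ℝ × ℝ) : ℝ × ℝ :=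
  (q.1 + q.2.2, (state f g c q.1 q.2.1 q.2.2).2)

/-- The restitution map `R_c : (τ, v) ↦ (τ, ρ(v))`. -/
def restitution (ρ : ℝ → ℝ) (w : ℝ × ℝ) : ℝ × ℝ := (w.1, ρ w.2)

/-- The impact map `G_c = R_c ∘ φ_c ∘ F_c`, to be used on `returnDomain`. -/
noncomputable def impactMap (f : ℝ → ℝ → ℝ) (g ρ : ℝ → ℝ) (c : ℝ) (w : ℝ × ℝ) : ℝ × ℝ :=
  restitution ρ (reset f g c (firstHit f g c w))

/-- The stable manifold of `p`: the points of `Π₀⁺` all of whose iterates under the impact map are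
defined, and whose iterates converge to `p`. -/
def stableSet (f : ℝ → ℝ → ℝ) (g ρ : ℝ → ℝ) (c : ℝ) (p : ℝ × ℝ) : Set (ℝ × ℝ) :=
  {w | (∀ n : ℕ, (impactMap f g ρ c)^[n] w ∈ returnDomain f g c) ∧
    Tendsto (fun n : ℕ => (impactMap f g ρ c)^[n] w) atTop (𝓝 p)}

/-- `Φ` restricts to a `C^∞` diffeomorphism of `A` onto `B`. -/
def IsSmoothDiffeoOn (Φ : ℝ × ℝ → ℝ × ℝ) (A B : Set (ℝ × ℝ)) : Prop :=
  ContDiffOn ℝ ∞ Φ A ∧ BijOn Φ A B ∧ ∃ Ψ : ℝ × ℝ → ℝ × ℝ, ContDiffOn ℝ ∞ Ψ B ∧ InvOn Ψ Φ A B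

/-- `γ` parametrizes, over `[0, 1]`, a smooth (embedded, closed) arc with end-points `p` and `q`. -/
def IsSmoothArc (γ : ℝ → ℝ × ℝ) (p q : ℝ × ℝ) : Prop :=
  ContDiffOn ℝ ∞ γ (Icc 0 1) ∧ InjOn γ (Icc 0 1) ∧
    (∀ s ∈ Icc (0 : ℝ) 1, derivWithin γ (Icc 0 1) s ≠ 0) ∧ γ 0 = p ∧ γ 1 = q

end ImpactOscillator

/-!
Write `a' = deriv a τs < 0` and `b = -a' / 6`. A motion that starts at the time `τ` with the
velocity `v` is `x = c + t v + t² X(τ, v, t)`, where `X` is smooth, `X(τ, v, 0)` is half the initial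
acceleration, and `X` decreases in `t` near the tangency point. Put `v = b p t`. The equation
`x = c` at the time `t > 0` then reads `b p + X(τ, b p t, t) = 0`, and as `∂X/∂τ = a' / 2 ≠ 0` it
can be solved for `τ = θ(p, t)`. So the quadrant `p, t ≥ 0` parametrizes the half-plane near the
tangency point by `(p, t) ↦ (θ(p, t), b p t)`. In these coordinates the first return takes the time
`t`, the impact velocity vanishes with `t`, and points with `t = 0` are at rest
(`exists_tangencyReturn`).

The impact map is still singular at the tangency point itself, but becomes regular after the blow-up
`(p, t) = (s (1 - y), s y)`, `0 ≤ y ≤ 1`: in the coordinates `(s, y)` the impact map extends to a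
smooth map `H` near the whole segment `{0} × [0, 1]` (`IsTangencyReturn.exists_blownUpReturn`). The
axis `y = 0` consists of fixed points of `H`, and on the segment `s = 0` the restitution coefficient
`r < 1` gives `0 ≤ y' ≤ r y`. Hence every orbit that starts near the segment enters, after a number
of steps that can be chosen uniformly, a neighbourhood of `(0, 0)` in which the axis of fixed points
is normally attracting.

Near a normally attracting segment of fixed points, the limit of `Hⁿ` exists and is smooth
(`exists_smooth_limit`). This is proved by induction on the order of differentiability: the tangent
map of `H` is a map of the same kind, and its limit is the tangent map of the limit. So the limit
phase `Λ(s, y)`, with `Gⁿ → (Λ, 0)`, is smooth up to the segment `s = 0`, where it equals `τs`. A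
step increases the phase by `t`, so that `Λ ≥ θ(p, t) + t ≥ τs + s / 4`, whence `∂Λ/∂s > 0` at
`s = 0`, and the level set `Λ = τ` is a graph `s = S(τ, y)` over `0 ≤ y ≤ 1`. These level sets are
the leaves. Their end-points `y = 0` and `y = 1` lie on the axes `t = 0` and `p = 0` of the
quadrant, which are mapped to the boundary `v = 0` to the right and to the left of `τs`, as `θ`
increases in `p` and decreases in `t`.

The flow of the differential equation is smooth in time and initial data jointly by the implicit
function theorem in the Banach space of continuous curves (`exists_smooth_flow`).
-/

namespace ImpactOscillator

/-! ### Germs of smooth functions -/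

section SmoothNear

variable {E F G : Type*} [NormedAddCommGroup E] [NormedSpace ℝ E]
  [NormedAddCommGroup F] [NormedSpace ℝ F] [NormedAddCommGroup G] [NormedSpace ℝ G]

/-- `f` is `C^∞` on a neighbourhood of `x`. This is stronger than `ContDiffAt ℝ ∞ f x`, which allows
the neighbourhood to shrink with the order of differentiability. -/
def SmoothNear (f : E → F) (x : E) : Prop := ∀ᶠ y in 𝓝 x, ContDiffAt ℝ ∞ f y

theorem SmoothNear.contDiffAt {f : E → F} {x : E} (h : SmoothNear f x) : ContDiffAt ℝ ∞ f x :=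
  h.self_of_nhds

theorem SmoothNear.continuousAt {f : E → F} {x : E} (h : SmoothNear f x) : ContinuousAt f x :=
  h.contDiffAt.continuousAt

theorem SmoothNear.differentiableAt {f : E → F} {x : E} (h : SmoothNear f x) :
    DifferentiableAt ℝ f x :=
  h.contDiffAt.differentiableAt (by simp)

theorem SmoothNear.eventually {f : E → F} {x : E} (h : SmoothNear f x) :
    ∀ᶠ y in 𝓝 x, SmoothNear f y :=
  eventually_eventually_nhds.2 h

theorem _root_.ContDiff.smoothNear {f : E → F} (h : ContDiff ℝ ∞ f) (x : E) : SmoothNear f x :=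
  Eventually.of_forall fun _ => h.contDiffAt

theorem SmoothNear.congr {f g : E → F} {x : E} (h : SmoothNear f x) (e : g =ᶠ[𝓝 x] f) :
    SmoothNear g x := by
  filter_upwards [h, e.eventuallyEq_nhds] with y hy hey
  exact hy.congr_of_eventuallyEq hey

theorem SmoothNear.comp {g : F → G} {f : E → F} {x : E} (hg : SmoothNear g (f x))
    (hf : SmoothNear f x) : SmoothNear (fun y => g (f y)) x := by
  filter_upwards [hf, hf.continuousAt.eventually hg] with y hy hgy
  exact hgy.comp y hy

theorem SmoothNear.prodMk {f : E → F} {g : E → G} {x : E} (hf : SmoothNear f x)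
    (hg : SmoothNear g x) : SmoothNear (fun y => (f y, g y)) x := by
  filter_upwards [hf, hg] with y h1 h2
  exact h1.prodMk h2

theorem SmoothNear.fst {f : E → F × G} {x : E} (hf : SmoothNear f x) :
    SmoothNear (fun y => (f y).1) x := by
  filter_upwards [hf] with y h1
  exact h1.fst

theorem SmoothNear.snd {f : E → F × G} {x : E} (hf : SmoothNear f x) :
    SmoothNear (fun y => (f y).2) x := by
  filter_upwards [hf] with y h1
  exact h1.snd

theorem SmoothNear.add {f g : E → F} {x : E} (hf : SmoothNear f x)
    (hg : SmoothNear g x) : SmoothNear (fun y => f y + g y) x := by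
  filter_upwards [hf, hg] with y h1 h2
  exact h1.add h2

theorem SmoothNear.sub {f g : E → F} {x : E} (hf : SmoothNear f x)
    (hg : SmoothNear g x) : SmoothNear (fun y => f y - g y) x := by
  filter_upwards [hf, hg] with y h1 h2
  exact h1.sub h2

theorem SmoothNear.mul {f g : E → ℝ} {x : E} (hf : SmoothNear f x)
    (hg : SmoothNear g x) : SmoothNear (fun y => f y * g y) x := by
  filter_upwards [hf, hg] with y h1 h2
  exact h1.mul h2

theorem SmoothNear.div {f g : E → ℝ} {x : E} (hf : SmoothNear f x)
    (hg : SmoothNear g x) (h0 : g x ≠ 0) : SmoothNear (fun y => f y / g y) x := by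
  filter_upwards [hf, hg, hg.continuousAt.eventually_ne h0] with y h1 h2 h3
  exact h1.div h2 h3

theorem smoothNear_const (c : F) (x : E) : SmoothNear (fun _ => c) x :=
  contDiff_const.smoothNear x

/-- A germ of a smooth map is represented by a map that is smooth on the whole space. -/
theorem SmoothNear.exists_contDiff [FiniteDimensional ℝ E] {f : E → F} {x : E}
    (hf : SmoothNear f x) : ∃ g : E → F, ContDiff ℝ ∞ g ∧ g =ᶠ[𝓝 x] f := by
  obtain ⟨R, hR, hball⟩ := Metric.eventually_nhds_iff_ball.1 hf
  let φ : ContDiffBump x := ⟨R / 3, R / 2, by positivity, by linarith⟩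
  refine ⟨fun y => φ y • f y, ?_, ?_⟩
  · rw [contDiff_iff_contDiffAt]
    intro y
    by_cases hy : y ∈ Metric.ball x R
    · exact φ.contDiff.contDiffAt.smul (hball y hy)
    · have h0 : (fun y => φ y • f y) =ᶠ[𝓝 y] fun _ => 0 := by
        have hm : (Metric.closedBall x (R / 2))ᶜ ∈ 𝓝 y := by
          refine Metric.isClosed_closedBall.isOpen_compl.mem_nhds fun h => hy ?_
          exact Metric.closedBall_subset_ball (by linarith) h
        filter_upwards [hm] with z hz
        have : φ z = 0 := φ.zero_of_le_dist (by
          simp only [mem_compl_iff, Metric.mem_closedBall, not_le] at hz; exact hz.le)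
        simp [this]
      exact contDiffAt_const.congr_of_eventuallyEq h0
  · filter_upwards [φ.eventuallyEq_one] with y hy
    simp [hy]

end SmoothNear

/-! ### Smooth roots of equations -/

section Root

variable {E F G : Type*} [NormedAddCommGroup E] [NormedSpace ℝ E] [CompleteSpace E]
  [NormedAddCommGroup F] [NormedSpace ℝ F] [CompleteSpace F]
  [NormedAddCommGroup G] [NormedSpace ℝ G] [CompleteSpace G]

/-- A continuous solution of an equation to which the implicit function theorem applies is
smooth. -/
theorem contDiffAt_of_implicit {f : E × F → G} {ψ : E → F} {x : E}
    (hf : ContDiffAt ℝ ∞ f (x, ψ x))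
    (hi : (fderiv ℝ f (x, ψ x) ∘L .inr ℝ E F).IsInvertible) (hψ : ContinuousAt ψ x)
    (he : ∀ᶠ y in 𝓝 x, f (y, ψ y) = f (x, ψ x)) : ContDiffAt ℝ ∞ ψ x := by
  have h1 := hf.contDiffAt_implicitFunction (by simp) hi
  refine h1.congr_of_eventuallyEq ?_
  have h2 := hf.eventually_apply_eq_iff_implicitFunction (by simp) hi
  have h3 : ContinuousAt (fun y => (y, ψ y)) x := continuousAt_id.prodMk hψ
  filter_upwards [h3.eventually h2, he] with y h4 h5
  exact (h4.1 h5).symm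

/-- The implicit function theorem, with a solution that is smooth on a neighbourhood. -/
theorem exists_smooth_implicit {f : E × F → G} {x : E} {q : F} (hf : SmoothNear f (x, q))
    (h0 : f (x, q) = 0) (hi : (fderiv ℝ f (x, q) ∘L .inr ℝ E F).IsInvertible) :
    ∃ ψ : E → F, SmoothNear ψ x ∧ ψ x = q ∧ ∀ᶠ z in 𝓝 (x, q), f z = 0 ↔ ψ z.1 = z.2 := by
  have hcd := hf.contDiffAt
  let ψ : E → F := hcd.implicitFunction (by simp) hi
  have hψ0 : ψ x = q := hcd.implicitFunction_apply_self (by simp) hi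
  have hψs : ContDiffAt ℝ ∞ ψ x := hcd.contDiffAt_implicitFunction (by simp) hi
  have hψe : ∀ᶠ z in 𝓝 x, f (z, ψ z) = 0 := by
    have := hcd.eventually_apply_implicitFunction (by simp) hi
    rw [h0] at this
    exact this
  have hψu : ∀ᶠ z in 𝓝 (x, q), f z = 0 ↔ ψ z.1 = z.2 := by
    have := hcd.eventually_apply_eq_iff_implicitFunction (by simp) hi
    rw [h0] at this
    exact this
  refine ⟨ψ, ?_, hψ0, hψu⟩
  have h1 : ∀ᶠ z in 𝓝 x, ContDiffAt ℝ 1 ψ z :=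
    (hψs.of_le (by simp : (1 : WithTop ℕ∞) ≤ ∞)).eventually (by simp)
  have h2 : ∀ᶠ z in 𝓝 (x, q), (fderiv ℝ f z ∘L .inr ℝ E F).IsInvertible := by
    have hc : ContinuousAt (fun z => fderiv ℝ f z ∘L .inr ℝ E F) (x, q) :=
      ((hcd.fderiv_right (m := 0) (by simp)).continuousAt).clm_comp continuousAt_const
    obtain ⟨A, hA⟩ := hi
    have h5 := ContinuousLinearEquiv.nhds A
    rw [hA] at h5
    exact hc.eventually h5
  have h3 : Tendsto (fun z => (z, ψ z)) (𝓝 x) (𝓝 (x, q)) := by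
    have := continuousAt_id.prodMk hψs.continuousAt
    rwa [ContinuousAt, hψ0] at this
  filter_upwards [h1, h3.eventually h2, h3.eventually hf, eventually_eventually_nhds.2 hψe]
    with z hz1 hz2 hz4 hz3
  refine contDiffAt_of_implicit hz4 hz2 hz1.continuousAt ?_
  rw [hz3.self_of_nhds]; exact hz3

omit [CompleteSpace E] in
theorem isInvertible_of_real {e : E × ℝ → ℝ} {z : E × ℝ} (h : fderiv ℝ e z (0, 1) ≠ 0) :
    (fderiv ℝ e z ∘L .inr ℝ E ℝ).IsInvertible := by
  have : fderiv ℝ e z ∘L .inr ℝ E ℝ =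
      (ContinuousLinearEquiv.smulLeft (Units.mk0 _ h) : ℝ ≃L[ℝ] ℝ) := by
    ext
    simp
  exact ⟨_, this.symm⟩

variable {X : Type*}

/-- The largest `q ∈ [a, b]` with `e (x, q) ≤ 0`. If `e (x, ·)` increases from a negative to a
positive value on `[a, b]`, then this is its root. -/
noncomputable def rootOn (e : X × ℝ → ℝ) (a b : ℝ) (x : X) : ℝ :=
  sSup {q | q ∈ Icc a b ∧ e (x, q) ≤ 0}

theorem rootOn_spec {e : X × ℝ → ℝ} {a b : ℝ} {x : X} (hab : a ≤ b)
    (hc : ContinuousOn (fun q => e (x, q)) (Icc a b))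
    (hm : StrictMonoOn (fun q => e (x, q)) (Icc a b)) (ha : e (x, a) < 0) (hb : 0 < e (x, b)) :
    rootOn e a b x ∈ Ioo a b ∧ e (x, rootOn e a b x) = 0 ∧
      ∀ q ∈ Icc a b, e (x, q) = 0 → q = rootOn e a b x := by
  obtain ⟨q₀, hq, h0⟩ := intermediate_value_Icc hab hc (⟨ha.le, hb.le⟩ : (0 : ℝ) ∈ Icc _ _)
  simp only at h0
  have hs : {q | q ∈ Icc a b ∧ e (x, q) ≤ 0} = Icc a q₀ := by
    ext q
    constructor
    · rintro ⟨h1, h2⟩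
      refine ⟨h1.1, ?_⟩
      rw [← h0] at h2
      exact (hm.le_iff_le h1 hq).1 h2
    · intro h
      have h1 : q ∈ Icc a b := ⟨h.1, h.2.trans hq.2⟩
      refine ⟨h1, ?_⟩
      rw [← h0]
      exact (hm.le_iff_le h1 hq).2 h.2
  have hr : rootOn e a b x = q₀ := by rw [rootOn, hs, csSup_Icc hq.1]
  rw [hr]
  refine ⟨⟨lt_of_le_of_ne hq.1 ?_, lt_of_le_of_ne hq.2 ?_⟩, h0, fun q h1 h2 => ?_⟩
  · rintro rfl; exact ha.ne h0
  · rintro rfl; exact hb.ne' h0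
  · exact hm.injOn h1 hq (h2.trans h0.symm)

/-- A one-dimensional implicit function theorem with a prescribed window `[a, b]` for the root. -/
theorem smoothNear_rootOn {e : E × ℝ → ℝ} {a b : ℝ} {x : E} (hab : a ≤ b)
    (hs : ∀ q ∈ Icc a b, SmoothNear e (x, q))
    (hd : ∀ q ∈ Icc a b, 0 < fderiv ℝ e (x, q) (0, 1)) (ha : e (x, a) < 0) (hb : 0 < e (x, b)) :
    SmoothNear (rootOn e a b) x ∧ ∀ᶠ y in 𝓝 x, rootOn e a b y ∈ Ioo a b ∧
      e (y, rootOn e a b y) = 0 ∧ ∀ q ∈ Icc a b, e (y, q) = 0 → q = rootOn e a b y := by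
  have hmem : ∀ᶠ y in 𝓝 x, ∀ q ∈ Icc a b, SmoothNear e (y, q) ∧
      0 < fderiv ℝ e (y, q) (0, 1) := by
    refine isCompact_Icc.eventually_forall_of_forall_eventually fun q hq => ?_
    have h1 : ContinuousAt (fun z => fderiv ℝ e z (0, 1)) (x, q) :=
      (((hs q hq).contDiffAt.fderiv_right (m := 0) (by simp)).continuousAt).clm_apply
        continuousAt_const
    exact (hs q hq).eventually.and (h1.eventually (lt_mem_nhds (hd q hq)))
  have hea : ∀ᶠ y in 𝓝 x, e (y, a) < 0 := by
    have : ContinuousAt (fun y => e (y, a)) x :=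
      ContinuousAt.comp (f := fun y => (y, a)) (hs a (left_mem_Icc.2 hab)).continuousAt
        (by fun_prop)
    exact this.eventually (gt_mem_nhds ha)
  have heb : ∀ᶠ y in 𝓝 x, 0 < e (y, b) := by
    have : ContinuousAt (fun y => e (y, b)) x :=
      ContinuousAt.comp (f := fun y => (y, b)) (hs b (right_mem_Icc.2 hab)).continuousAt
        (by fun_prop)
    exact this.eventually (lt_mem_nhds hb)
  have hderiv : ∀ y q, DifferentiableAt ℝ e (y, q) →
      HasDerivAt (fun q => e (y, q)) (fderiv ℝ e (y, q) (0, 1)) q := by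
    intro y q h
    have h2 : HasDerivAt (fun q : ℝ => (y, q)) ((0 : E), (1 : ℝ)) q :=
      (hasDerivAt_const q y).prodMk (hasDerivAt_id q)
    exact h.hasFDerivAt.comp_hasDerivAt q h2
  have hmono : ∀ᶠ y in 𝓝 x, ContinuousOn (fun q => e (y, q)) (Icc a b) ∧
      StrictMonoOn (fun q => e (y, q)) (Icc a b) := by
    filter_upwards [hmem] with y hy
    have hc : ContinuousOn (fun q => e (y, q)) (Icc a b) := fun q hq =>
      (hderiv y q (hy q hq).1.differentiableAt).continuousAt.continuousWithinAt
    refine ⟨hc, strictMonoOn_of_deriv_pos (convex_Icc a b) hc fun q hq => ?_⟩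
    rw [(hderiv y q (hy q (interior_subset hq)).1.differentiableAt).deriv]
    exact (hy q (interior_subset hq)).2
  have hspec : ∀ᶠ y in 𝓝 x, rootOn e a b y ∈ Ioo a b ∧
      e (y, rootOn e a b y) = 0 ∧ ∀ q ∈ Icc a b, e (y, q) = 0 → q = rootOn e a b y := by
    filter_upwards [hmono, hea, heb] with y h1 h2 h3
    exact rootOn_spec hab h1.1 h1.2 h2 h3
  refine ⟨?_, hspec⟩
  filter_upwards [eventually_eventually_nhds.2 hspec, eventually_eventually_nhds.2 hmono, hmem,
    eventually_eventually_nhds.2 hmem] with y hy hym hys hys'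
  obtain ⟨hy1, hy2, hy3⟩ := hy.self_of_nhds
  set q₀ := rootOn e a b y
  -- the sign of `e` on either side of the root persists, which traps nearby roots
  have hcont : ContinuousAt (rootOn e a b) y := by
    have key : ∀ q ∈ Ioo a b, ContinuousAt (fun z => e (z, q)) y := fun q hq =>
      ContinuousAt.comp (f := fun z => (z, q))
        (hys q (Ioo_subset_Icc_self hq)).1.continuousAt (by fun_prop)
    refine tendsto_order.2 ⟨fun l hl => ?_, fun u hu => ?_⟩
    · obtain ⟨q, hq1, hq2⟩ := exists_between (max_lt hl hy1.1)
      have hq : q ∈ Ioo a b := ⟨(le_max_right _ _).trans_lt hq1, hq2.trans hy1.2⟩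
      have hneg : e (y, q) < 0 := by
        rw [← hy2]
        exact hym.self_of_nhds.2 (Ioo_subset_Icc_self hq) (Ioo_subset_Icc_self hy1) hq2
      filter_upwards [(key q hq).eventually (gt_mem_nhds hneg), hy, hym] with z h1 h2 h3
      refine ((le_max_left _ _).trans_lt hq1).trans ?_
      rw [← h2.2.1] at h1
      exact (h3.2.lt_iff_lt (Ioo_subset_Icc_self hq) (Ioo_subset_Icc_self h2.1)).1 h1
    · obtain ⟨q, hq1, hq2⟩ := exists_between (lt_min hu hy1.2)
      have hq : q ∈ Ioo a b := ⟨hy1.1.trans hq1, hq2.trans_le (min_le_right _ _)⟩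
      have hpos : 0 < e (y, q) := by
        rw [← hy2]
        exact hym.self_of_nhds.2 (Ioo_subset_Icc_self hy1) (Ioo_subset_Icc_self hq) hq1
      filter_upwards [(key q hq).eventually (lt_mem_nhds hpos), hy, hym] with z h1 h2 h3
      refine lt_trans ?_ (hq2.trans_le (min_le_left _ _))
      rw [← h2.2.1] at h1
      exact (h3.2.lt_iff_lt (Ioo_subset_Icc_self h2.1) (Ioo_subset_Icc_self hq)).1 h1
  have hq₀ := hys q₀ (Ioo_subset_Icc_self hy1)
  refine contDiffAt_of_implicit (f := e) hq₀.1.contDiffAt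
    (isInvertible_of_real hq₀.2.ne') hcont ?_
  filter_upwards [hy] with z hz
  rw [hz.2.1, hy2]

end Root

/-! ### Superposition operators on spaces of continuous functions -/

section Superposition

variable {K : Type} [TopologicalSpace K] [CompactSpace K]
  {E F G : Type} [NormedAddCommGroup E] [NormedSpace ℝ E]
  [NormedAddCommGroup F] [NormedSpace ℝ F]

/-- The pointwise application `(A, u) ↦ (k ↦ A k (u k))` of operator-valued functions. -/
noncomputable def pointwiseApply : C(K, E →L[ℝ] F) →L[ℝ] C(K, E) →L[ℝ] C(K, F) :=
  LinearMap.mkContinuous₂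
    (LinearMap.mk₂ ℝ (fun (A : C(K, E →L[ℝ] F)) (u : C(K, E)) =>
        (⟨fun k => A k (u k), A.continuous.clm_apply u.continuous⟩ : C(K, F)))
      (fun A B u => by ext k; simp) (fun c A u => by ext k; simp)
      (fun A u v => by ext k; simp) (fun c A u => by ext k; simp)) 1 (by
    intro A u
    rw [one_mul]
    refine (ContinuousMap.norm_le _ (by positivity)).2 fun k => ?_
    refine ((A k).le_opNorm (u k)).trans ?_
    gcongr
    · exact A.norm_coe_le_norm k
    · exact u.norm_coe_le_norm k)

theorem hasFDerivAt_comp_left {b : E → F} (hb : ContDiff ℝ ∞ b) (u : C(K, E)) :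
    HasFDerivAt (fun u : C(K, E) => (⟨b, hb.continuous⟩ : C(E, F)).comp u)
      (pointwiseApply ((⟨fderiv ℝ b, hb.continuous_fderiv (by simp)⟩ : C(E, E →L[ℝ] F)).comp u))
      u := by
  rw [hasFDerivAt_iff_isLittleO_nhds_zero, Asymptotics.isLittleO_iff]
  intro c hc
  have key : ∀ᶠ h : E in 𝓝 0, ∀ x ∈ range u, ‖b (x + h) - b x - fderiv ℝ b x h‖ ≤ c * ‖h‖ := by
    refine (isCompact_range u.continuous).eventually_forall_of_forall_eventually fun x _ => ?_
    have h1 := (hb.contDiffAt (x := x)).hasStrictFDerivAt (by simp)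
    have h2 := (Asymptotics.isLittleO_iff.1 h1.isLittleO) (half_pos hc)
    have h3 : Tendsto (fun z : E × E => (z.2 + z.1, z.2)) (𝓝 (0, x)) (𝓝 (x, x)) := by
      have : Continuous (fun z : E × E => (z.2 + z.1, z.2)) := by fun_prop
      simpa using this.tendsto (0, x)
    have h4 : ∀ᶠ z : E × E in 𝓝 (0, x), ‖fderiv ℝ b z.2 - fderiv ℝ b x‖ < c / 2 := by
      have : Continuous (fun z : E × E => ‖fderiv ℝ b z.2 - fderiv ℝ b x‖) := by
        have := hb.continuous_fderiv (by simp)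
        fun_prop
      exact this.continuousAt.eventually (gt_mem_nhds (by simpa using half_pos hc))
    filter_upwards [h3.eventually h2, h4] with z h5 h6
    simp only [add_sub_cancel_left] at h5
    have h7 := (fderiv ℝ b z.2 - fderiv ℝ b x).le_opNorm z.1
    have h8 : b (z.2 + z.1) - b z.2 - fderiv ℝ b z.2 z.1 =
        (b (z.2 + z.1) - b z.2 - fderiv ℝ b x z.1) -
          (fderiv ℝ b z.2 - fderiv ℝ b x) z.1 := by
      simp only [sub_apply]; abel
    rw [h8]
    refine (norm_sub_le _ _).trans ?_
    have : ‖fderiv ℝ b z.2 - fderiv ℝ b x‖ * ‖z.1‖ ≤ c / 2 * ‖z.1‖ := by gcongr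
    linarith
  obtain ⟨δ, hδ, hball⟩ := Metric.eventually_nhds_iff_ball.1 key
  filter_upwards [Metric.ball_mem_nhds 0 hδ] with h hh
  rw [mem_ball_zero_iff] at hh
  refine (ContinuousMap.norm_le _ (by positivity)).2 fun k => ?_
  have hk := h.norm_coe_le_norm k
  refine (hball (h k) (mem_ball_zero_iff.2 (hk.trans_lt hh)) (u k) ⟨k, rfl⟩).trans ?_
  gcongr

/-- The superposition operator `u ↦ b ∘ u` of a smooth map `b` is smooth: its derivative at `u` is
the pointwise application of the superposition operator of `Db`. -/
theorem contDiff_comp_left {b : E → F} (hb : ContDiff ℝ ∞ b) :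
    ContDiff ℝ ∞ (fun u : C(K, E) => (⟨b, hb.continuous⟩ : C(E, F)).comp u) := by
  rw [contDiff_infty]
  intro n
  induction n generalizing F with
  | zero =>
    exact contDiff_zero.2 (continuous_iff_continuousAt.2 fun u =>
      (hasFDerivAt_comp_left hb u).continuousAt)
  | succ n ih =>
    have : ((n + 1 : ℕ) : WithTop ℕ∞) = (n : WithTop ℕ∞) + 1 := by simp
    rw [this, contDiff_succ_iff_hasFDerivAt]
    refine ⟨_, ?_, fun u => hasFDerivAt_comp_left hb u⟩
    exact pointwiseApply.contDiff.comp (ih (hb.fderiv_right (m := ∞) (by simp)))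

/-- Constant functions, as a continuous linear map. -/
noncomputable def constL : E →L[ℝ] C(K, E) :=
  LinearMap.mkContinuous
    { toFun := fun x => ContinuousMap.const K x
      map_add' := fun x y => by ext; simp
      map_smul' := fun c x => by ext; simp } 1 (fun x => by
    refine (ContinuousMap.norm_le _ (by positivity)).2 fun k => ?_
    simp)

@[simp]
theorem constL_apply (x : E) (k : K) : constL x k = x := rfl

end Superposition

section Primitive

variable {E : Type} [NormedAddCommGroup E] [NormedSpace ℝ E]

/-- The primitive that vanishes at `0` of a continuous function on the unit interval. -/
noncomputable def primitiveL : C(unitInterval, E) →L[ℝ] C(unitInterval, E) :=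
  LinearMap.mkContinuous
    { toFun := fun u => ⟨fun θ => ∫ s in (0 : ℝ)..θ, u (projIcc 0 1 zero_le_one s), by
        have hc : Continuous fun s : ℝ => u (projIcc 0 1 zero_le_one s) :=
          u.continuous.comp continuous_projIcc
        exact (intervalIntegral.continuous_primitive
          (fun a b => hc.intervalIntegrable a b) 0).comp continuous_subtype_val⟩
      map_add' := fun u v => by
        ext θ
        have hc : ∀ u : C(unitInterval, E), Continuous fun s : ℝ =>
          u (projIcc 0 1 zero_le_one s) := fun u => u.continuous.comp continuous_projIcc
        exact intervalIntegral.integral_add ((hc u).intervalIntegrable _ _)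
          ((hc v).intervalIntegrable _ _)
      map_smul' := fun c u => by
        ext θ
        exact intervalIntegral.integral_smul c _ } 1 (fun u => by
    refine (ContinuousMap.norm_le _ (by positivity)).2 fun θ => ?_
    have := intervalIntegral.norm_integral_le_of_norm_le_const (a := 0) (b := (θ : ℝ))
      (f := fun s => u (projIcc 0 1 zero_le_one s)) (C := ‖u‖)
      (fun s _ => u.norm_coe_le_norm _)
    refine this.trans ?_
    rw [sub_zero, abs_of_nonneg θ.2.1, one_mul]
    exact mul_le_of_le_one_right (norm_nonneg _) θ.2.2)

theorem primitiveL_apply (u : C(unitInterval, E)) (θ : unitInterval) :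
    primitiveL u θ = ∫ s in (0 : ℝ)..θ, u (projIcc 0 1 zero_le_one s) := rfl

end Primitive

/-! ### Smoothness of difference quotients -/

section DSlope

variable {E F : Type} [NormedAddCommGroup E] [NormedSpace ℝ E]
  [NormedAddCommGroup F] [NormedSpace ℝ F]

theorem dslope_eq_integral [CompleteSpace F] {h : ℝ → F} (hh : ContDiff ℝ ∞ h) (s : ℝ) :
    dslope h 0 s = ∫ u in (0 : ℝ)..1, deriv h (u * s) := by
  by_cases hs : s = 0
  · subst hs; simp
  · have hd : ∀ u ∈ uIcc (0 : ℝ) 1, HasDerivAt (fun u => h (u * s)) (s • deriv h (u * s)) u := by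
      intro u _
      have h1 : HasDerivAt h (deriv h (u * s)) (u * s) :=
        (hh.differentiable (by simp)).differentiableAt.hasDerivAt
      exact h1.scomp u (by simpa using (hasDerivAt_id u).mul_const s)
    have hc : Continuous fun u : ℝ => deriv h (u * s) :=
      (hh.continuous_deriv (by simp)).comp (by fun_prop)
    have h2 := intervalIntegral.integral_eq_sub_of_hasDerivAt hd
      ((hc.const_smul s).intervalIntegrable 0 1)
    rw [intervalIntegral.integral_smul] at h2
    rw [dslope_of_ne _ hs, slope_def_module, sub_zero, ← one_mul s, ← zero_mul s, one_mul]
    simp only [one_mul, zero_mul] at h2 ⊢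
    rw [← h2, smul_smul, inv_mul_cancel₀ hs, one_smul]

/-- **Hadamard's lemma**: the difference quotient of a smooth function of `(s, x)` with respect to
its first argument is a smooth function of `(s, x)`, also at `s = 0`. -/
theorem contDiff_dslope [CompleteSpace F] {h : ℝ × E → F} (hh : ContDiff ℝ ∞ h) :
    ContDiff ℝ ∞ (fun z : ℝ × E => dslope (fun s => h (s, z.2)) 0 z.1) := by
  have hb : ContDiff ℝ ∞ fun z : ℝ × E => fderiv ℝ h z (1, 0) :=
    (hh.fderiv_right (m := ∞) (by simp)).clm_apply contDiff_const
  let ι : C(unitInterval, ℝ × E) := ⟨fun u => ((u : ℝ), 0), by fun_prop⟩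
  -- `(s, x) ↦ (u ↦ (u s, x))`
  let P : ℝ × E → C(unitInterval, ℝ × E) := fun z => z.1 • ι + constL ((0 : ℝ), z.2)
  have hP : ContDiff ℝ ∞ P :=
    (contDiff_fst.smul contDiff_const).add
      ((constL (K := unitInterval) (E := ℝ × E)).contDiff.comp
        (contDiff_const.prodMk contDiff_snd))
  have hall := ((ContinuousMap.evalCLM ℝ (1 : unitInterval) :
    C(unitInterval, F) →L[ℝ] F).contDiff.comp primitiveL.contDiff).comp
      ((contDiff_comp_left hb).comp hP)
  convert hall using 1
  ext z
  have hs : ContDiff ℝ ∞ fun s => h (s, z.2) := hh.comp (by fun_prop)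
  rw [dslope_eq_integral hs]
  simp only [Function.comp_apply, ContinuousMap.evalCLM_apply, primitiveL_apply]
  refine intervalIntegral.integral_congr fun u hu => ?_
  rw [uIcc_of_le zero_le_one] at hu
  have hd : HasDerivAt (fun s => h (s, z.2)) (fderiv ℝ h (u * z.1, z.2) (1, 0)) (u * z.1) :=
    ((hh.differentiable (by simp)).differentiableAt.hasFDerivAt).comp_hasDerivAt (u * z.1)
      ((hasDerivAt_id (u * z.1)).prodMk (hasDerivAt_const (u * z.1) z.2))
  rw [hd.deriv]
  simp [P, ι, projIcc_of_mem _ hu, mul_comm]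

theorem SmoothNear.dslope [FiniteDimensional ℝ E] [CompleteSpace F] {h : ℝ × E → F} {x : E}
    (hh : SmoothNear h (0, x)) :
    SmoothNear (fun z : ℝ × E => dslope (fun s => h (s, z.2)) 0 z.1) (0, x) := by
  obtain ⟨h', hs, he⟩ := hh.exists_contDiff
  refine ((contDiff_dslope hs).smoothNear _).congr ?_
  have h1 : ∀ᶠ z : ℝ × E in 𝓝 (0, x), (fun s => h (s, z.2)) =ᶠ[𝓝 0] fun s => h' (s, z.2) := by
    have h0 : Tendsto (fun z : ℝ × E => ((0 : ℝ), z.2)) (𝓝 (0, x)) (𝓝 (0, x)) :=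
      Continuous.tendsto (by fun_prop) _
    filter_upwards [h0.eventually he.eventuallyEq_nhds] with z hz
    have h2 : Tendsto (fun s : ℝ => (s, z.2)) (𝓝 0) (𝓝 ((0 : ℝ), z.2)) :=
      Continuous.tendsto (by fun_prop) _
    exact (h2.eventually hz).mono fun s hs => hs.symm
  filter_upwards [h1, he] with z hz hz'
  by_cases h0 : z.1 = 0
  · rw [h0, dslope_same, dslope_same, hz.deriv_eq]
  · rw [dslope_of_ne _ h0, dslope_of_ne _ h0, slope_def_module, slope_def_module,
      hz.eq_of_nhds]
    simp only [Prod.mk.eta, hz']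

end DSlope

/-! ### Smooth dependence of solutions on initial data -/

section Flow

variable {E : Type} [NormedAddCommGroup E] [NormedSpace ℝ E] [CompleteSpace E]

/-- A smooth autonomous vector field has a local flow that is smooth in time and initial data. The
flow is the endpoint of the solution of the integral equation on the unit interval obtained by
rescaling time, which the implicit function theorem provides near the time-scale `t = 0`. -/
theorem exists_smooth_flow {b : E → E} (hb : ContDiff ℝ ∞ b) (x₀ : E) :
    ∃ φ : E × ℝ → E, SmoothNear φ (x₀, 0) ∧ (∀ᶠ x in 𝓝 x₀, φ (x, 0) = x) ∧
      ∀ᶠ z in 𝓝 (x₀, (0 : ℝ)), HasDerivAt (fun t => φ (z.1, t)) (b (φ z)) z.2 := by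
  let N : C(unitInterval, E) → C(unitInterval, E) :=
    fun u => (⟨b, hb.continuous⟩ : C(E, E)).comp u
  let Ξ : (E × ℝ) × C(unitInterval, E) → C(unitInterval, E) :=
    fun q => q.2 - constL q.1.1 - q.1.2 • primitiveL (N q.2)
  have hN : ContDiff ℝ ∞ N := contDiff_comp_left hb
  have hΞ : ContDiff ℝ ∞ Ξ :=
    (contDiff_snd.sub (constL.contDiff.comp (contDiff_fst.comp contDiff_fst))).sub
      ((contDiff_snd.comp contDiff_fst).smul
        (primitiveL.contDiff.comp (hN.comp contDiff_snd)))
  let u₀ : C(unitInterval, E) := constL x₀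
  let q₀ : (E × ℝ) × C(unitInterval, E) := ((x₀, 0), u₀)
  have hΞ0 : Ξ q₀ = 0 := by simp [Ξ, q₀, u₀]
  have hid : fderiv ℝ Ξ q₀ ∘L .inr ℝ (E × ℝ) C(unitInterval, E) =
      ContinuousLinearMap.id ℝ C(unitInterval, E) := by
    have h1 : HasFDerivAt (fun u : C(unitInterval, E) => Ξ ((x₀, 0), u))
        (fderiv ℝ Ξ q₀ ∘L .inr ℝ (E × ℝ) C(unitInterval, E)) u₀ :=
      HasFDerivAt.comp u₀ (g := Ξ) (f := fun u => ((x₀, (0 : ℝ)), u))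
        (hΞ.differentiable (by simp)).differentiableAt.hasFDerivAt (hasFDerivAt_prodMk_right _ _)
    have h2 : (fun u : C(unitInterval, E) => Ξ ((x₀, 0), u)) = fun u => u - constL x₀ := by
      ext u; simp [Ξ]
    rw [h2] at h1
    exact h1.unique ((hasFDerivAt_id u₀).sub_const _)
  have hi : (fderiv ℝ Ξ q₀ ∘L .inr ℝ (E × ℝ) C(unitInterval, E)).IsInvertible := by
    rw [hid]; exact ⟨ContinuousLinearEquiv.refl ℝ _, rfl⟩
  obtain ⟨U, hUsm, hU0, hUu⟩ := exists_smooth_implicit (hΞ.smoothNear _) hΞ0 hi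
  have hUe : ∀ᶠ z in 𝓝 (x₀, (0 : ℝ)), Ξ (z, U z) = 0 := by
    have h3 : Tendsto (fun z => (z, U z)) (𝓝 (x₀, 0)) (𝓝 q₀) := by
      have := continuousAt_id.prodMk hUsm.continuousAt
      rwa [ContinuousAt, hU0] at this
    filter_upwards [h3.eventually hUu] with z hz
    exact hz.2 rfl
  let ev : C(unitInterval, E) →L[ℝ] E := ContinuousMap.evalCLM ℝ (1 : unitInterval)
  let φ : E × ℝ → E := fun z => U z 1
  have hφ : SmoothNear φ (x₀, 0) := (ev.contDiff.smoothNear _).comp hUsm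
  -- a ball for the parameters and one for the solutions, on which solutions are unique
  obtain ⟨R, hR, hball⟩ := Metric.eventually_nhds_iff_ball.1 hUu
  have hclose : ∀ᶠ z in 𝓝 (x₀, (0 : ℝ)), U z ∈ Metric.ball u₀ R :=
    hUsm.continuousAt.eventually (by rw [hU0]; exact Metric.ball_mem_nhds _ hR)
  obtain ⟨r, hr, hrb⟩ := Metric.eventually_nhds_iff_ball.1
    ((hclose.and hUe).and (hφ.and (Metric.ball_mem_nhds (x₀, (0 : ℝ)) hR)))
  have hresc : ∀ x t, (x, t) ∈ Metric.ball (x₀, (0 : ℝ)) r → ∀ θ : unitInterval,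
      U (x, t) θ = φ (x, θ * t) := by
    intro x t hxt θ
    obtain ⟨⟨h1, h2⟩, h3, h4⟩ := hrb _ hxt
    have hsc : Continuous fun θ' : unitInterval => θ * θ' := by fun_prop
    let w : C(unitInterval, E) := (U (x, t)).comp ⟨fun θ' => θ * θ', hsc⟩
    have hw : w ∈ Metric.ball u₀ R := by
      rw [mem_ball_iff_norm] at h1 ⊢
      refine lt_of_le_of_lt ((ContinuousMap.norm_le _ (norm_nonneg _)).2 fun k => ?_) h1
      exact (U (x, t) - u₀).norm_coe_le_norm (θ * k)
    have hθt : |(θ : ℝ) * t| ≤ |t| := by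
      rw [abs_mul, abs_of_nonneg θ.2.1]
      exact mul_le_of_le_one_left (abs_nonneg _) θ.2.2
    have hmem : ((x, (θ : ℝ) * t) : E × ℝ) ∈ Metric.ball (x₀, (0 : ℝ)) R := by
      have : ((x, t) : E × ℝ) ∈ Metric.ball (x₀, (0 : ℝ)) R := h4
      rw [Metric.mem_ball, Prod.dist_eq, max_lt_iff] at this ⊢
      refine ⟨this.1, lt_of_le_of_lt ?_ this.2⟩
      simpa using hθt
    have hwe : Ξ ((x, (θ : ℝ) * t), w) = 0 := by
      ext k
      have h5 : Ξ ((x, t), U (x, t)) (θ * k) = 0 := by rw [h2]; rfl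
      simp only [Ξ, ContinuousMap.sub_apply, constL_apply, ContinuousMap.smul_apply,
        primitiveL_apply, ContinuousMap.zero_apply] at h5 ⊢
      rw [← h5]
      have h6 : (U (x, t)) (θ * k) = w k := rfl
      rw [h6]
      congr 1
      rw [mul_comm (θ : ℝ) t, mul_smul]
      congr 1
      have h7 := intervalIntegral.smul_integral_comp_mul_left (a := 0) (b := (k : ℝ))
        (fun s => (N (U (x, t))) (projIcc 0 1 zero_le_one s)) (θ : ℝ)
      rw [mul_zero] at h7
      rw [show (((θ * k : unitInterval) : ℝ)) = (θ : ℝ) * k from rfl, ← h7]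
      congr 1
      refine intervalIntegral.integral_congr fun s hs => ?_
      rw [uIcc_of_le k.2.1] at hs
      have hs1 : s ∈ Icc (0 : ℝ) 1 := ⟨hs.1, hs.2.trans k.2.2⟩
      have hs2 : (θ : ℝ) * s ∈ Icc (0 : ℝ) 1 := (θ * ⟨s, hs1⟩ : unitInterval).2
      rw [projIcc_of_mem _ hs1, projIcc_of_mem _ hs2]
      rfl
    have hmem2 : (((x, (θ : ℝ) * t), w) : (E × ℝ) × C(unitInterval, E)) ∈ Metric.ball q₀ R := by
      rw [Metric.mem_ball, Prod.dist_eq, max_lt_iff]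
      exact ⟨hmem, hw⟩
    have h8 := (hball _ hmem2).1 hwe
    simp only at h8
    simp only [φ, h8]
    change U (x, t) θ = U (x, t) (θ * 1)
    rw [mul_one]
  have hint : ∀ x t, (x, t) ∈ Metric.ball (x₀, (0 : ℝ)) r →
      φ (x, t) = x + ∫ s in (0 : ℝ)..t, b (φ (x, s)) := by
    intro x t hxt
    obtain ⟨⟨_, h2⟩, -⟩ := hrb _ hxt
    have h5 : Ξ ((x, t), U (x, t)) 1 = 0 := by rw [h2]; rfl
    simp only [Ξ, ContinuousMap.sub_apply, constL_apply, ContinuousMap.smul_apply,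
        primitiveL_apply] at h5
    have h6 : U (x, t) 1 = φ (x, t) := rfl
    rw [h6, sub_sub, sub_eq_zero] at h5
    rw [h5]
    congr 1
    have h7 := intervalIntegral.smul_integral_comp_mul_left (a := 0) (b := (1 : ℝ))
        (fun s => b (φ (x, s))) t
    rw [mul_zero, mul_one] at h7
    rw [← h7]
    congr 1
    refine intervalIntegral.integral_congr fun s hs => ?_
    change s ∈ uIcc (0 : ℝ) 1 at hs
    rw [uIcc_of_le zero_le_one] at hs
    rw [projIcc_of_mem _ hs]
    change b (U (x, t) ⟨s, hs⟩) = _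
    rw [hresc x t hxt]
    simp [mul_comm]
  refine ⟨φ, hφ, ?_, ?_⟩
  · have h0 : Tendsto (fun x : E => (x, (0 : ℝ))) (𝓝 x₀) (𝓝 (x₀, 0)) :=
      Continuous.tendsto (by fun_prop) _
    filter_upwards [h0.eventually (Metric.ball_mem_nhds (x₀, (0 : ℝ)) hr)] with x hx
    rw [hint x 0 hx]
    simp
  · filter_upwards [Metric.ball_mem_nhds (x₀, (0 : ℝ)) hr] with z hz
    obtain ⟨x, t⟩ := z
    have hx : dist x x₀ < r ∧ |t| < r := by
      rw [Metric.mem_ball, Prod.dist_eq, max_lt_iff] at hz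
      simpa using hz
    have hin : ∀ s, |s| < r → ((x, s) : E × ℝ) ∈ Metric.ball (x₀, (0 : ℝ)) r := by
      intro s hs
      rw [Metric.mem_ball, Prod.dist_eq, max_lt_iff]
      simpa using ⟨hx.1, hs⟩
    have hcont : ∀ s, |s| < r → ContinuousAt (fun s => b (φ (x, s))) s := by
      intro s hs
      have h1 : ContinuousAt φ (x, s) := (hrb _ (hin s hs)).2.1.continuousAt
      exact hb.continuous.continuousAt.comp
        (ContinuousAt.comp (f := fun s => (x, s)) h1 (by fun_prop))
    have hopen : IsOpen {s : ℝ | |s| < r} := isOpen_lt continuous_abs continuous_const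
    have hd : HasDerivAt (fun t => ∫ s in (0 : ℝ)..t, b (φ (x, s))) (b (φ (x, t))) t := by
      refine intervalIntegral.integral_hasDerivAt_right ?_ ?_ (hcont t hx.2)
      · refine ContinuousOn.intervalIntegrable fun s hs => (hcont s ?_).continuousWithinAt
        have := abs_sub_left_of_mem_uIcc hs
        simp only [sub_zero] at this
        exact lt_of_le_of_lt this hx.2
      · exact ContinuousOn.stronglyMeasurableAtFilter hopen
          (fun s hs => (hcont s hs).continuousWithinAt) t hx.2
    have hd2 := hd.const_add x
    refine hd2.congr_of_eventuallyEq ?_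
    filter_upwards [hopen.mem_nhds hx.2] with s hs
    exact hint x s (hin s hs)

end Flow

/-! ### Limits of iterates near a normally attracting set of fixed points -/

section Attracting

variable {E F : Type} [NormedAddCommGroup E] [NormedSpace ℝ E]
  [NormedAddCommGroup F] [NormedSpace ℝ F]

/-- Near `(p₀, 0)` the points `(p, 0)` are fixed by the smooth map `H`, and `H` contracts the second
coordinate by a factor `k < 1`. -/
structure IsAttracting (H : E × F → E × F) (p₀ : E) : Prop where
  contDiff : ContDiff ℝ ∞ H
  fixed : ∀ᶠ p in 𝓝 p₀, H (p, 0) = (p, 0)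
  contract : ∃ k : ℝ, 0 ≤ k ∧ k < 1 ∧ ∀ᶠ x in 𝓝 (p₀, (0 : F)), ‖(H x).2‖ ≤ k * ‖x.2‖

namespace IsAttracting

variable {H : E × F → E × F} {p₀ : E}

omit [NormedSpace ℝ E] [NormedSpace ℝ F] in
theorem tendsto_proj : Tendsto (fun x : E × F => (x.1, (0 : F))) (𝓝 (p₀, 0)) (𝓝 (p₀, 0)) :=
  Continuous.tendsto (by fun_prop) _

theorem eventually (h : IsAttracting H p₀) : ∀ᶠ p in 𝓝 p₀, IsAttracting H p := by
  obtain ⟨k, hk0, hk1, hk⟩ := h.contract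
  have h1 : Tendsto (fun p : E => (p, (0 : F))) (𝓝 p₀) (𝓝 (p₀, 0)) :=
    Continuous.tendsto (by fun_prop) _
  filter_upwards [eventually_eventually_nhds.2 h.fixed,
    h1.eventually (eventually_eventually_nhds.2 hk)] with p hp1 hp2
  exact ⟨h.contDiff, hp1, k, hk0, hk1, hp2⟩

theorem displacement_le (h : IsAttracting H p₀) :
    ∃ C : ℝ, 0 ≤ C ∧ ∀ᶠ x in 𝓝 (p₀, (0 : F)), ‖H x - x‖ ≤ C * ‖x.2‖ := by
  have hs : ContDiff ℝ ∞ fun x => H x - x := h.contDiff.sub contDiff_id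
  obtain ⟨K, s, hs1, hs2⟩ := ((hs.contDiffAt (x := (p₀, (0 : F)))).hasStrictFDerivAt
    (by simp)).exists_lipschitzOnWith
  refine ⟨K, K.2, ?_⟩
  have hfix : ∀ᶠ x in 𝓝 (p₀, (0 : F)), H (x.1, 0) = (x.1, 0) :=
    (continuous_fst.tendsto (p₀, (0 : F))).eventually h.fixed
  filter_upwards [hs1, tendsto_proj hs1, hfix] with x h1 h2 h3
  have := hs2.dist_le_mul x h1 (x.1, 0) h2
  rw [dist_eq_norm, h3, sub_self, sub_zero, dist_eq_norm] at this
  refine this.trans (le_of_eq ?_)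
  congr 1
  rw [Prod.norm_def]
  simp

/-- Orbits that start near `(p₀, 0)` stay near it, and their steps decrease geometrically. -/
theorem orbit_bounds (h : IsAttracting H p₀) {W : Set (E × F)} (hW : W ∈ 𝓝 (p₀, (0 : F))) :
    ∃ k C : ℝ, 0 ≤ k ∧ k < 1 ∧ 0 ≤ C ∧ ∀ᶠ x in 𝓝 (p₀, (0 : F)), ∀ n : ℕ,
      H^[n] x ∈ W ∧ ‖(H^[n] x).2‖ ≤ C * k ^ n ∧ dist (H^[n] x) (H^[n + 1] x) ≤ C * k ^ n := by
  obtain ⟨k, hk0, hk1, hk⟩ := h.contract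
  obtain ⟨C, hC0, hC⟩ := h.displacement_le
  obtain ⟨R, hR, hball⟩ := Metric.eventually_nhds_iff_ball.1 ((hk.and hC).and hW)
  have h1k : 0 < 1 - k := by linarith
  set ρ := min 1 (R / (1 + C / (1 - k)) / 2) with hρ
  have hA : 0 < 1 + C / (1 - k) := by positivity
  have hρ0 : 0 < ρ := by positivity
  have hρR : ρ * (1 + C / (1 - k)) < R := by
    have : ρ ≤ R / (1 + C / (1 - k)) / 2 := min_le_right _ _
    rw [div_div, le_div_iff₀ (by positivity)] at this
    nlinarith
  refine ⟨k, max 1 C, hk0, hk1, by positivity, ?_⟩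
  filter_upwards [Metric.ball_mem_nhds (p₀, (0 : F)) hρ0] with x hx
  rw [mem_ball_iff_norm] at hx
  have hx2 : ‖x.2‖ < ρ := by
    refine lt_of_le_of_lt ?_ hx
    simpa using norm_snd_le (x - (p₀, (0 : F)))
  have main : ∀ n : ℕ, H^[n] x ∈ Metric.ball (p₀, (0 : F)) R ∧ ‖(H^[n] x).2‖ ≤ k ^ n * ‖x.2‖ ∧
      ‖H^[n] x - x‖ ≤ C * ‖x.2‖ * ∑ i ∈ Finset.range n, k ^ i := by
    have hgeo : ∀ n, ∑ i ∈ Finset.range n, k ^ i ≤ 1 / (1 - k) := by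
      intro n
      rw [geom_sum_eq hk1.ne, ← neg_div_neg_eq, neg_sub, neg_sub]
      gcongr
      have := pow_nonneg hk0 n
      linarith
    have hball' : ∀ n, ‖H^[n] x - x‖ ≤ C * ‖x.2‖ * ∑ i ∈ Finset.range n, k ^ i →
        H^[n] x ∈ Metric.ball (p₀, (0 : F)) R := by
      intro n hn
      rw [mem_ball_iff_norm]
      have h1 : C * ‖x.2‖ * ∑ i ∈ Finset.range n, k ^ i ≤ C * ρ * (1 / (1 - k)) := by
        gcongr
        exact hgeo n
      have h2 : ‖H^[n] x - (p₀, 0)‖ ≤ ‖H^[n] x - x‖ + ‖x - (p₀, 0)‖ :=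
        norm_sub_le_norm_sub_add_norm_sub _ _ _
      calc _ ≤ C * ρ * (1 / (1 - k)) + ρ := by linarith
        _ = ρ * (1 + C / (1 - k)) := by ring
        _ < R := hρR
    intro n
    induction n with
    | zero =>
      refine ⟨hball' 0 (by simp), by simp, by simp⟩
    | succ n ih =>
      obtain ⟨h1, h2, h3⟩ := ih
      have h4 := (hball _ h1).1
      have h5 : ‖H^[n + 1] x - x‖ ≤ C * ‖x.2‖ * ∑ i ∈ Finset.range (n + 1), k ^ i := by
        rw [Function.iterate_succ_apply', Finset.sum_range_succ, mul_add]
        have h6 : ‖H (H^[n] x) - x‖ ≤ ‖H (H^[n] x) - H^[n] x‖ + ‖H^[n] x - x‖ :=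
          norm_sub_le_norm_sub_add_norm_sub _ _ _
        have h7 : C * ‖(H^[n] x).2‖ ≤ C * (k ^ n * ‖x.2‖) := by gcongr
        have h8 := h4.2
        nlinarith
      refine ⟨hball' _ h5, ?_, h5⟩
      rw [Function.iterate_succ_apply', pow_succ']
      refine h4.1.trans ?_
      rw [mul_assoc]
      gcongr
  intro n
  obtain ⟨h1, h2, h3⟩ := main n
  have h4 := hball _ h1
  have hρ1 : ρ ≤ 1 := min_le_left _ _
  have h5 : ‖(H^[n] x).2‖ ≤ k ^ n := h2.trans (mul_le_of_le_one_right (by positivity) (by linarith))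
  refine ⟨h4.2, h5.trans ?_, ?_⟩
  · exact le_mul_of_one_le_left (by positivity) (le_max_left _ _)
  · rw [Function.iterate_succ_apply', dist_comm, dist_eq_norm]
    refine h4.1.2.trans ?_
    gcongr
    exact le_max_right _ _

theorem exists_tendsto [CompleteSpace E] [CompleteSpace F] (h : IsAttracting H p₀) :
    ∃ L : E × F → E, ∀ᶠ x in 𝓝 (p₀, (0 : F)), Tendsto (fun n => H^[n] x) atTop (𝓝 (L x, 0)) := by
  obtain ⟨k, C, hk0, hk1, hC0, hx⟩ := h.orbit_bounds univ_mem
  have : ∀ x : E × F, ∃ p : E, (∀ n : ℕ, H^[n] x ∈ (univ : Set (E × F)) ∧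
      ‖(H^[n] x).2‖ ≤ C * k ^ n ∧ dist (H^[n] x) (H^[n + 1] x) ≤ C * k ^ n) →
      Tendsto (fun n => H^[n] x) atTop (𝓝 (p, 0)) := by
    intro x
    by_cases hx : ∀ n : ℕ, H^[n] x ∈ (univ : Set (E × F)) ∧
      ‖(H^[n] x).2‖ ≤ C * k ^ n ∧ dist (H^[n] x) (H^[n + 1] x) ≤ C * k ^ n
    · obtain ⟨q, hq⟩ := cauchySeq_tendsto_of_complete
        (cauchySeq_of_le_geometric k C hk1 fun n => (hx n).2.2)
      refine ⟨q.1, fun _ => ?_⟩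
      have h2 : Tendsto (fun n => (H^[n] x).2) atTop (𝓝 q.2) := (continuous_snd.tendsto q).comp hq
      have h3 : Tendsto (fun n => (H^[n] x).2) atTop (𝓝 0) := by
        refine squeeze_zero_norm (fun n => (hx n).2.1) ?_
        simpa using (tendsto_pow_atTop_nhds_zero_of_lt_one hk0 hk1).const_mul C
      rw [← tendsto_nhds_unique h2 h3]
      exact hq
    · exact ⟨0, fun h => absurd h hx⟩
  choose L hL using this
  exact ⟨L, hx.mono fun x hx => hL x hx⟩

theorem rate (h : IsAttracting H p₀) {L : E × F → E}
    (hL : ∀ᶠ x in 𝓝 (p₀, (0 : F)), Tendsto (fun n => H^[n] x) atTop (𝓝 (L x, 0))) :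
    ∃ k C : ℝ, 0 ≤ k ∧ k < 1 ∧ 0 ≤ C ∧
      ∀ᶠ x in 𝓝 (p₀, (0 : F)), ∀ n : ℕ, ‖(H^[n] x).1 - L x‖ ≤ C * k ^ n := by
  obtain ⟨k, C, hk0, hk1, hC0, hx⟩ := h.orbit_bounds univ_mem
  have h1k : 0 < 1 - k := by linarith
  refine ⟨k, C / (1 - k), hk0, hk1, by positivity, ?_⟩
  filter_upwards [hx, hL] with x h1 h2 n
  have h3 := dist_le_of_le_geometric_of_tendsto k C hk1 (fun n => (h1 n).2.2) h2 n
  rw [dist_eq_norm] at h3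
  refine (norm_fst_le _).trans (h3.trans (le_of_eq ?_))
  ring

/-- The tangent map of `H`, with the coordinates ordered so that the base coordinate and its
variation come before the contracted coordinate and its variation. -/
noncomputable def tangentMap (H : E × F → E × F) (z : (E × E) × (F × F)) : (E × E) × (F × F) :=
  (((H (z.1.1, z.2.1)).1, (fderiv ℝ H (z.1.1, z.2.1) (z.1.2, z.2.2)).1),
    ((H (z.1.1, z.2.1)).2, (fderiv ℝ H (z.1.1, z.2.1) (z.1.2, z.2.2)).2))

theorem contDiff_iterate (hH : ContDiff ℝ ∞ H) (n : ℕ) : ContDiff ℝ ∞ H^[n] := by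
  induction n with
  | zero => exact contDiff_id
  | succ n ih => rw [Function.iterate_succ']; exact hH.comp ih

theorem iterate_tangentMap (hH : ContDiff ℝ ∞ H) (n : ℕ) (z : (E × E) × (F × F)) :
    (tangentMap H)^[n] z = tangentMap (H^[n]) z := by
  induction n with
  | zero => simp [tangentMap, fderiv_id]
  | succ n ih =>
    rw [Function.iterate_succ_apply', ih, Function.iterate_succ']
    have : fderiv ℝ (H ∘ H^[n]) (z.1.1, z.2.1) =
        (fderiv ℝ H (H^[n] (z.1.1, z.2.1))).comp (fderiv ℝ H^[n] (z.1.1, z.2.1)) :=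
      fderiv_comp _ (hH.differentiable (by simp)).differentiableAt
        ((contDiff_iterate hH n).differentiable (by simp)).differentiableAt
    simp [tangentMap, this]

theorem tangent (h : IsAttracting H p₀) : IsAttracting (tangentMap H) (p₀, (0 : E)) := by
  have hd : ContDiff ℝ ∞ (fderiv ℝ H) := h.contDiff.fderiv_right (by simp)
  have hfd : ∀ x, HasFDerivAt H (fderiv ℝ H x) x := fun x =>
    (h.contDiff.differentiable (by simp)).differentiableAt.hasFDerivAt
  have hbase : ContDiff ℝ ∞ fun z : (E × E) × (F × F) => (z.1.1, z.2.1) := by fun_prop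
  have hvar : ContDiff ℝ ∞ fun z : (E × E) × (F × F) =>
      fderiv ℝ H (z.1.1, z.2.1) (z.1.2, z.2.2) :=
    (hd.comp hbase).clm_apply (by fun_prop)
  have hH := h.contDiff.comp hbase
  have hdfix : ∀ᶠ p in 𝓝 p₀, ∀ δ : E, fderiv ℝ H (p, 0) (δ, 0) = (δ, 0) := by
    filter_upwards [eventually_eventually_nhds.2 h.fixed] with p hp δ
    have h1 : HasFDerivAt (fun p : E => H (p, 0))
        ((fderiv ℝ H (p, 0)).comp (.inl ℝ E F)) p :=
      (hfd (p, 0)).comp p (hasFDerivAt_prodMk_left p (0 : F))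
    have h2 : HasFDerivAt (fun p : E => H (p, 0)) (.inl ℝ E F) p :=
      (hasFDerivAt_prodMk_left p (0 : F)).congr_of_eventuallyEq hp
    exact DFunLike.congr_fun (h1.unique h2) δ
  refine ⟨(hH.fst.prodMk hvar.fst).prodMk (hH.snd.prodMk hvar.snd), ?_, ?_⟩
  · have hf : Tendsto (fun P : E × E => P.1) (𝓝 (p₀, 0)) (𝓝 p₀) := continuous_fst.tendsto _
    filter_upwards [hf.eventually h.fixed, hf.eventually hdfix] with P h1 h2
    simp [tangentMap, h1, h2]
  -- The second component of `DH(p, y)(δ, η)` is at most `k |η| + K |y| |(δ, η)|`, as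
  -- `DH(p, 0)(δ, 0) = (δ, 0)`. Since only small variations occur, `|(δ, η)| < ε`, this is a
  -- contraction in `(y, η)`.
  · obtain ⟨k, hk0, hk1, hk⟩ := h.contract
    obtain ⟨K, s, hs1, hs2⟩ := ((hd.contDiffAt (x := (p₀, (0 : F)))).hasStrictFDerivAt
      (by simp)).exists_lipschitzOnWith
    have hnormal : ∀ᶠ p in 𝓝 p₀, ∀ η : F, ‖(fderiv ℝ H (p, 0) (0, η)).2‖ ≤ k * ‖η‖ := by
      have hc : Tendsto (fun p : E => (p, (0 : F))) (𝓝 p₀) (𝓝 (p₀, 0)) :=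
        Continuous.tendsto (by fun_prop) _
      filter_upwards [hc.eventually (eventually_eventually_nhds.2 hk), h.fixed] with p hp hp0 η
      have h1 : HasFDerivAt (fun y : F => (H (p, y)).2) ((ContinuousLinearMap.snd ℝ E F).comp
          ((fderiv ℝ H (p, 0)).comp (.inr ℝ E F))) 0 :=
        (ContinuousLinearMap.snd ℝ E F).hasFDerivAt.comp (0 : F)
          ((hfd (p, 0)).comp (0 : F) (hasFDerivAt_prodMk_right p (0 : F)))
      have hc2 : Tendsto (fun y : F => (p, y)) (𝓝 0) (𝓝 (p, 0)) :=
        Continuous.tendsto (by fun_prop) _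
      have h2 := h1.le_of_lip' hk0 (by
        filter_upwards [hc2.eventually hp] with y hy
        simpa [hp0] using hy)
      exact ((((ContinuousLinearMap.snd ℝ E F).comp ((fderiv ℝ H (p, 0)).comp
        (.inr ℝ E F))).le_opNorm η)).trans (by gcongr)
    obtain ⟨ε, hε0, hε1⟩ : ∃ ε : ℝ, 0 < ε ∧ k + K * ε < 1 := by
      refine ⟨(1 - k) / (2 * (K + 1)), div_pos (by linarith) (by positivity), ?_⟩
      have hK : (0 : ℝ) ≤ K := K.2
      have : (K : ℝ) * ((1 - k) / (2 * (K + 1))) ≤ (1 - k) / 2 := by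
        rw [mul_div_assoc', div_le_div_iff₀ (by positivity) (by positivity)]
        nlinarith
      linarith
    refine ⟨k + K * ε, by positivity, hε1, ?_⟩
    have hb : Tendsto (fun z : (E × E) × (F × F) => (z.1.1, z.2.1)) (𝓝 ((p₀, 0), 0))
        (𝓝 (p₀, 0)) := Continuous.tendsto (by fun_prop) _
    have hb1 : Tendsto (fun z : (E × E) × (F × F) => z.1.1) (𝓝 ((p₀, 0), 0))
        (𝓝 p₀) := Continuous.tendsto (by fun_prop) _
    have hvar0 : ∀ᶠ z : (E × E) × (F × F) in 𝓝 ((p₀, 0), 0), ‖(z.1.2, z.2.2)‖ < ε := by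
      have : Continuous fun z : (E × E) × (F × F) => ‖(z.1.2, z.2.2)‖ := by fun_prop
      exact this.continuousAt.eventually (gt_mem_nhds (by simpa using hε0))
    filter_upwards [hb.eventually hk, hb hs1, hb (tendsto_proj hs1), hb1.eventually hnormal,
      hb1.eventually hdfix, hvar0] with z h1 h2 h3 h4 h5 h6
    obtain ⟨⟨p, δ⟩, ⟨y, η⟩⟩ := z
    simp only [tangentMap] at h1 h2 h3 h4 h5 h6 ⊢
    have hn : ‖((y, η) : F × F)‖ = max ‖y‖ ‖η‖ := rfl
    have hsplit : (fderiv ℝ H (p, y) (δ, η)).2 = (fderiv ℝ H (p, 0) (0, η)).2 +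
        ((fderiv ℝ H (p, y) - fderiv ℝ H (p, 0)) (δ, η)).2 := by
      have h7 : fderiv ℝ H (p, 0) (δ, η) = fderiv ℝ H (p, 0) (δ, 0) + fderiv ℝ H (p, 0) (0, η) := by
        rw [← map_add]; simp
      rw [sub_apply, h7, h5 δ]
      simp
    have hdiff : ‖((fderiv ℝ H (p, y) - fderiv ℝ H (p, 0)) (δ, η)).2‖ ≤ K * ‖y‖ * ε := by
      refine (norm_snd_le _).trans ((ContinuousLinearMap.le_opNorm _ _).trans ?_)
      have h8 := hs2.dist_le_mul _ h2 _ h3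
      rw [dist_eq_norm, dist_eq_norm] at h8
      have h9 : ‖((p, y) : E × F) - (p, 0)‖ = ‖y‖ := by simp [Prod.norm_def]
      rw [h9] at h8
      gcongr
    rw [Prod.norm_def (x := ((H (p, y)).2, _)), hn]
    have hy : ‖y‖ ≤ max ‖y‖ ‖η‖ := le_max_left _ _
    have hη : ‖η‖ ≤ max ‖y‖ ‖η‖ := le_max_right _ _
    have hKε : 0 ≤ K * ε := by positivity
    refine max_le (h1.trans ?_) ?_
    · nlinarith [norm_nonneg y]
    · change ‖(fderiv ℝ H (p, y) (δ, η)).2‖ ≤ _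
      rw [hsplit]
      refine (norm_add_le _ _).trans ((add_le_add (h4 η) hdiff).trans ?_)
      nlinarith [norm_nonneg y]

/-- The limit of the iterates is `C^m` at the fixed points: its derivative is the limit of the
derivatives of the iterates, hence a component of the limit of the iterates of the tangent map, to
which the statement for `m - 1` applies. -/
theorem contDiffAt_limit (m : ℕ) {E F : Type} [NormedAddCommGroup E] [NormedSpace ℝ E]
    [NormedAddCommGroup F] [NormedSpace ℝ F] [FiniteDimensional ℝ E] [FiniteDimensional ℝ F]
    {H : E × F → E × F} {p₀ : E} (h : IsAttracting H p₀) {L : E × F → E}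
    (hL : ∀ᶠ x in 𝓝 (p₀, (0 : F)), Tendsto (fun n => H^[n] x) atTop (𝓝 (L x, 0))) :
    ContDiffAt ℝ m L (p₀, 0) := by
  induction m generalizing E F with
  | zero =>
    obtain ⟨k, C, hk0, hk1, hC0, hr⟩ := h.rate hL
    refine contDiffAt_zero.2 ⟨_, hr, ?_⟩
    refine TendstoUniformlyOn.continuousOn (F := fun n x => (H^[n] x).1) (p := atTop) ?_ ?_
    · rw [Metric.tendstoUniformlyOn_iff]
      intro ε hε
      have h1 : Tendsto (fun n : ℕ => C * k ^ n) atTop (𝓝 0) := by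
        simpa using (tendsto_pow_atTop_nhds_zero_of_lt_one hk0 hk1).const_mul C
      filter_upwards [h1.eventually (gt_mem_nhds hε)] with n hn x hx
      rw [dist_comm, dist_eq_norm]
      exact (hx n).trans_lt hn
    · exact Frequently.of_forall fun n =>
        (contDiff_iterate h.contDiff n).continuous.fst.continuousOn
  | succ m ih =>
    have : CompleteSpace E := FiniteDimensional.complete ℝ E
    have : CompleteSpace F := FiniteDimensional.complete ℝ F
    obtain ⟨L', hL'⟩ := h.tangent.exists_tendsto
    have hsm := ih h.tangent hL'
    obtain ⟨k, C, hk0, hk1, hC0, hr⟩ := h.tangent.rate hL'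
    have hsm' : ∀ᶠ z in 𝓝 ((p₀, (0 : E)), (0 : F × F)), ContDiffAt ℝ m L' z :=
      hsm.eventually (by simp)
    obtain ⟨R, hR, hball⟩ := Metric.eventually_nhds_iff_ball.1 ((hr.and hsm').and hL')
    obtain ⟨R', hR', hball'⟩ := Metric.eventually_nhds_iff_ball.1 hL
    set ρ := min R R' with hρ
    have hρ0 : 0 < ρ := lt_min hR hR'
    let D : ℕ → E × F → E × F →L[ℝ] E := fun n x =>
      (ContinuousLinearMap.fst ℝ E F).comp (fderiv ℝ H^[n] x)
    have hD : ∀ n x, HasFDerivAt (fun x => (H^[n] x).1) (D n x) x := fun n x =>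
      (ContinuousLinearMap.fst ℝ E F).hasFDerivAt.comp x
        ((contDiff_iterate h.contDiff n).differentiable (by simp)).differentiableAt.hasFDerivAt
    have hmem : ∀ x ∈ Metric.ball (p₀, (0 : F)) ρ, ∀ δ : E × F, ‖δ‖ < ρ →
        ((x.1, δ.1), (x.2, δ.2)) ∈ Metric.ball ((p₀, (0 : E)), (0 : F × F)) R := by
      intro x hx δ hδ
      have hρR : ρ ≤ R := min_le_left _ _
      rw [Prod.norm_def, max_lt_iff] at hδ
      rw [Metric.mem_ball, Prod.dist_eq, max_lt_iff] at hx
      rw [Metric.mem_ball, Prod.dist_eq, max_lt_iff, Prod.dist_eq, Prod.dist_eq, max_lt_iff,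
        max_lt_iff]
      simp only [dist_zero_right, Prod.fst_zero, Prod.snd_zero] at hx ⊢
      refine ⟨⟨?_, ?_⟩, ?_, ?_⟩ <;> linarith [hx.1, hx.2, hδ.1, hδ.2]
    have hrate : ∀ x ∈ Metric.ball (p₀, (0 : F)) ρ, ∀ δ : E × F, ‖δ‖ < ρ → ∀ n,
        ‖D n x δ - (L' ((x.1, δ.1), (x.2, δ.2))).2‖ ≤ C * k ^ n := by
      intro x hx δ hδ n
      have h1 := (hball _ (hmem x hx δ hδ)).1.1 n
      rw [iterate_tangentMap h.contDiff] at h1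
      refine le_trans ?_ h1
      exact norm_snd_le (((tangentMap H^[n] ((x.1, δ.1), (x.2, δ.2))).1) -
        L' ((x.1, δ.1), (x.2, δ.2)))
    -- The rate for variations of a fixed size gives a rate in the operator norm.
    have hop : ∀ x ∈ Metric.ball (p₀, (0 : F)) ρ, ∀ n j, n ≤ j →
        ‖D n x - D j x‖ ≤ 2 * C * 2 / ρ * k ^ n := by
      intro x hx n j hnj
      refine ContinuousLinearMap.opNorm_le_of_shell (c := (2 : ℝ)) hρ0 (by positivity) (by simp)
        fun δ h1 h2 => ?_
      have h3 := hrate x hx δ h2 n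
      have h4 := hrate x hx δ h2 j
      have h5 : k ^ j ≤ k ^ n := pow_le_pow_of_le_one hk0 hk1.le hnj
      have h6 : ‖(D n x - D j x) δ‖ ≤ 2 * C * k ^ n := by
        have h7 : (D n x - D j x) δ = (D n x δ - (L' ((x.1, δ.1), (x.2, δ.2))).2) -
            (D j x δ - (L' ((x.1, δ.1), (x.2, δ.2))).2) := by
          rw [sub_apply]; abel
        rw [h7]
        refine (norm_sub_le _ _).trans ?_
        nlinarith
      refine h6.trans ?_
      rw [Real.norm_two, div_le_iff₀ (by norm_num)] at h1
      have h8 : 2 * C * 2 / ρ * k ^ n * ‖δ‖ = 2 * C * k ^ n * (‖δ‖ * 2 / ρ) := by ring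
      rw [h8]
      refine le_mul_of_one_le_right (by positivity) ?_
      rwa [le_div_iff₀ hρ0, one_mul]
    have hgeom : Tendsto (fun n : ℕ => 2 * C * 2 / ρ * k ^ n) atTop (𝓝 0) := by
      simpa using (tendsto_pow_atTop_nhds_zero_of_lt_one hk0 hk1).const_mul (2 * C * 2 / ρ)
    have hex : ∀ x, ∃ A : E × F →L[ℝ] E, x ∈ Metric.ball (p₀, (0 : F)) ρ →
        Tendsto (fun n => D n x) atTop (𝓝 A) := by
      intro x
      by_cases hx : x ∈ Metric.ball (p₀, (0 : F)) ρ
      · obtain ⟨A, hA⟩ := cauchySeq_tendsto_of_complete (u := fun n => D n x)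
          (cauchySeq_of_le_tendsto_0' _ (fun n j hnj => by
            rw [dist_eq_norm]; exact hop x hx n j hnj) hgeom)
        exact ⟨A, fun _ => hA⟩
      · exact ⟨0, fun h => absurd h hx⟩
    choose A hA using hex
    have hAval : ∀ x ∈ Metric.ball (p₀, (0 : F)) ρ, ∀ δ : E × F, ‖δ‖ < ρ →
        A x δ = (L' ((x.1, δ.1), (x.2, δ.2))).2 := by
      intro x hx δ hδ
      have h1 : Tendsto (fun n => D n x δ) atTop (𝓝 (A x δ)) :=
        ((continuous_eval_const δ).tendsto (A x)).comp (hA x hx)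
      refine tendsto_nhds_unique h1 ?_
      rw [tendsto_iff_norm_sub_tendsto_zero]
      refine squeeze_zero (fun _ => norm_nonneg _) (hrate x hx δ hδ) ?_
      simpa using (tendsto_pow_atTop_nhds_zero_of_lt_one hk0 hk1).const_mul C
    have hderiv : ∀ x ∈ Metric.ball (p₀, (0 : F)) ρ, HasFDerivAt L (A x) x := by
      intro x hx
      refine hasFDerivAt_of_tendstoUniformlyOn (l := atTop) (f := fun n x => (H^[n] x).1)
        (f' := D) Metric.isOpen_ball ?_ (fun n x _ => hD n x) ?_ hx
      · rw [Metric.tendstoUniformlyOn_iff]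
        intro ε hε
        filter_upwards [hgeom.eventually (gt_mem_nhds hε)] with n hn x hx
        rw [dist_comm]
        refine lt_of_le_of_lt ?_ hn
        refine le_of_tendsto (((continuous_const.dist continuous_id).tendsto (A x)).comp
          (hA x hx)) ?_
        filter_upwards [eventually_ge_atTop n] with j hj
        simp only [Function.comp_apply, id_eq, dist_eq_norm]
        exact hop x hx n j hj
      · intro x hx
        exact (continuous_fst.tendsto _).comp
          (hball' x (Metric.ball_subset_ball (min_le_right _ _) hx))
    have hcast : ((m + 1 : ℕ) : WithTop ℕ∞) = (m : WithTop ℕ∞) + 1 := by simp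
    rw [hcast, contDiffAt_succ_iff_hasFDerivAt]
    have hnhds := Metric.ball_mem_nhds (p₀, (0 : F)) hρ0
    refine ⟨A, ⟨_, hnhds, hderiv⟩, ?_⟩
    have hAon : ContDiffOn ℝ m A (Metric.ball (p₀, (0 : F)) ρ) := by
      refine contDiffOn_clm_apply.2 fun δ => ?_
      -- `L'` is controlled at small variations only, and `A x` is linear
      set c : ℝ := ρ / (2 * (‖δ‖ + 1)) with hc
      have hc0 : 0 < c := by positivity
      have hcδ : ‖c • δ‖ < ρ := by
        rw [norm_smul, Real.norm_of_nonneg hc0.le, hc, div_mul_eq_mul_div,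
          div_lt_iff₀ (by positivity)]
        nlinarith [norm_nonneg δ]
      have hon : ContDiffOn ℝ m (fun x : E × F => c⁻¹ •
          (L' ((x.1, (c • δ).1), (x.2, (c • δ).2))).2) (Metric.ball (p₀, (0 : F)) ρ) := by
        intro x hx
        have h1 := (hball _ (hmem x hx _ hcδ)).1.2
        have h2 : ContDiffAt ℝ m (fun x : E × F => ((x.1, (c • δ).1), (x.2, (c • δ).2))) x := by
          fun_prop
        have h3 : ContDiffAt ℝ m (fun x : E × F => L' ((x.1, (c • δ).1), (x.2, (c • δ).2))) x :=
          ContDiffAt.comp x h1 h2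
        exact (h3.snd.const_smul c⁻¹).contDiffWithinAt
      refine hon.congr fun x hx => ?_
      rw [← hAval x hx _ hcδ, map_smul, smul_smul, inv_mul_cancel₀ hc0.ne', one_smul]
    exact hAon.contDiffAt hnhds

/-- One neighbourhood serves all orders `m`: a point near `(p₀, 0)` is carried by an iterate `Hⁿ` so
close to the fixed point `(p, 0)` to which it converges that the limit is `C^m` there. -/
theorem smoothNear_limit [FiniteDimensional ℝ E] [FiniteDimensional ℝ F]
    (h : IsAttracting H p₀) {L : E × F → E}
    (hL : ∀ᶠ x in 𝓝 (p₀, (0 : F)), Tendsto (fun n => H^[n] x) atTop (𝓝 (L x, 0))) :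
    SmoothNear L (p₀, 0) := by
  obtain ⟨_, _, _, _, _, horb⟩ := h.orbit_bounds hL
  have hp : L (p₀, 0) = p₀ := by
    have h1 := hL.self_of_nhds
    have h2 : ∀ n : ℕ, H^[n] (p₀, 0) = (p₀, (0 : F)) := fun n =>
      Function.iterate_fixed h.fixed.self_of_nhds n
    simp only [h2] at h1
    exact (congrArg Prod.fst (tendsto_nhds_unique tendsto_const_nhds h1)).symm
  have hc : ContinuousAt L (p₀, 0) := (h.contDiffAt_limit 0 hL).continuousAt
  have hc' : Tendsto (fun x => (L x, (0 : F))) (𝓝 (p₀, 0)) (𝓝 (p₀, 0)) := by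
    have := hc.prodMk (continuousAt_const (y := (0 : F)))
    rwa [ContinuousAt, hp] at this
  have hc1 : Tendsto L (𝓝 (p₀, 0)) (𝓝 p₀) := by
    have := hc.tendsto
    rwa [hp] at this
  filter_upwards [hL.and (eventually_eventually_nhds.2 (hL.and horb)), hc1.eventually h.eventually,
    hc'.eventually (eventually_eventually_nhds.2 hL)] with x h1 h2 h3
  rw [contDiffAt_infty]
  intro m
  have h4 : ∀ᶠ y in 𝓝 (L x, (0 : F)), ContDiffAt ℝ m L y :=
    (h2.contDiffAt_limit m h3).eventually (by simp)
  obtain ⟨n, hn⟩ := (h1.1.eventually h4).exists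
  refine (hn.comp x ((contDiff_iterate h.contDiff n).contDiffAt.of_le
    (by exact_mod_cast le_top))).congr_of_eventuallyEq ?_
  filter_upwards [h1.2] with y hy
  have h5 : Tendsto (fun j => H^[j] (H^[n] y)) atTop (𝓝 (L (H^[n] y), 0)) := (hy.2 n).1
  have h6 : Tendsto (fun j => H^[j] (H^[n] y)) atTop (𝓝 (L y, 0)) := by
    simp only [← Function.iterate_add_apply]
    exact hy.1.comp (tendsto_add_atTop_nat n)
  exact congrArg Prod.fst (tendsto_nhds_unique h6 h5)

end IsAttracting

/-- Near a normally attracting set of fixed points the iterates converge, and their limit is a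
smooth function of the initial point. -/
theorem exists_smooth_limit [FiniteDimensional ℝ E] [FiniteDimensional ℝ F]
    {H : E × F → E × F} {p₀ : E} (hs : SmoothNear H (p₀, 0))
    (hfix : ∀ᶠ p in 𝓝 p₀, H (p, 0) = (p, 0)) {k : ℝ} (hk0 : 0 ≤ k) (hk1 : k < 1)
    (hk : ∀ᶠ x in 𝓝 (p₀, (0 : F)), ‖(H x).2‖ ≤ k * ‖x.2‖) :
    ∃ L : E × F → E, SmoothNear L (p₀, 0) ∧ ∀ W ∈ 𝓝 (p₀, (0 : F)), ∀ᶠ x in 𝓝 (p₀, (0 : F)),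
      (∀ n : ℕ, H^[n] x ∈ W) ∧ Tendsto (fun n => H^[n] x) atTop (𝓝 (L x, 0)) := by
  have : CompleteSpace E := FiniteDimensional.complete ℝ E
  have : CompleteSpace F := FiniteDimensional.complete ℝ F
  obtain ⟨H', hH', he⟩ := hs.exists_contDiff
  have hc : Tendsto (fun p : E => (p, (0 : F))) (𝓝 p₀) (𝓝 (p₀, 0)) :=
    Continuous.tendsto (by fun_prop) _
  have hA : IsAttracting H' p₀ := by
    refine ⟨hH', ?_, k, hk0, hk1, ?_⟩
    · filter_upwards [hfix, hc.eventually he] with p h1 h2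
      rw [h2, h1]
    · filter_upwards [hk, he] with x h1 h2
      rwa [h2]
  obtain ⟨L, hL⟩ := hA.exists_tendsto
  refine ⟨L, hA.smoothNear_limit hL, fun W hW => ?_⟩
  obtain ⟨_, _, _, _, _, horb⟩ := hA.orbit_bounds (inter_mem hW he)
  filter_upwards [hL, horb] with x h1 h2
  have h3 : ∀ n : ℕ, H^[n] x = H'^[n] x := by
    intro n
    induction n with
    | zero => rfl
    | succ n ih =>
      rw [Function.iterate_succ_apply', Function.iterate_succ_apply', ih]
      exact ((h2 n).1.2 : H' _ = H _).symm
  simp only [h3]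
  exact ⟨fun n => (h2 n).1.1, h1⟩

end Attracting

/-! ### Expansion of the motion in the elapsed time -/

section Expansion

theorem SmoothNear.deriv {m : ℝ → ℝ} {x : ℝ} (hm : SmoothNear m x) : SmoothNear (deriv m) x := by
  filter_upwards [hm] with y hy
  have h1 : ContDiffAt ℝ ∞ (fun z => fderiv ℝ m z 1) y :=
    (hy.fderiv_right (m := ∞) (by simp)).clm_apply contDiffAt_const
  simpa using h1

theorem SmoothNear.hasDerivAt {m : ℝ → ℝ} {x : ℝ} (hm : SmoothNear m x) :
    HasDerivAt m (_root_.deriv m x) x :=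
  hm.differentiableAt.hasDerivAt

/-- If `x = c + t v + t² m(t)`, then the first three derivatives of `x` at `0` are determined by
`v`, `m(0)` and `m'(0)`. -/
theorem expansion_derivatives {c v : ℝ} {m x η A : ℝ → ℝ} (hm : SmoothNear m 0)
    (hx : ∀ᶠ t in 𝓝 0, x t = c + t * v + t ^ 2 * m t)
    (hη : ∀ᶠ t in 𝓝 0, HasDerivAt x (η t) t) (hA : ∀ᶠ t in 𝓝 0, HasDerivAt η (A t) t) :
    A 0 = 2 * m 0 ∧ ∀ A₁, HasDerivAt A A₁ 0 → A₁ = 6 * deriv m 0 := by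
  have hid : ∀ z : ℝ, SmoothNear (fun t : ℝ => t) z := fun z => contDiff_id.smoothNear z
  set k : ℝ → ℝ := fun t => 2 * m t + t * deriv m t with hk
  have hks : SmoothNear k 0 := ((smoothNear_const 2 0).mul hm).add ((hid 0).mul hm.deriv)
  have h1 : η =ᶠ[𝓝 0] fun t => v + t * k t := by
    filter_upwards [eventually_eventually_nhds.2 hx, hη, hm.eventually] with t h1 h2 h3
    have h4 : HasDerivAt (fun t => c + t * v + t ^ 2 * m t) (η t) t :=
      h2.congr_of_eventuallyEq (h1.mono fun _ h => h.symm)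
    have h5 : HasDerivAt (fun t => c + t * v + t ^ 2 * m t)
        ((0 + 1 * v) + ((2 : ℕ) * t ^ (2 - 1) * m t + t ^ 2 * deriv m t)) t :=
      ((hasDerivAt_const t c).add ((hasDerivAt_id t).mul_const v)).add
        ((hasDerivAt_pow 2 t).mul h3.hasDerivAt)
    rw [h4.unique h5]
    simp [hk]
    ring
  have h2 : A =ᶠ[𝓝 0] fun t => k t + t * deriv k t := by
    filter_upwards [h1.eventuallyEq_nhds, hA, hks.eventually] with t h1 h2 h3
    have h4 := h2.congr_of_eventuallyEq h1.symm
    have h5 : HasDerivAt (fun t => v + t * k t) (0 + (1 * k t + t * deriv k t)) t :=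
      (hasDerivAt_const t v).add ((hasDerivAt_id t).mul h3.hasDerivAt)
    rw [h4.unique h5]
    ring
  refine ⟨by rw [h2.self_of_nhds]; simp [hk], fun A₁ hA₁ => ?_⟩
  have h3 := hA₁.congr_of_eventuallyEq h2.symm
  have h4 : HasDerivAt (fun t => k t + t * deriv k t)
      (deriv k 0 + (1 * deriv k 0 + 0 * deriv (deriv k) 0)) 0 :=
    hks.hasDerivAt.add ((hasDerivAt_id (0 : ℝ)).mul hks.deriv.hasDerivAt)
  have h5 : HasDerivAt k (2 * deriv m 0 + (1 * deriv m 0 + 0 * deriv (deriv m) 0)) 0 :=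
    (hm.hasDerivAt.const_mul 2).add ((hasDerivAt_id (0 : ℝ)).mul hm.deriv.hasDerivAt)
  rw [h3.unique h4, h5.deriv]
  ring

variable {f : ℝ → ℝ → ℝ} {g : ℝ → ℝ}

/-- The state `(x, ẋ)` after the elapsed time `t` as a smooth function of `(t, (τ, v))`. -/
theorem exists_smooth_motion (hf : ContDiff ℝ ∞ (Function.uncurry f)) (hg : ContDiff ℝ ∞ g)
    (c τs : ℝ) :
    ∃ ζ : ℝ × (ℝ × ℝ) → ℝ × ℝ, SmoothNear ζ (0, (τs, 0)) ∧ ∃ ε > 0, ∀ τ v, |τ - τs| < ε → |v| < ε →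
      ζ (0, (τ, v)) = (c, v) ∧ ∀ t, |t| < ε →
        HasDerivAt (fun t => ζ (t, (τ, v))) (field f g (τ + t) (ζ (t, (τ, v)))) t := by
  -- the first coordinate is a clock
  let b : ℝ × (ℝ × ℝ) → ℝ × (ℝ × ℝ) := fun y => (1, (y.2.2, g y.1 - f y.2.1 y.2.2))
  have hb : ContDiff ℝ ∞ b :=
    contDiff_const.prodMk (contDiff_snd.snd.prodMk
      ((hg.comp contDiff_fst).sub (hf.comp (contDiff_snd.fst.prodMk contDiff_snd.snd))))
  obtain ⟨φ, hφ, hφ0, hφd⟩ := exists_smooth_flow hb (τs, (c, 0))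
  obtain ⟨ε, hε, hball⟩ := Metric.eventually_nhds_iff_ball.1 hφd
  obtain ⟨ε', hε', hball'⟩ := Metric.eventually_nhds_iff_ball.1 hφ0
  refine ⟨fun q => (φ ((q.2.1, (c, q.2.2)), q.1)).2, ?_, min ε ε', lt_min hε hε', ?_⟩
  · have h1 : ContDiff ℝ ∞ fun q : ℝ × (ℝ × ℝ) => ((q.2.1, (c, q.2.2)), q.1) := by fun_prop
    exact (SmoothNear.comp (f := fun q : ℝ × (ℝ × ℝ) => ((q.2.1, (c, q.2.2)), q.1)) hφ
      (h1.smoothNear _)).snd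
  · intro τ v hτ hv
    have h0 : φ ((τ, (c, v)), 0) = (τ, (c, v)) := by
      refine hball' _ ?_
      rw [Metric.mem_ball, Prod.dist_eq, Prod.dist_eq]
      simp only [dist_self, Real.dist_eq, sub_zero, max_lt_iff]
      exact ⟨hτ.trans_le (min_le_right _ _), hε', hv.trans_le (min_le_right _ _)⟩
    have hd : ∀ t, |t| < ε → HasDerivAt (fun t => φ ((τ, (c, v)), t))
        (b (φ ((τ, (c, v)), t))) t := by
      intro t ht
      refine hball ((τ, (c, v)), t) ?_
      rw [Metric.mem_ball, Prod.dist_eq, Prod.dist_eq, Prod.dist_eq]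
      simp only [dist_self, Real.dist_eq, sub_zero, max_lt_iff]
      exact ⟨⟨hτ.trans_le (min_le_left _ _), hε, hv.trans_le (min_le_left _ _)⟩, ht⟩
    refine ⟨congrArg Prod.snd h0, fun t ht => ?_⟩
    have ht' : |t| < ε := ht.trans_le (min_le_left _ _)
    have hclock : (φ ((τ, (c, v)), t)).1 = τ + t := by
      have h1 : ∀ s, |s| < ε → HasDerivAt (fun t => (φ ((τ, (c, v)), t)).1 - t) 0 s := by
        intro s hs
        have := ((ContinuousLinearMap.fst ℝ ℝ (ℝ × ℝ)).hasFDerivAt.comp_hasDerivAt s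
          (hd s hs)).sub (hasDerivAt_id s)
        have h2 : (ContinuousLinearMap.fst ℝ ℝ (ℝ × ℝ)) (b (φ ((τ, (c, v)), s))) - 1 = 0 := by
          simp [b]
        rw [h2] at this
        exact this
      have h2 := isOpen_Ioo.is_const_of_deriv_eq_zero (s := Ioo (-ε) ε) (x := t) (y := 0)
        isPreconnected_Ioo
        (fun s hs => (h1 s (abs_lt.2 hs)).differentiableAt.differentiableWithinAt)
        (fun s hs => (h1 s (abs_lt.2 hs)).deriv) (abs_lt.1 ht') ⟨by linarith, hε⟩
      rw [h0] at h2
      simp only at h2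
      linarith
    have h3 := (ContinuousLinearMap.snd ℝ ℝ (ℝ × ℝ)).hasFDerivAt.comp_hasDerivAt t (hd t ht')
    have h4 : (ContinuousLinearMap.snd ℝ ℝ (ℝ × ℝ)) (b (φ ((τ, (c, v)), t))) =
        field f g (τ + t) (φ ((τ, (c, v)), t)).2 := by
      simp [b, field, hclock]
    rw [h4] at h3
    exact h3

/-- The motion is `x = c + t v + t² X(t, τ, v)` with a smooth function `X`. At a tangency point,
`6 ∂X/∂t` is the third derivative of `x`, that is, `ġ`. -/
theorem exists_expansion (hf : ContDiff ℝ ∞ (Function.uncurry f)) (hg : ContDiff ℝ ∞ g)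
    {c τs : ℝ} (h0 : g τs - f c 0 = 0) :
    ∃ X : ℝ × (ℝ × ℝ) → ℝ, SmoothNear X (0, (τs, 0)) ∧
      fderiv ℝ X (0, (τs, 0)) (1, (0, 0)) = deriv g τs / 6 ∧
      ∃ ε > 0, ∀ τ v, |τ - τs| < ε → |v| < ε →
        X (0, (τ, v)) = (g τ - f c v) / 2 ∧ ∀ t, |t| < ε →
          IsMotion f g c τ v t (fun s => (c + s * v + s ^ 2 * X (s, (τ, v)),
            v + 2 * s * X (s, (τ, v)) + s ^ 2 * fderiv ℝ X (s, (τ, v)) (1, (0, 0)))) := by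
  obtain ⟨ζ, hζ, ε, hε, hm⟩ := exists_smooth_motion hf hg c τs
  let Y : ℝ × (ℝ × ℝ) → ℝ := fun z => dslope (fun s => (ζ (s, z.2)).1) 0 z.1
  let X : ℝ × (ℝ × ℝ) → ℝ := fun z => dslope (fun s => Y (s, z.2)) 0 z.1
  have hY : SmoothNear Y (0, (τs, 0)) := hζ.fst.dslope
  have hX : SmoothNear X (0, (τs, 0)) := hY.dslope
  have hxd : ∀ τ v, |τ - τs| < ε → |v| < ε → ∀ t, |t| < ε →
      HasDerivAt (fun t => (ζ (t, (τ, v))).1) (ζ (t, (τ, v))).2 t := fun τ v h1 h2 t h3 =>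
    (ContinuousLinearMap.fst ℝ ℝ ℝ).hasFDerivAt.comp_hasDerivAt t ((hm τ v h1 h2).2 t h3)
  have hvd : ∀ τ v, |τ - τs| < ε → |v| < ε → ∀ t, |t| < ε →
      HasDerivAt (fun t => (ζ (t, (τ, v))).2)
        (g (τ + t) - f (ζ (t, (τ, v))).1 (ζ (t, (τ, v))).2) t :=
    fun τ v h1 h2 t h3 =>
    (ContinuousLinearMap.snd ℝ ℝ ℝ).hasFDerivAt.comp_hasDerivAt t ((hm τ v h1 h2).2 t h3)
  have hx : ∀ τ v, |τ - τs| < ε → |v| < ε → ∀ t,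
      (ζ (t, (τ, v))).1 = c + t * v + t ^ 2 * X (t, (τ, v)) := by
    intro τ v h1 h2 t
    have h3 : Y (0, (τ, v)) = v := by
      simp only [Y, dslope_same]
      rw [(hxd τ v h1 h2 0 (by simpa using hε)).deriv, (hm τ v h1 h2).1]
    have h4 := sub_smul_dslope (fun s => (ζ (s, (τ, v))).1) 0 t
    have h5 := sub_smul_dslope (fun s => Y (s, (τ, v))) 0 t
    change (t - 0) • Y (t, (τ, v)) = _ at h4
    change (t - 0) • X (t, (τ, v)) = Y (t, (τ, v)) - Y (0, (τ, v)) at h5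
    rw [h3] at h5
    simp only [sub_zero, smul_eq_mul, (hm τ v h1 h2).1] at h4 h5
    have h6 : Y (t, (τ, v)) = v + t * X (t, (τ, v)) := by linarith
    rw [h6] at h4
    linarith
  have hXt : ∀ t τ v, SmoothNear X (t, (τ, v)) →
      HasDerivAt (fun s => X (s, (τ, v))) (fderiv ℝ X (t, (τ, v)) (1, (0, 0))) t := by
    intro t τ v h
    exact h.differentiableAt.hasFDerivAt.comp_hasDerivAt t
      ((hasDerivAt_id t).prodMk (hasDerivAt_const t (τ, v)))
  have hslice : ∀ t τ v, SmoothNear X (t, (τ, v)) → SmoothNear (fun s => X (s, (τ, v))) t := by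
    intro t τ v h
    have : ContDiff ℝ ∞ fun s : ℝ => (s, (τ, v)) := by fun_prop
    exact SmoothNear.comp (f := fun s : ℝ => (s, (τ, v))) h (this.smoothNear t)
  obtain ⟨ε', hε', hball⟩ := Metric.eventually_nhds_iff_ball.1 hX.eventually
  have hin : ∀ t τ v, |τ - τs| < ε' → |v| < ε' → |t| < ε' → SmoothNear X (t, (τ, v)) := by
    intro t τ v h1 h2 h3
    refine hball _ ?_
    rw [Metric.mem_ball, Prod.dist_eq, Prod.dist_eq]
    simp only [Real.dist_eq, sub_zero, max_lt_iff]
    exact ⟨h3, h1, h2⟩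
  have hnear : ∀ᶠ t : ℝ in 𝓝 0, |t| < ε :=
    continuous_abs.continuousAt.eventually (gt_mem_nhds (by simpa using hε))
  refine ⟨X, hX, ?_, min ε ε', lt_min hε hε', fun τ v h1 h2 => ?_⟩
  · have hτ0 : |τs - τs| < ε := by simpa using hε
    have hv0 : |(0 : ℝ)| < ε := by simpa using hε
    have h3 := (expansion_derivatives (hslice 0 τs 0 hX)
      (Eventually.of_forall (hx τs 0 hτ0 hv0)) (hnear.mono (hxd τs 0 hτ0 hv0))
      (hnear.mono (hvd τs 0 hτ0 hv0))).2 (deriv g τs) (by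
        have h4 : HasDerivAt (fun t => g (τs + t)) (deriv g τs) 0 := by
          have : HasDerivAt g (deriv g τs) (τs + 0) := by
            rw [add_zero]; exact (hg.differentiable (by simp)).differentiableAt.hasDerivAt
          simpa using this.comp_const_add τs 0
        have h5 : HasDerivAt (fun t => ζ (t, (τs, (0 : ℝ)))) ((0 : ℝ), (0 : ℝ)) 0 := by
          have := (hm τs 0 hτ0 hv0).2 0 hv0
          rw [(hm τs 0 hτ0 hv0).1] at this
          simpa [field, h0] using this
        have h6 :
            HasDerivAt (fun t => f (ζ (t, (τs, (0 : ℝ)))).1 (ζ (t, (τs, (0 : ℝ)))).2) 0 0 := by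
          have h7 : HasFDerivAt (Function.uncurry f) (fderiv ℝ (Function.uncurry f)
              (ζ (0, (τs, (0 : ℝ))))) (ζ (0, (τs, (0 : ℝ)))) :=
            (hf.differentiable (by simp)).differentiableAt.hasFDerivAt
          have h8 := h7.comp_hasDerivAt (0 : ℝ) h5
          have h9 : ((0 : ℝ), (0 : ℝ)) = 0 := rfl
          rw [h9, map_zero] at h8
          exact h8
        have h7 := h4.sub h6
        rw [sub_zero] at h7
        exact h7)
    rw [(hXt 0 τs 0 hX).deriv] at h3
    linarith
  · have h1' := h1.trans_le (min_le_left ε ε')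
    have h2' := h2.trans_le (min_le_left ε ε')
    refine ⟨?_, fun t ht => ?_⟩
    · have h3 := (expansion_derivatives (hslice 0 τ v (hin 0 τ v (h1.trans_le (min_le_right _ _))
        (h2.trans_le (min_le_right _ _)) (by simpa using hε')))
        (Eventually.of_forall (hx τ v h1' h2')) (hnear.mono (hxd τ v h1' h2'))
        (hnear.mono (hvd τ v h1' h2'))).1
      rw [(hm τ v h1' h2').1] at h3
      simp only [add_zero] at h3
      linarith
    · have hsmall : ∀ s ∈ uIcc 0 t, |s| < min ε ε' := fun s hs => by
        have := abs_sub_left_of_mem_uIcc hs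
        simp only [sub_zero] at this
        exact this.trans_lt ht
      have heq : ∀ s ∈ uIcc 0 t, (c + s * v + s ^ 2 * X (s, (τ, v)),
            v + 2 * s * X (s, (τ, v)) + s ^ 2 * fderiv ℝ X (s, (τ, v)) (1, (0, 0))) =
            ζ (s, (τ, v)) := by
        intro s hs
        have hs' := hsmall s hs
        have hX' := hXt s τ v (hin s τ v (h1.trans_le (min_le_right _ _))
          (h2.trans_le (min_le_right _ _)) (hs'.trans_le (min_le_right _ _)))
        refine Prod.ext (hx τ v h1' h2' s).symm ?_
        have h4 := hxd τ v h1' h2' s (hs'.trans_le (min_le_left _ _))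
        have h5 : HasDerivAt (fun s => c + s * v + s ^ 2 * X (s, (τ, v))) _ s :=
          ((hasDerivAt_const s c).add ((hasDerivAt_id s).mul_const v)).add
            ((hasDerivAt_pow 2 s).mul hX')
        have h6 := h4.congr_of_eventuallyEq
          (Eventually.of_forall fun s => (hx τ v h1' h2' s).symm)
        simp only
        rw [h6.unique h5]
        simp
        ring
      refine ⟨?_, fun s hs => ?_⟩
      · exact (heq 0 left_mem_uIcc).trans (hm τ v h1' h2').1
      · have h4 := (hm τ v h1' h2').2 s ((hsmall s hs).trans_le (min_le_left _ _))
        beta_reduce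
        rw [heq s hs]
        exact h4.hasDerivWithinAt.congr heq (heq s hs)

end Expansion

/-! ### The impact map near a tangency point -/

section Tangency

/-- The chart `(p, t) ↦ (τ, v) = (θ(p, t), b p t)` of the half-plane of initial data near a tangency
point. The quadrant `p, t ≥ 0` corresponds to `v ≥ 0`, and `t` is the time of the next impact. -/
def tangencyChart (b : ℝ) (θ : ℝ × ℝ → ℝ) (q : ℝ × ℝ) : ℝ × ℝ := (θ q, b * q.1 * q.2)

/-- The description, in the chart `tangencyChart b θ`, of a return map `G` with domain `dom` near
the tangency point `(τs, 0)`: the points `(p, 0)` are fixed, and `(p, t)` with `t > 0` is sent to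
the point with phase `θ(p, t) + t` and velocity `b t (p μ + t ν)`. -/
structure IsTangencyReturn (dom : Set (ℝ × ℝ)) (G : ℝ × ℝ → ℝ × ℝ) (τs b r : ℝ)
    (θ μ ν : ℝ × ℝ → ℝ) : Prop where
  b_pos : 0 < b
  smooth_θ : SmoothNear θ (0, 0)
  smooth_μ : SmoothNear μ (0, 0)
  smooth_ν : SmoothNear ν (0, 0)
  θ_zero : θ (0, 0) = τs
  θ_fst : fderiv ℝ θ (0, 0) (1, 0) = 1 / 3
  θ_snd : fderiv ℝ θ (0, 0) (0, 1) = -1 / 3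
  μ_zero : μ (0, 0) = r
  ν_zero : ν (0, 0) = r
  step : ∀ᶠ q : ℝ × ℝ in 𝓝 (0, 0), 0 ≤ q.1 → 0 < q.2 → tangencyChart b θ q ∈ dom ∧
    G (tangencyChart b θ q) = (θ q + q.2, b * q.2 * (q.1 * μ q + q.2 * ν q))
  rest : ∀ᶠ p : ℝ in 𝓝 0, 0 ≤ p → tangencyChart b θ (p, 0) ∈ dom ∧
    G (tangencyChart b θ (p, 0)) = tangencyChart b θ (p, 0)

variable {f : ℝ → ℝ → ℝ} {g ρ : ℝ → ℝ} {c : ℝ}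

/-- The first impact of a motion `x = c + s v + s² X(s)` with decreasing `X`: if it is at `x = c` at
the time `t > 0`, then it is above `c` at all times between `0` and `t`. -/
theorem impactMap_of_expansion (hf : ContDiff ℝ ∞ (Function.uncurry f)) {τ v t p : ℝ} {X η : ℝ → ℝ}
    (ht : 0 < t) (hp : 0 ≤ p) (hv : v = p * t) (hXt : X t = -p)
    (hX : ∀ s, 0 < s → s < t → X t < X s)
    (hm : ∀ s, 0 < s → s ≤ t → IsMotion f g c τ v s (fun s => (c + s * v + s ^ 2 * X s, η s))) :
    (τ, v) ∈ returnDomain f g c ∧ impactMap f g ρ c (τ, v) = (τ + t, ρ (η t)) := by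
  have hst : ∀ s, 0 < s → s ≤ t → state f g c τ v s = (c + s * v + s ^ 2 * X s, η s) :=
    fun s h1 h2 => (hm s h1 h2).state_eq hf
  have habove : ∀ s, 0 < s → s < t → c < (state f g c τ v s).1 := by
    intro s h1 h2
    rw [hst s h1 h2.le]
    have h3 := hX s h1 h2
    rw [hXt] at h3
    have h4 : 0 < s * (v + s * X s) := by
      refine mul_pos h1 ?_
      have : 0 ≤ p * (t - s) := mul_nonneg hp (by linarith)
      rw [hv]
      nlinarith
    simp only
    nlinarith
  have hlift : LiftsOff f g c (τ, v) := by
    filter_upwards [Ioo_mem_nhdsGT ht] with s hs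
    exact ⟨⟨_, hm s hs.1 hs.2.le⟩, habove s hs.1 hs.2⟩
  have hhit : t ∈ hitTimes f g c (τ, v) := by
    refine ⟨ht, ⟨_, hm t ht le_rfl⟩, ?_⟩
    simp only
    rw [hst t ht le_rfl, hXt, hv]
    simp only
    ring
  have hleast : IsLeast (hitTimes f g c (τ, v)) t := by
    refine ⟨hhit, fun s hs => ?_⟩
    by_contra hlt
    exact (habove s hs.1 (not_le.1 hlt)).ne' hs.2.2
  have hnn : 0 ≤ v := by rw [hv]; exact mul_nonneg hp ht.le
  refine ⟨⟨hnn, fun _ => ⟨t, hhit⟩⟩, ?_⟩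
  rw [impactMap, firstHit, if_pos (Or.inr hlift), hleast.csInf_eq]
  simp only [reset, restitution]
  rw [hst t ht le_rfl]

theorem impactMap_at_rest (hf : ContDiff ℝ ∞ (Function.uncurry f)) (hρ0 : ρ 0 = 0) {τ ε : ℝ}
    {X η : ℝ → ℝ} (hε : 0 < ε) (hX : ∀ s, 0 < s → s < ε → X s < 0) (hη : η 0 = 0)
    (hm : ∀ s, 0 ≤ s → s < ε → IsMotion f g c τ 0 s (fun s => (c + s * 0 + s ^ 2 * X s, η s))) :
    (τ, (0 : ℝ)) ∈ returnDomain f g c ∧ impactMap f g ρ c (τ, 0) = (τ, 0) := by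
  have hn : ¬ ((0 : ℝ) < ((τ, (0 : ℝ)) : ℝ × ℝ).2 ∨ LiftsOff f g c (τ, 0)) := by
    rintro (h | h)
    · exact lt_irrefl _ h
    · obtain ⟨s, h1, h2⟩ := (h.and (Ioo_mem_nhdsGT hε)).exists
      have h3 := h1.2
      simp only at h3
      rw [(hm s h2.1.le h2.2).state_eq hf] at h3
      have h4 := hX s h2.1 h2.2
      have h5 : 0 < s ^ 2 := pow_pos h2.1 2
      simp only at h3
      nlinarith
  refine ⟨⟨le_refl (0 : ℝ), fun h => absurd h hn⟩, ?_⟩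
  rw [impactMap, firstHit, if_neg hn]
  simp only [reset, restitution]
  rw [(hm 0 le_rfl hε).state_eq hf]
  simp [hη, hρ0]

theorem SmoothNear.fderiv_apply {E F : Type*} [NormedAddCommGroup E] [NormedSpace ℝ E]
    [NormedAddCommGroup F] [NormedSpace ℝ F] {h : E → F} {x : E} (hh : SmoothNear h x) (v : E) :
    SmoothNear (fun y => fderiv ℝ h y v) x := by
  filter_upwards [hh] with y hy
  exact (hy.fderiv_right (m := ∞) (by simp)).clm_apply contDiffAt_const

/-- The impact map near a tangency point with `a' < 0`. With `x = c + t v + t² X(t, τ, v)` for the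
motion, the relation `b p + X(t, τ, b p t) = 0` between `τ`, `p` and `t` says that the motion from
`(τ, b p t)` is at `x = c` at the time `t`. It determines `τ` as a function of `(p, t)`. -/
theorem exists_tangencyReturn (hf : ContDiff ℝ ∞ (Function.uncurry f)) (hg : ContDiff ℝ ∞ g)
    (hρ : ContDiff ℝ ∞ ρ) (hρ0 : ρ 0 = 0) {r : ℝ} (hρ' : deriv ρ 0 = -r) {τs : ℝ}
    (h0 : initialAcceleration f g c τs = 0) (ha' : deriv (initialAcceleration f g c) τs < 0) :
    ∃ (b : ℝ) (θ μ ν : ℝ × ℝ → ℝ), IsTangencyReturn (returnDomain f g c) (impactMap f g ρ c)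
      τs b r θ μ ν := by
  have hgd : HasDerivAt g (deriv g τs) τs :=
    (hg.differentiable (by simp)).differentiableAt.hasDerivAt
  have had : deriv (initialAcceleration f g c) τs = deriv g τs := (hgd.sub_const (f c 0)).deriv
  rw [had] at ha'
  obtain ⟨X, hX, hXt, ε, hε, hm⟩ := exists_expansion hf hg h0
  obtain ⟨b, hb⟩ : ∃ b, b = -deriv g τs / 6 := ⟨_, rfl⟩
  have hb0 : 0 < b := by rw [hb]; linarith
  replace hXt : fderiv ℝ X (0, (τs, 0)) (1, (0, 0)) = -b := by rw [hXt, hb]; ring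
  have hXτ : fderiv ℝ X (0, (τs, 0)) (0, (1, 0)) = -3 * b := by
    have h1 : HasDerivAt (fun τ => X (0, (τ, 0))) (fderiv ℝ X (0, (τs, 0)) (0, (1, 0))) τs :=
      hX.differentiableAt.hasFDerivAt.comp_hasDerivAt τs
        ((hasDerivAt_const τs (0 : ℝ)).prodMk ((hasDerivAt_id τs).prodMk (hasDerivAt_const τs 0)))
    have h2 : (fun τ => X (0, (τ, 0))) =ᶠ[𝓝 τs] fun τ => (g τ - f c 0) / 2 := by
      filter_upwards [Metric.ball_mem_nhds τs hε] with τ hτ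
      rw [Metric.mem_ball, Real.dist_eq] at hτ
      exact (hm τ 0 hτ (by simpa using hε)).1
    have h3 := (h1.congr_of_eventuallyEq h2.symm).unique ((hgd.sub_const (f c 0)).div_const 2)
    rw [h3, hb]; ring
  -- the relation that defines `θ`
  let e : (ℝ × ℝ) × ℝ → ℝ := fun z => b * z.1.1 + X (z.1.2, (z.2, b * z.1.1 * z.1.2))
  have hin : ContDiff ℝ ∞ fun z : (ℝ × ℝ) × ℝ => (z.1.2, (z.2, b * z.1.1 * z.1.2)) := by fun_prop
  have he : SmoothNear e ((0, 0), τs) := by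
    have h1 : ContDiff ℝ ∞ fun z : (ℝ × ℝ) × ℝ => b * z.1.1 := by fun_prop
    refine (h1.smoothNear _).add (SmoothNear.comp
      (f := fun z : (ℝ × ℝ) × ℝ => (z.1.2, (z.2, b * z.1.1 * z.1.2))) ?_ (hin.smoothNear _))
    simpa using hX
  have hX0 : X (0, (τs, 0)) = 0 := by
    rw [(hm τs 0 (by simpa using hε) (by simpa using hε)).1]
    have : g τs - f c 0 = 0 := h0
    rw [this]; simp
  have he0 : e ((0, 0), τs) = 0 := by simp [e, hX0]
  have hed : fderiv ℝ e ((0, 0), τs) (0, 1) = -3 * b := by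
    have h1 : HasDerivAt (fun τ => e ((0, 0), τ)) (fderiv ℝ e ((0, 0), τs) (0, 1)) τs :=
      he.differentiableAt.hasFDerivAt.comp_hasDerivAt τs
        ((hasDerivAt_const τs ((0 : ℝ), (0 : ℝ))).prodMk (hasDerivAt_id τs))
    have h2 : HasDerivAt (fun τ => X (0, (τ, 0))) (fderiv ℝ X (0, (τs, 0)) (0, (1, 0))) τs :=
      hX.differentiableAt.hasFDerivAt.comp_hasDerivAt τs
        ((hasDerivAt_const τs (0 : ℝ)).prodMk ((hasDerivAt_id τs).prodMk (hasDerivAt_const τs 0)))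
    have h3 : (fun τ => e ((0, 0), τ)) = fun τ => X (0, (τ, 0)) := by
      ext τ; simp [e]
    rw [h3] at h1
    rw [h1.unique h2, hXτ]
  obtain ⟨θ, hθ, hθ0, hθu⟩ := exists_smooth_implicit he he0
    (isInvertible_of_real (by rw [hed]; nlinarith))
  have hθe : ∀ᶠ q in 𝓝 ((0 : ℝ), (0 : ℝ)), b * q.1 + X (q.2, (θ q, b * q.1 * q.2)) = 0 := by
    have h3 : Tendsto (fun q => (q, θ q)) (𝓝 (0, 0)) (𝓝 ((0, 0), τs)) := by
      have := continuousAt_id.prodMk hθ.continuousAt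
      rwa [ContinuousAt, hθ0] at this
    filter_upwards [h3.eventually hθu] with q hq
    exact hq.2 rfl
  have hθd := hθ.differentiableAt.hasFDerivAt
  have hXd : HasFDerivAt X (fderiv ℝ X (0, (τs, 0))) (0, (τs, 0)) :=
    hX.differentiableAt.hasFDerivAt
  have hsplit : ∀ x y : ℝ, fderiv ℝ X (0, (τs, 0)) (x, (y, 0)) = -b * x - 3 * b * y := by
    intro x y
    have : ((x, (y, 0)) : ℝ × ℝ × ℝ) = x • (1, (0, 0)) + y • (0, (1, 0)) := by simp
    rw [this, map_add, map_smul, map_smul, hXt, hXτ]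
    simp; ring
  have hθ1 : fderiv ℝ θ (0, 0) (1, 0) = 1 / 3 := by
    have hc : HasDerivAt (fun s : ℝ => (s, (0 : ℝ))) ((1 : ℝ), (0 : ℝ)) 0 :=
      (hasDerivAt_id _).prodMk (hasDerivAt_const _ _)
    have h1 : HasDerivAt (fun s : ℝ => θ (s, 0)) _ 0 :=
      HasFDerivAt.comp_hasDerivAt (f := fun s : ℝ => (s, (0 : ℝ))) (0 : ℝ) hθd hc
    have h2 : HasDerivAt (fun s : ℝ => ((0 : ℝ), (θ (s, 0), (0 : ℝ)))) _ 0 :=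
      (hasDerivAt_const _ _).prodMk (h1.prodMk (hasDerivAt_const _ _))
    have h3 : HasDerivAt (fun s : ℝ => b * s + X (0, (θ (s, 0), 0))) _ 0 :=
      ((hasDerivAt_id (0 : ℝ)).const_mul b).add
        (HasFDerivAt.comp_hasDerivAt (f := fun s : ℝ => ((0 : ℝ), (θ (s, 0), (0 : ℝ)))) (0 : ℝ)
          (by rw [hθ0]; exact hXd) h2)
    have hc' : Tendsto (fun s : ℝ => (s, (0 : ℝ))) (𝓝 0) (𝓝 (0, 0)) :=
      Continuous.tendsto' (by fun_prop) _ _ rfl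
    have h4 : (fun s : ℝ => b * s + X (0, (θ (s, 0), 0))) =ᶠ[𝓝 0] fun _ => 0 := by
      filter_upwards [hc'.eventually hθe] with s hs
      simpa using hs
    have h5 := (h3.congr_of_eventuallyEq h4.symm).unique (hasDerivAt_const _ _)
    rw [hsplit] at h5
    have h6 : b * (1 - 3 * fderiv ℝ θ (0, 0) (1, 0)) = 0 := by linarith
    rcases mul_eq_zero.1 h6 with h | h
    · exact absurd h hb0.ne'
    · linarith
  have hθ2 : fderiv ℝ θ (0, 0) (0, 1) = -1 / 3 := by
    have hc : HasDerivAt (fun s : ℝ => ((0 : ℝ), s)) ((0 : ℝ), (1 : ℝ)) 0 :=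
      (hasDerivAt_const _ _).prodMk (hasDerivAt_id _)
    have h1 : HasDerivAt (fun s : ℝ => θ (0, s)) _ 0 :=
      HasFDerivAt.comp_hasDerivAt (f := fun s : ℝ => ((0 : ℝ), s)) (0 : ℝ) hθd hc
    have h2 : HasDerivAt (fun s : ℝ => (s, (θ (0, s), (0 : ℝ)))) _ 0 :=
      (hasDerivAt_id _).prodMk (h1.prodMk (hasDerivAt_const _ _))
    have h3 : HasDerivAt (fun s : ℝ => X (s, (θ (0, s), 0))) _ 0 :=
      HasFDerivAt.comp_hasDerivAt (f := fun s : ℝ => (s, (θ (0, s), (0 : ℝ)))) (0 : ℝ)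
          (by rw [hθ0]; exact hXd) h2
    have hc' : Tendsto (fun s : ℝ => ((0 : ℝ), s)) (𝓝 0) (𝓝 (0, 0)) :=
      Continuous.tendsto' (by fun_prop) _ _ rfl
    have h4 : (fun s : ℝ => X (s, (θ (0, s), 0))) =ᶠ[𝓝 0] fun _ => 0 := by
      filter_upwards [hc'.eventually hθe] with s hs
      simpa using hs
    have h5 := (h3.congr_of_eventuallyEq h4.symm).unique (hasDerivAt_const _ _)
    rw [hsplit] at h5
    have h6 : b * (1 + 3 * fderiv ℝ θ (0, 0) (0, 1)) = 0 := by linarith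
    rcases mul_eq_zero.1 h6 with h | h
    · exact absurd h hb0.ne'
    · linarith
  -- a box in which `X` is decreasing in time
  have hneg : ∀ᶠ z in 𝓝 ((0 : ℝ), (τs, (0 : ℝ))), SmoothNear X z ∧
      fderiv ℝ X z (1, (0, 0)) < 0 :=
    hX.eventually.and ((hX.fderiv_apply (1, (0, 0))).continuousAt.eventually
      (gt_mem_nhds (by beta_reduce; rw [hXt]; linarith)))
  obtain ⟨ε', hε', hball⟩ := Metric.eventually_nhds_iff_ball.1 hneg
  have hanti : ∀ τ v, |τ - τs| < ε' → |v| < ε' →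
      StrictAntiOn (fun s => X (s, (τ, v))) (Ioo (-ε') ε') := by
    intro τ v h1 h2
    have hd : ∀ s ∈ Ioo (-ε') ε', HasDerivAt (fun s => X (s, (τ, v)))
        (fderiv ℝ X (s, (τ, v)) (1, (0, 0))) s ∧ fderiv ℝ X (s, (τ, v)) (1, (0, 0)) < 0 := by
      intro s hs
      have h3 := hball (s, (τ, v)) (by
        rw [Metric.mem_ball, Prod.dist_eq, Prod.dist_eq]
        simp only [Real.dist_eq, sub_zero, max_lt_iff]
        exact ⟨abs_lt.2 hs, h1, h2⟩)
      exact ⟨h3.1.differentiableAt.hasFDerivAt.comp_hasDerivAt s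
        ((hasDerivAt_id s).prodMk (hasDerivAt_const s (τ, v))), h3.2⟩
    refine strictAntiOn_of_deriv_neg (convex_Ioo _ _)
      (fun s hs => (hd s hs).1.continuousAt.continuousWithinAt) fun s hs => ?_
    rw [interior_Ioo] at hs
    rw [(hd s hs).1.deriv]
    exact (hd s hs).2
  have hbox : ∀ᶠ q in 𝓝 ((0 : ℝ), (0 : ℝ)), |θ q - τs| < min ε ε' ∧ |b * q.1 * q.2| < min ε ε' ∧
      |q.2| < min ε ε' := by
    have hmin : 0 < min ε ε' := lt_min hε hε'
    refine ((hθ.continuousAt.sub continuousAt_const).abs.eventually (gt_mem_nhds (by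
      simpa [hθ0] using hmin))).and (Eventually.and ?_ ?_)
    · have : Continuous fun q : ℝ × ℝ => |b * q.1 * q.2| := by fun_prop
      exact this.continuousAt.eventually (gt_mem_nhds (by simpa using hmin))
    · have : Continuous fun q : ℝ × ℝ => |q.2| := by fun_prop
      exact this.continuousAt.eventually (gt_mem_nhds (by simpa using hmin))
  -- the velocity at the impact is `-t (b p + t κ)`
  let pt : ℝ × ℝ → ℝ × (ℝ × ℝ) := fun q => (q.2, (θ q, b * q.1 * q.2))
  have hpt0 : pt (0, 0) = (0, (τs, 0)) := by simp [pt, hθ0]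
  have hfst : SmoothNear (fun q : ℝ × ℝ => q.1) (0, 0) := contDiff_fst.smoothNear _
  have hsnd : SmoothNear (fun q : ℝ × ℝ => q.2) (0, 0) := contDiff_snd.smoothNear _
  have hpt : SmoothNear pt (0, 0) :=
    hsnd.prodMk (hθ.prodMk (((smoothNear_const b _).mul hfst).mul hsnd))
  let κ : ℝ × ℝ → ℝ := fun q => 0 - fderiv ℝ X (pt q) (1, (0, 0))
  have hκ : SmoothNear κ (0, 0) := by
    refine (smoothNear_const 0 _).sub (SmoothNear.comp
      (g := fun z => fderiv ℝ X z (1, (0, 0))) (f := pt) ?_ hpt)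
    rw [hpt0]
    exact hX.fderiv_apply _
  have hκ0 : κ (0, 0) = b := by simp [κ, hpt0, hXt]
  let w : ℝ × ℝ → ℝ := fun q => 0 - q.2 * (b * q.1 + q.2 * κ q)
  have hw : SmoothNear w (0, 0) :=
    (smoothNear_const 0 _).sub (hsnd.mul (((smoothNear_const b _).mul hfst).add (hsnd.mul hκ)))
  have hρs : ContDiff ℝ ∞ fun w : ℝ => dslope ρ 0 w :=
    (contDiff_dslope (h := fun z : ℝ × ℝ => ρ z.1) (hρ.comp contDiff_fst)).comp
      (contDiff_id.prodMk contDiff_const : ContDiff ℝ ∞ fun w : ℝ => (w, (0 : ℝ)))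
  have hρw : ∀ w, ρ w = w * dslope ρ 0 w := by
    intro w
    have := sub_smul_dslope ρ 0 w
    simp only [sub_zero, hρ0, smul_eq_mul] at this
    exact this.symm
  let μ : ℝ × ℝ → ℝ := fun q => 0 - dslope ρ 0 (w q)
  have hμ : SmoothNear μ (0, 0) := (smoothNear_const 0 _).sub ((hρs.smoothNear _).comp hw)
  have hμ0 : μ (0, 0) = r := by simp [μ, w, hρ']
  refine ⟨b, θ, μ, fun q => κ q / b * μ q, hb0, hθ, hμ,
    (hκ.div (smoothNear_const b _) hb0.ne').mul hμ, hθ0, hθ1, hθ2, hμ0, ?_, ?_, ?_⟩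
  · simp only [hκ0, hμ0]
    field_simp
  · filter_upwards [hθe, hbox] with q h1 h2 h3 h4
    obtain ⟨h5, h6, h7⟩ := h2
    have hmot := (hm (θ q) (b * q.1 * q.2) (h5.trans_le (min_le_left _ _))
      (h6.trans_le (min_le_left _ _))).2
    have han := hanti (θ q) (b * q.1 * q.2) (h5.trans_le (min_le_right _ _))
      (h6.trans_le (min_le_right _ _))
    rw [abs_of_pos h4] at h7
    have h8 := impactMap_of_expansion (ρ := ρ) hf (τ := θ q) (v := b * q.1 * q.2) (t := q.2)
      (p := b * q.1) (X := fun s => X (s, (θ q, b * q.1 * q.2)))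
      (η := fun s => b * q.1 * q.2 + 2 * s * X (s, (θ q, b * q.1 * q.2)) +
        s ^ 2 * fderiv ℝ X (s, (θ q, b * q.1 * q.2)) (1, (0, 0)))
      h4 (by positivity) rfl (by linarith) (fun s hs1 hs2 => by
        have h9 := h7.trans_le (min_le_right _ _)
        exact han ⟨by linarith, by linarith⟩ ⟨by linarith, h9⟩ hs2) (fun s hs1 hs2 => by
        refine hmot s ?_
        rw [abs_of_pos hs1]
        exact hs2.trans_lt (h7.trans_le (min_le_left _ _)))
    refine ⟨h8.1, h8.2.trans ?_⟩
    refine Prod.ext rfl ?_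
    simp only
    have h9 : b * q.1 * q.2 + 2 * q.2 * X (q.2, (θ q, b * q.1 * q.2)) +
        q.2 ^ 2 * fderiv ℝ X (q.2, (θ q, b * q.1 * q.2)) (1, (0, 0)) = w q := by
      have h10 : X (q.2, (θ q, b * q.1 * q.2)) = -(b * q.1) := by linarith
      simp only [w, κ, pt, h10]
      ring
    rw [h9, hρw]
    simp only [w, μ]
    field_simp
    ring
  · have hc' : Tendsto (fun s : ℝ => (s, (0 : ℝ))) (𝓝 0) (𝓝 (0, 0)) :=
      Continuous.tendsto' (by fun_prop) _ _ rfl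
    filter_upwards [hc'.eventually hθe, hc'.eventually hbox] with p h1 h2 h3
    obtain ⟨h5, h6, h7⟩ := h2
    simp only [mul_zero] at h1
    have hz : |(0 : ℝ)| < min ε ε' := by simpa using lt_min hε hε'
    have hmot := (hm (θ (p, 0)) 0 (h5.trans_le (min_le_left _ _))
      (hz.trans_le (min_le_left _ _))).2
    have han := hanti (θ (p, 0)) 0 (h5.trans_le (min_le_right _ _))
      (hz.trans_le (min_le_right _ _))
    have h8 := impactMap_at_rest (ρ := ρ) (g := g) (c := c) hf hρ0 (τ := θ (p, 0)) (ε := min ε ε')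
      (X := fun s => X (s, (θ (p, 0), 0)))
      (η := fun s => 0 + 2 * s * X (s, (θ (p, 0), 0)) +
        s ^ 2 * fderiv ℝ X (s, (θ (p, 0), 0)) (1, (0, 0))) (lt_min hε hε') (fun s hs1 hs2 => by
        have h9 := hs2.trans_le (min_le_right _ _)
        have h10 := han (a := 0) (b := s) ⟨by linarith, by linarith⟩ ⟨by linarith, h9⟩ hs1
        simp only at h10 ⊢
        nlinarith) (by simp) (fun s hs1 hs2 => by
        refine hmot s ?_
        rw [abs_of_nonneg hs1]
        exact hs2.trans_le (min_le_left _ _))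
    have h9 : tangencyChart b θ (p, 0) = (θ (p, 0), 0) := by simp [tangencyChart]
    rw [h9]
    exact h8

end Tangency

/-! ### Blowing up the tangency point -/

section BlowUp

/-- The polar-type coordinates `(s, y) ↦ (p, t) = (s (1 - y), s y)` of the quadrant `p, t ≥ 0`,
which is the image of `s ≥ 0`, `0 ≤ y ≤ 1`. -/
def blowUp (x : ℝ × ℝ) : ℝ × ℝ := (x.1 * (1 - x.2), x.1 * x.2)

theorem contDiff_blowUp : ContDiff ℝ ∞ blowUp := by unfold blowUp; fun_prop

@[simp]
theorem blowUp_zero (y : ℝ) : blowUp (0, y) = (0, 0) := by simp [blowUp]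

@[simp]
theorem blowUp_axis (s : ℝ) : blowUp (s, 0) = (s, 0) := by simp [blowUp]

/-- `H` is the return map in the coordinates `(s, y)`. It is smooth also on the segment `s = 0`,
`0 ≤ y ≤ 1`, to which the tangency point is blown up. -/
structure IsBlownUpReturn (H : ℝ × ℝ → ℝ × ℝ) (r : ℝ) (θ μ ν : ℝ × ℝ → ℝ) : Prop where
  smooth : ∀ y ∈ Icc (0 : ℝ) 1, SmoothNear H (0, y)
  segment : ∀ y ∈ Icc (0 : ℝ) 1, (H (0, y)).1 = 0 ∧ 0 ≤ (H (0, y)).2 ∧ (H (0, y)).2 ≤ r * y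
  fixed : ∀ᶠ s in 𝓝 (0 : ℝ), H (s, 0) = (s, 0)
  contract : ∃ k : ℝ, 0 ≤ k ∧ k < 1 ∧ ∀ᶠ x in 𝓝 ((0 : ℝ), (0 : ℝ)), ‖(H x).2‖ ≤ k * ‖x.2‖
  step : ∀ᶠ s in 𝓝 (0 : ℝ), ∀ y ∈ Icc (0 : ℝ) 1, 0 < s →
    0 < (H (s, y)).1 ∧ (H (s, y)).2 ∈ Icc (0 : ℝ) 1 ∧
    θ (blowUp (H (s, y))) = θ (blowUp (s, y)) + (blowUp (s, y)).2 ∧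
    (blowUp (H (s, y))).1 * (blowUp (H (s, y))).2 = (blowUp (s, y)).2 *
      ((blowUp (s, y)).1 * μ (blowUp (s, y)) + (blowUp (s, y)).2 * ν (blowUp (s, y)))

theorem _root_.DifferentiableAt.fderiv_apply_prod_real {E F : Type*} [NormedAddCommGroup E]
    [NormedSpace ℝ E] [NormedAddCommGroup F] [NormedSpace ℝ F] {e : E × ℝ → F} {x : E} {q : ℝ}
    (h : DifferentiableAt ℝ e (x, q)) :
    HasDerivAt (fun q => e (x, q)) (fderiv ℝ e (x, q) (0, 1)) q :=
  h.hasFDerivAt.comp_hasDerivAt q ((hasDerivAt_const q x).prodMk (hasDerivAt_id q))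

variable {dom : Set (ℝ × ℝ)} {G : ℝ × ℝ → ℝ × ℝ} {τs b r : ℝ} {θ μ ν : ℝ × ℝ → ℝ}

theorem IsTangencyReturn.fderiv_θ (h : IsTangencyReturn dom G τs b r θ μ ν) (p q : ℝ) :
    fderiv ℝ θ (0, 0) (p, q) = (p - q) / 3 := by
  have : ((p, q) : ℝ × ℝ) = p • (1, 0) + q • (0, 1) := by simp
  rw [this, map_add, map_smul, map_smul, h.θ_fst, h.θ_snd]
  simp; ring

/-- The next point `(s P, s Q)` after `(s (1 - y), s y)` is determined by
`θ(s P, s Q) = θ(s (1 - y), s y) + s y` and `P Q = y ((1 - y) μ + y ν)`. After division of the first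
relation by `s` both are smooth in `s`, and at `s = 0` they are `P - Q = 1 + y` and `P Q = r y`. -/
theorem IsTangencyReturn.exists_blownUpReturn (h : IsTangencyReturn dom G τs b r θ μ ν)
    (hr0 : 0 < r) (hr1 : r < 1) : ∃ H, IsBlownUpReturn H r θ μ ν := by
  -- `s Θ(s, P, Q) = 3 (θ(s P, s Q) - τs)`, where the factor `3` makes `Θ(0, P, Q) = P - Q`
  let Θ : ℝ × (ℝ × ℝ) → ℝ := fun z => 3 * dslope (fun s => θ (s * z.2.1, s * z.2.2)) 0 z.1
  have hΘ : ∀ P Q, SmoothNear Θ (0, (P, Q)) := by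
    intro P Q
    refine (smoothNear_const 3 _).mul (SmoothNear.dslope
      (h := fun z : ℝ × (ℝ × ℝ) => θ (z.1 * z.2.1, z.1 * z.2.2)) ?_)
    have : ContDiff ℝ ∞ fun z : ℝ × (ℝ × ℝ) => (z.1 * z.2.1, z.1 * z.2.2) := by fun_prop
    refine SmoothNear.comp (f := fun z : ℝ × (ℝ × ℝ) => (z.1 * z.2.1, z.1 * z.2.2)) ?_
      (this.smoothNear _)
    simpa using h.smooth_θ
  have hΘ0 : ∀ P Q, Θ (0, (P, Q)) = P - Q := by
    intro P Q
    have h1 : HasDerivAt (fun s : ℝ => (s * P, s * Q)) (1 * P, 1 * Q) 0 :=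
      ((hasDerivAt_id (0 : ℝ)).mul_const P).prodMk ((hasDerivAt_id (0 : ℝ)).mul_const Q)
    have h2 : HasDerivAt (fun s : ℝ => θ (s * P, s * Q)) (fderiv ℝ θ (0, 0) (1 * P, 1 * Q)) 0 :=
      HasFDerivAt.comp_hasDerivAt (f := fun s : ℝ => (s * P, s * Q)) (0 : ℝ)
        (by simpa using h.smooth_θ.differentiableAt.hasFDerivAt) h1
    simp only [Θ, dslope_same]
    rw [h2.deriv, h.fderiv_θ]
    ring
  have hΘs : ∀ s P Q, s * Θ (s, (P, Q)) = 3 * (θ (s * P, s * Q) - τs) := by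
    intro s P Q
    have := sub_smul_dslope (fun s => θ (s * P, s * Q)) 0 s
    simp only [sub_zero, smul_eq_mul, zero_mul, h.θ_zero] at this
    simp only [Θ]
    linarith
  let N : ℝ × ℝ → ℝ := fun x => (1 - x.2) * μ (blowUp x) + x.2 * ν (blowUp x)
  have hfst : ∀ z : ℝ × ℝ, SmoothNear (fun q : ℝ × ℝ => q.1) z := fun z => contDiff_fst.smoothNear _
  have hsnd : ∀ z : ℝ × ℝ, SmoothNear (fun q : ℝ × ℝ => q.2) z := fun z => contDiff_snd.smoothNear _
  have hN : ∀ y, SmoothNear N (0, y) := by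
    intro y
    have hB : SmoothNear blowUp ((0 : ℝ), y) := contDiff_blowUp.smoothNear _
    refine (((smoothNear_const 1 _).sub (hsnd _)).mul (SmoothNear.comp ?_ hB)).add
      ((hsnd _).mul (SmoothNear.comp ?_ hB))
    · rw [blowUp_zero]; exact h.smooth_μ
    · rw [blowUp_zero]; exact h.smooth_ν
  have hN0 : ∀ y, N (0, y) = r := by
    intro y
    simp only [N, blowUp_zero, h.μ_zero, h.ν_zero]
    ring
  -- the equation for `P` that remains after the elimination of `Q = y N / P`
  let e : (ℝ × ℝ) × ℝ → ℝ := fun z =>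
    Θ (z.1.1, (z.2, z.1.2 * N z.1 / z.2)) - Θ (z.1.1, (1 - z.1.2, z.1.2)) - 3 * z.1.2
  have he : ∀ y P, P ≠ 0 → SmoothNear e ((0, y), P) := by
    intro y P hP
    have h1 : SmoothNear (fun z : (ℝ × ℝ) × ℝ => z.1) ((0, y), P) := contDiff_fst.smoothNear _
    have h2 : SmoothNear (fun z : (ℝ × ℝ) × ℝ => z.2) ((0, y), P) := contDiff_snd.smoothNear _
    have h3 : SmoothNear (fun z : (ℝ × ℝ) × ℝ => N z.1) ((0, y), P) :=
      SmoothNear.comp (f := fun z : (ℝ × ℝ) × ℝ => z.1) (hN y) h1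
    refine ((SmoothNear.comp (g := Θ) (f := fun z : (ℝ × ℝ) × ℝ =>
      (z.1.1, (z.2, z.1.2 * N z.1 / z.2))) (hΘ _ _)
      (h1.fst.prodMk (h2.prodMk ((h1.snd.mul h3).div h2 hP)))).sub
      (SmoothNear.comp (g := Θ) (f := fun z : (ℝ × ℝ) × ℝ => (z.1.1, (1 - z.1.2, z.1.2)))
      (hΘ _ _) (h1.fst.prodMk (((smoothNear_const 1 _).sub h1.snd).prodMk h1.snd)))).sub
      ((smoothNear_const 3 _).mul h1.snd)
  have he0 : ∀ y P, e ((0, y), P) = P - y * r / P - (1 + y) := by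
    intro y P
    simp only [e, hΘ0, hN0]
    ring
  have hed : ∀ y ∈ Icc (0 : ℝ) 1, ∀ P ∈ Icc (1 / 2 : ℝ) 4,
      0 < fderiv ℝ e ((0, y), P) (0, 1) := by
    intro y hy P hP
    have hP0 : 0 < P := by linarith [hP.1]
    have h1 := (he y P hP0.ne').differentiableAt.fderiv_apply_prod_real
    simp only [he0] at h1
    have h2 : HasDerivAt (fun P : ℝ => P - y * r / P - (1 + y))
        (1 - (0 * P - y * r * 1) / P ^ 2) P :=
      ((hasDerivAt_id P).sub ((hasDerivAt_const P (y * r)).div (hasDerivAt_id P) hP0.ne')).sub_const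
        (1 + y)
    rw [h1.unique h2]
    have : 0 ≤ y * r / P ^ 2 := div_nonneg (mul_nonneg hy.1 hr0.le) (by positivity)
    have h3 : (0 * P - y * r * 1) / P ^ 2 = -(y * r / P ^ 2) := by ring
    rw [h3]
    linarith
  -- At `s = 0` the equation is `P - y r / P = 1 + y`, which has its positive root in `(1/2, 4)`.
  let P : ℝ × ℝ → ℝ := rootOn e (1 / 2) 4
  have hroot : ∀ y ∈ Icc (0 : ℝ) 1, SmoothNear P (0, y) ∧ ∀ᶠ x in 𝓝 ((0 : ℝ), y),
      P x ∈ Ioo (1 / 2 : ℝ) 4 ∧ e (x, P x) = 0 ∧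
        ∀ q ∈ Icc (1 / 2 : ℝ) 4, e (x, q) = 0 → q = P x := by
    intro y hy
    refine smoothNear_rootOn (by norm_num) (fun q hq => he y q ?_) (fun q hq => hed y hy q hq) ?_ ?_
    · linarith [hq.1]
    · rw [he0]
      have : 0 ≤ y * r / (1 / 2) := div_nonneg (mul_nonneg hy.1 hr0.le) (by norm_num)
      linarith [hy.1]
    · rw [he0]
      have : y * r ≤ 1 := mul_le_one₀ hy.2 hr0.le hr1.le
      linarith [hy.2]
  let Q : ℝ × ℝ → ℝ := fun x => x.2 * N x / P x
  let H : ℝ × ℝ → ℝ × ℝ := fun x => (x.1 * (P x + Q x), Q x / (P x + Q x))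
  have hP0 : ∀ y ∈ Icc (0 : ℝ) 1, 1 ≤ P (0, y) := by
    intro y hy
    obtain ⟨h1, h2, -⟩ := (hroot y hy).2.self_of_nhds
    rw [he0] at h2
    have : 0 ≤ y * r / P (0, y) := div_nonneg (mul_nonneg hy.1 hr0.le) (by linarith [h1.1])
    linarith [hy.1]
  have hQ0 : ∀ y ∈ Icc (0 : ℝ) 1, 0 ≤ Q (0, y) ∧ Q (0, y) ≤ r * y := by
    intro y hy
    have h1 := hP0 y hy
    have h2 : 0 ≤ y * r := mul_nonneg hy.1 hr0.le
    simp only [Q, hN0]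
    refine ⟨div_nonneg h2 (by linarith), ?_⟩
    rw [div_le_iff₀ (by linarith)]
    nlinarith
  have hQs : ∀ y ∈ Icc (0 : ℝ) 1, SmoothNear Q (0, y) := fun y hy =>
    ((hsnd _).mul (hN y)).div (hroot y hy).1 (by linarith [hP0 y hy])
  have hHs : ∀ y ∈ Icc (0 : ℝ) 1, SmoothNear H (0, y) := by
    intro y hy
    have h1 := (hroot y hy).1.add (hQs y hy)
    exact ((hfst _).mul h1).prodMk ((hQs y hy).div h1 (by linarith [hP0 y hy, (hQ0 y hy).1]))
  have h01 : (0 : ℝ) ∈ Icc (0 : ℝ) 1 := ⟨le_rfl, zero_le_one⟩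
  have hP1 : ∀ᶠ s in 𝓝 (0 : ℝ), P (s, 0) = 1 := by
    have hc : Tendsto (fun s : ℝ => (s, (0 : ℝ))) (𝓝 0) (𝓝 (0, 0)) :=
      Continuous.tendsto' (by fun_prop) _ _ rfl
    filter_upwards [hc.eventually (hroot 0 h01).2] with s hs
    refine (hs.2.2 1 (by norm_num) ?_).symm
    simp [e]
  refine ⟨H, hHs, fun y hy => ⟨by simp [H], ?_, ?_⟩, ?_, ?_, ?_⟩
  · exact div_nonneg (hQ0 y hy).1 (by linarith [hP0 y hy, (hQ0 y hy).1])
  · have h1 := hP0 y hy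
    have h2 := hQ0 y hy
    refine le_trans ?_ h2.2
    exact div_le_self h2.1 (by linarith)
  · filter_upwards [hP1] with s hs
    simp [H, Q, hs]
  -- Near `(0, 0)` the factor `Q / (y (P + Q))` is close to its value `r`.
  · refine ⟨(1 + r) / 2, by linarith, by linarith, ?_⟩
    let F : ℝ × ℝ → ℝ := fun x => N x / (P x * (P x + Q x))
    have hFc : ContinuousAt F (0, 0) := by
      have hPc := (hroot 0 h01).1.continuousAt
      have hQc := (hQs 0 h01).continuousAt
      refine (hN 0).continuousAt.div (hPc.mul (hPc.add hQc)) ?_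
      have := hP0 0 h01
      have := (hQ0 0 h01).1
      positivity
    have hF0 : F (0, 0) = r := by
      simp [F, Q, hN0, hP1.self_of_nhds]
    have hF : ∀ᶠ x in 𝓝 ((0 : ℝ), (0 : ℝ)), |F x| < (1 + r) / 2 :=
      hFc.abs.eventually (gt_mem_nhds (by
        beta_reduce; rw [hF0, abs_of_pos hr0]; linarith))
    filter_upwards [hF] with x hx
    have h1 : (H x).2 = F x * x.2 := by
      simp only [H, F, Q]
      rw [div_div, mul_comm (x.2), mul_div_right_comm]
    rw [h1, norm_mul]
    gcongr
    exact hx.le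
  · have hcomp : ∀ᶠ s in 𝓝 (0 : ℝ), ∀ y ∈ Icc (0 : ℝ) 1,
        P (s, y) ∈ Ioo (1 / 2 : ℝ) 4 ∧ e ((s, y), P (s, y)) = 0 ∧ 0 < N (s, y) := by
      refine isCompact_Icc.eventually_forall_of_forall_eventually fun y hy => ?_
      filter_upwards [(hroot y hy).2, (hN y).continuousAt.eventually (lt_mem_nhds (by
        rw [hN0]; exact hr0))] with x h1 h2
      exact ⟨h1.1, h1.2.1, h2⟩
    filter_upwards [hcomp] with s hs y hy hs0
    obtain ⟨h1, h2, h3⟩ := hs y hy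
    have hPp : 0 < P (s, y) := by linarith [h1.1]
    have hQp : 0 ≤ Q (s, y) := div_nonneg (mul_nonneg hy.1 h3.le) hPp.le
    have hPQ : 0 < P (s, y) + Q (s, y) := by linarith
    have hB : blowUp (H (s, y)) = (s * P (s, y), s * Q (s, y)) := by
      simp only [H, blowUp]
      refine Prod.ext ?_ ?_
      · simp only
        field_simp
        ring
      · simp only
        field_simp
    refine ⟨mul_pos hs0 hPQ, ⟨div_nonneg hQp hPQ.le, (div_le_one hPQ).2 (by linarith)⟩, ?_, ?_⟩
    · have h4 := hΘs s (P (s, y)) (Q (s, y))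
      have h5 := hΘs s (1 - y) y
      have h6 : Θ (s, (P (s, y), Q (s, y))) = Θ (s, (1 - y, y)) + 3 * y := by
        simp only [e] at h2
        linarith
      rw [h6, mul_add, h5] at h4
      rw [hB]
      simp only [blowUp]
      linarith
    · rw [hB]
      simp only [Q, blowUp, N]
      field_simp

end BlowUp

/-! ### The limit of the impacts -/

section LimitPhase

variable {dom : Set (ℝ × ℝ)} {G : ℝ × ℝ → ℝ × ℝ} {τs b r : ℝ} {θ μ ν : ℝ × ℝ → ℝ}
  {H : ℝ × ℝ → ℝ × ℝ}

/-- On the segment `s = 0` the iterates tend to the end-point `y = 0` at a uniform rate. -/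
theorem IsBlownUpReturn.iterate_segment (hH : IsBlownUpReturn H r θ μ ν) (hr0 : 0 < r) (hr1 : r < 1)
    {y : ℝ} (hy : y ∈ Icc (0 : ℝ) 1) (n : ℕ) : SmoothNear H^[n] (0, y) ∧ (H^[n] (0, y)).1 = 0 ∧
      0 ≤ (H^[n] (0, y)).2 ∧ (H^[n] (0, y)).2 ≤ r ^ n := by
  induction n with
  | zero => exact ⟨contDiff_id.smoothNear _, rfl, hy.1, by simpa using hy.2⟩
  | succ n ih =>
    obtain ⟨h1, h2, h3, h4⟩ := ih
    have h5 : H^[n] (0, y) = (0, (H^[n] (0, y)).2) := Prod.ext h2 rfl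
    have h6 : (H^[n] (0, y)).2 ∈ Icc (0 : ℝ) 1 := ⟨h3, h4.trans (pow_le_one₀ hr0.le hr1.le)⟩
    obtain ⟨h7, h8, h9⟩ := hH.segment _ h6
    rw [Function.iterate_succ_apply', h5]
    refine ⟨?_, h7, h8, h9.trans ?_⟩
    · rw [Function.iterate_succ']
      refine SmoothNear.comp (f := H^[n]) ?_ h1
      rw [h5]
      exact hH.smooth _ h6
    · rw [pow_succ']
      gcongr

/-- The impacts of a motion that starts near the tangency point converge to a point `(Λ, 0)`, and
the phase `Λ` is a smooth function of the blown-up coordinates, also at `s = 0`. -/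
theorem IsTangencyReturn.exists_limitPhase (h : IsTangencyReturn dom G τs b r θ μ ν)
    (hr0 : 0 < r) (hr1 : r < 1) (hH : IsBlownUpReturn H r θ μ ν) :
    ∃ Λ : ℝ × ℝ → ℝ, (∀ y ∈ Icc (0 : ℝ) 1, SmoothNear Λ (0, y) ∧ Λ (0, y) = τs) ∧
      (∀ᶠ s in 𝓝 (0 : ℝ), Λ (s, 0) = θ (s, 0)) ∧
      ∀ᶠ s in 𝓝 (0 : ℝ), ∀ y ∈ Icc (0 : ℝ) 1, 0 < s → τs + s / 4 ≤ Λ (s, y) ∧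
        (∀ n : ℕ, G^[n] (tangencyChart b θ (blowUp (s, y))) ∈ dom) ∧
        Tendsto (fun n : ℕ => G^[n] (tangencyChart b θ (blowUp (s, y)))) atTop
          (𝓝 (Λ (s, y), 0)) := by
  have h01 : (0 : ℝ) ∈ Icc (0 : ℝ) 1 := ⟨le_rfl, zero_le_one⟩
  have hBt : ∀ y : ℝ, Tendsto blowUp (𝓝 ((0 : ℝ), y)) (𝓝 (0, 0)) := fun y => by
    have := contDiff_blowUp.continuous.tendsto ((0 : ℝ), y)
    rwa [blowUp_zero] at this
  -- one step of the return map
  have hstep : ∀ᶠ s in 𝓝 (0 : ℝ), ∀ y ∈ Icc (0 : ℝ) 1, 0 < s →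
      0 < (H (s, y)).1 ∧ (H (s, y)).2 ∈ Icc (0 : ℝ) 1 ∧
      θ (blowUp (H (s, y))) = θ (blowUp (s, y)) + s * y ∧
      tangencyChart b θ (blowUp (s, y)) ∈ dom ∧
      G (tangencyChart b θ (blowUp (s, y))) = tangencyChart b θ (blowUp (H (s, y))) := by
    have h1 : ∀ᶠ s in 𝓝 (0 : ℝ), ∀ y ∈ Icc (0 : ℝ) 1, 0 ≤ (blowUp (s, y)).1 →
        0 < (blowUp (s, y)).2 → tangencyChart b θ (blowUp (s, y)) ∈ dom ∧
        G (tangencyChart b θ (blowUp (s, y))) = (θ (blowUp (s, y)) + (blowUp (s, y)).2,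
          b * (blowUp (s, y)).2 * ((blowUp (s, y)).1 * μ (blowUp (s, y)) +
            (blowUp (s, y)).2 * ν (blowUp (s, y)))) :=
      isCompact_Icc.eventually_forall_of_forall_eventually fun y hy => (hBt y).eventually h.step
    filter_upwards [h1, hH.step, h.rest, hH.fixed] with s h1 h2 h3 h4 y hy hs
    obtain ⟨h5, h6, h7, h8⟩ := h2 y hy hs
    refine ⟨h5, h6, h7, ?_⟩
    rcases hy.1.eq_or_lt with hy0 | hy0
    · rw [← hy0, h4, blowUp_axis]
      exact h3 hs.le
    · have h9 := h1 y hy (mul_nonneg hs.le (by linarith [hy.2])) (mul_pos hs hy0)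
      refine ⟨h9.1, h9.2.trans ?_⟩
      refine Prod.ext h7.symm ?_
      simp only [tangencyChart]
      rw [mul_assoc b, mul_assoc b, h8]
  obtain ⟨δ, hδ, hball⟩ := Metric.eventually_nhds_iff_ball.1 hstep
  obtain ⟨k, hk0, hk1, hk⟩ := hH.contract
  obtain ⟨L, hL, hLt⟩ := exists_smooth_limit (hH.smooth 0 h01) hH.fixed hk0 hk1 hk
  have hW : {x : ℝ × ℝ | |x.1| < δ} ∈ 𝓝 ((0 : ℝ), (0 : ℝ)) :=
    (isOpen_lt (by fun_prop) continuous_const).mem_nhds (by simpa using hδ)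
  have hLW := hLt _ hW
  obtain ⟨η, hη, hηb⟩ := Metric.eventually_nhds_iff_ball.1 (hLW.and hL.eventually)
  -- After `N` steps the whole segment `s = 0` is in the region where the limit `L` exists.
  obtain ⟨N, hN⟩ := exists_pow_lt_of_lt_one hη hr1
  have hNb : ∀ y ∈ Icc (0 : ℝ) 1, H^[N] (0, y) ∈ Metric.ball ((0 : ℝ), (0 : ℝ)) η := by
    intro y hy
    obtain ⟨-, h2, h3, h4⟩ := hH.iterate_segment hr0 hr1 hy N
    rw [Metric.mem_ball, Prod.dist_eq, max_lt_iff, h2]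
    refine ⟨by simpa using hη, ?_⟩
    rw [Real.dist_eq, sub_zero, abs_of_nonneg h3]
    exact h4.trans_lt hN
  have hLs : ∀ y ∈ Icc (0 : ℝ) 1, SmoothNear (fun x => L (H^[N] x)) (0, y) := fun y hy =>
    SmoothNear.comp (hηb _ (hNb y hy)).2 (hH.iterate_segment hr0 hr1 hy N).1
  have hL0 : ∀ y ∈ Icc (0 : ℝ) 1, L (H^[N] (0, y)) = 0 := by
    intro y hy
    have h1 := (continuous_fst.tendsto _).comp (hηb _ (hNb y hy)).1.2
    have h2 : (Prod.fst ∘ fun n => H^[n] (H^[N] (0, y))) = fun _ => (0 : ℝ) := by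
      ext n
      simp only [Function.comp_apply, ← Function.iterate_add_apply]
      exact (hH.iterate_segment hr0 hr1 hy _).2.1
    rw [h2] at h1
    exact (tendsto_nhds_unique tendsto_const_nhds h1).symm
  have hθL : ∀ y ∈ Icc (0 : ℝ) 1, Tendsto (fun x => (L (H^[N] x), (0 : ℝ))) (𝓝 (0, y))
      (𝓝 (0, 0)) := by
    intro y hy
    have := (hLs y hy).continuousAt.prodMk (continuousAt_const (y := (0 : ℝ)))
    rwa [ContinuousAt, hL0 y hy] at this
  refine ⟨fun x => θ (L (H^[N] x), 0), fun y hy => ⟨?_, ?_⟩, ?_, ?_⟩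
  · refine SmoothNear.comp (g := θ) (f := fun x => (L (H^[N] x), (0 : ℝ))) ?_
      ((hLs y hy).prodMk (smoothNear_const 0 _))
    rw [hL0 y hy]
    exact h.smooth_θ
  · beta_reduce
    rw [hL0 y hy, h.θ_zero]
  · have hc : Tendsto (fun s : ℝ => (s, (0 : ℝ))) (𝓝 0) (𝓝 (0, 0)) :=
      Continuous.tendsto' (by fun_prop) _ _ rfl
    filter_upwards [hH.fixed, hc.eventually hLW] with s h1 h2
    have h3 : ∀ n : ℕ, H^[n] (s, 0) = (s, 0) := fun n => Function.iterate_fixed h1 n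
    have h4 := h2.2
    simp only [h3] at h4
    rw [h3 N, ← tendsto_nhds_unique tendsto_const_nhds h4]
  · have hθlin : ∀ᶠ q in 𝓝 ((0 : ℝ), (0 : ℝ)), |θ q - τs - (q.1 - q.2) / 3| ≤ 1 / 12 * ‖q‖ := by
      have h1 := (Asymptotics.isLittleO_iff.1 h.smooth_θ.differentiableAt.hasFDerivAt.isLittleO)
        (show (0 : ℝ) < 1 / 12 by norm_num)
      filter_upwards [h1] with q hq
      have h2 : q - (0, 0) = q := by ext <;> simp
      have h3 : fderiv ℝ θ (0, 0) q = (q.1 - q.2) / 3 := h.fderiv_θ q.1 q.2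
      rw [h2, h.θ_zero, h3] at hq
      exact hq
    have hall : ∀ᶠ s in 𝓝 (0 : ℝ), ∀ y ∈ Icc (0 : ℝ) 1,
        (∀ n ∈ Finset.range N, |(H^[n] (s, y)).1| < δ) ∧
        H^[N] (s, y) ∈ Metric.ball ((0 : ℝ), (0 : ℝ)) η ∧
        ContinuousAt θ (L (H^[N] (s, y)), 0) ∧
        |θ (blowUp (s, y)) - τs - ((blowUp (s, y)).1 - (blowUp (s, y)).2) / 3|
          ≤ 1 / 12 * ‖blowUp (s, y)‖ := by
      refine isCompact_Icc.eventually_forall_of_forall_eventually fun y hy => ?_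
      refine Eventually.and ?_ (Eventually.and ?_ (Eventually.and ?_ ((hBt y).eventually hθlin)))
      · refine (Filter.eventually_all_finset _).2 fun n _ => ?_
        obtain ⟨h1, h2, -⟩ := hH.iterate_segment hr0 hr1 hy n
        refine (h1.fst.continuousAt.abs).eventually (gt_mem_nhds ?_)
        beta_reduce
        rw [h2]; simpa using hδ
      · exact (hH.iterate_segment hr0 hr1 hy N).1.continuousAt.eventually
          (Metric.isOpen_ball.mem_nhds (hNb y hy))
      · filter_upwards [(hθL y hy).eventually h.smooth_θ] with x hx
        exact hx.continuousAt
    filter_upwards [hall] with s hs y hy hs0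
    obtain ⟨h1, h2, h3, h4⟩ := hs y hy
    obtain ⟨⟨h5, h6⟩, -⟩ := hηb _ h2
    -- `hstep` applies along the whole orbit
    have hsmall : ∀ n : ℕ, |(H^[n] (s, y)).1| < δ := by
      intro n
      rcases lt_or_ge n N with hn | hn
      · exact h1 n (Finset.mem_range.2 hn)
      · have := h5 (n - N)
        rw [← Function.iterate_add_apply, Nat.sub_add_cancel hn] at this
        exact this
    have horbit : ∀ n : ℕ, 0 < (H^[n] (s, y)).1 ∧ (H^[n] (s, y)).2 ∈ Icc (0 : ℝ) 1 ∧
        G^[n] (tangencyChart b θ (blowUp (s, y))) = tangencyChart b θ (blowUp (H^[n] (s, y))) := by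
      intro n
      induction n with
      | zero => exact ⟨hs0, hy, rfl⟩
      | succ n ih =>
        obtain ⟨h7, h8, h9⟩ := ih
        have h10 := hball (H^[n] (s, y)).1 (by simpa using hsmall n) _ h8 h7
        rw [Function.iterate_succ_apply', Function.iterate_succ_apply', h9]
        exact ⟨h10.1, h10.2.1, h10.2.2.2.2⟩
    have hconv : Tendsto (fun n : ℕ => H^[n] (s, y)) atTop (𝓝 (L (H^[N] (s, y)), 0)) := by
      rw [← tendsto_add_atTop_iff_nat N]
      simpa only [Function.iterate_add_apply] using h6
    have hBconv : Tendsto (fun n : ℕ => blowUp (H^[n] (s, y))) atTop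
        (𝓝 (L (H^[N] (s, y)), 0)) := by
      have := (contDiff_blowUp.continuous.tendsto _).comp hconv
      rwa [blowUp_axis] at this
    have hθconv := h3.tendsto.comp hBconv
    refine ⟨?_, fun n => ?_, ?_⟩
    -- The phase is at least `θ(p, t) + t` after the first step, and `θ(p, t) + t` is about
    -- `τs + (p - t) / 3 + t ≥ τs + s / 3`.
    · have hmono : Monotone fun n : ℕ => θ (blowUp (H^[n] (s, y))) := by
        refine monotone_nat_of_le_succ fun n => ?_
        obtain ⟨h7, h8, -⟩ := horbit n
        have h10 := (hball (H^[n] (s, y)).1 (by simpa using hsmall n) _ h8 h7).2.2.1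
        rw [Function.iterate_succ_apply']
        rw [Prod.mk.eta] at h10
        rw [h10]
        have := mul_nonneg h7.le h8.1
        linarith
      have h7 := hmono.ge_of_tendsto hθconv 1
      have h8 := (hball s (by simpa using hsmall 0) y hy hs0).2.2.1
      simp only [Function.iterate_one] at h7
      rw [h8] at h7
      refine le_trans ?_ h7
      have h9 : ‖blowUp (s, y)‖ ≤ s := by
        refine (norm_prod_le_iff).2 ⟨?_, ?_⟩
        · simp only [blowUp]
          rw [Real.norm_of_nonneg (mul_nonneg hs0.le (by linarith [hy.2]))]
          nlinarith [hy.1]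
        · simp only [blowUp]
          rw [Real.norm_of_nonneg (mul_nonneg hs0.le hy.1)]
          nlinarith [hy.2]
      have h10 := (abs_le.1 h4).1
      simp only [blowUp] at h10 h9 ⊢
      nlinarith [mul_nonneg hs0.le hy.1]
    · rw [(horbit n).2.2]
      obtain ⟨h7, h8, -⟩ := horbit n
      exact (hball (H^[n] (s, y)).1 (by simpa using hsmall n) _ h8 h7).2.2.2.1
    · simp only [(horbit _).2.2]
      refine hθconv.prodMk_nhds ?_
      have h7 := (continuous_fst.tendsto _).comp hBconv
      have h8 := (continuous_snd.tendsto _).comp hBconv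
      have h9 := (h7.const_mul b).mul h8
      simpa using h9

end LimitPhase

/-! ### The foliation -/

section Chart

variable {b ρ₀ τs : ℝ} {θ : ℝ × ℝ → ℝ}

/-- On the box `|p|, |t| < ρ₀` the function `θ` is smooth, increasing in `p` and decreasing in
`t`. -/
def IsMonotoneBox (θ : ℝ × ℝ → ℝ) (ρ₀ : ℝ) : Prop :=
  ∀ p t, |p| < ρ₀ → |t| < ρ₀ → SmoothNear θ (p, t) ∧ 0 < fderiv ℝ θ (p, t) (1, 0) ∧
    fderiv ℝ θ (p, t) (0, 1) < 0

namespace IsMonotoneBox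

theorem strictMonoOn (h : IsMonotoneBox θ ρ₀) {t : ℝ} (ht : |t| < ρ₀) :
    StrictMonoOn (fun p => θ (p, t)) (Ioo (-ρ₀) ρ₀) := by
  have hd : ∀ p ∈ Ioo (-ρ₀) ρ₀, HasDerivAt (fun p => θ (p, t)) (fderiv ℝ θ (p, t) (1, 0)) p :=
    fun p hp => (h p t (abs_lt.2 hp) ht).1.differentiableAt.hasFDerivAt.comp_hasDerivAt p
      ((hasDerivAt_id p).prodMk (hasDerivAt_const p t))
  refine strictMonoOn_of_deriv_pos (convex_Ioo _ _)
    (fun p hp => (hd p hp).continuousAt.continuousWithinAt) fun p hp => ?_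
  rw [interior_Ioo] at hp
  rw [(hd p hp).deriv]
  exact (h p t (abs_lt.2 hp) ht).2.1

theorem strictAntiOn (h : IsMonotoneBox θ ρ₀) {p : ℝ} (hp : |p| < ρ₀) :
    StrictAntiOn (fun t => θ (p, t)) (Ioo (-ρ₀) ρ₀) := by
  have hd : ∀ t ∈ Ioo (-ρ₀) ρ₀, HasDerivAt (fun t => θ (p, t)) (fderiv ℝ θ (p, t) (0, 1)) t :=
    fun t ht => (h p t hp (abs_lt.2 ht)).1.differentiableAt.fderiv_apply_prod_real
  refine strictAntiOn_of_deriv_neg (convex_Ioo _ _)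
    (fun t ht => (hd t ht).continuousAt.continuousWithinAt) fun t ht => ?_
  rw [interior_Ioo] at ht
  rw [(hd t ht).deriv]
  exact (h p t hp (abs_lt.2 ht)).2.2

/-- Two points of the quadrant on the same hyperbola `p t = const` are ordered oppositely in `p` and
in `t`, and hence have different phases `θ`. -/
theorem injOn_chart (h : IsMonotoneBox θ ρ₀) (hb : 0 < b) :
    InjOn (tangencyChart b θ) (Ico 0 ρ₀ ×ˢ Ico 0 ρ₀) := by
  have key : ∀ q ∈ Ico 0 ρ₀ ×ˢ Ico 0 ρ₀, ∀ q' ∈ Ico 0 ρ₀ ×ˢ Ico 0 ρ₀,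
      tangencyChart b θ q = tangencyChart b θ q' → ¬ q.1 < q'.1 := by
    rintro ⟨p, t⟩ ⟨hp, ht⟩ ⟨p', t'⟩ ⟨hp', ht'⟩ he hlt
    simp only [tangencyChart, Prod.mk.injEq, mem_Ico] at he hp ht hp' ht' hlt
    have hρ : 0 < ρ₀ := hp.1.trans_lt hp.2
    have hpt : p * t = p' * t' := by
      have := he.2
      rw [mul_assoc, mul_assoc] at this
      exact mul_left_cancel₀ hb.ne' this
    have htt : t' ≤ t := by
      by_contra hcon
      push Not at hcon
      nlinarith [mul_nonneg hp.1 ht.1]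
    have h1 : θ (p, t) < θ (p', t) := h.strictMonoOn (by rw [abs_of_nonneg ht.1]; exact ht.2)
      ⟨by linarith, hp.2⟩ ⟨by linarith, hp'.2⟩ hlt
    have h2 : θ (p', t) ≤ θ (p', t') :=
      (h.strictAntiOn (by rw [abs_of_nonneg hp'.1]; exact hp'.2)).antitoneOn
        ⟨by linarith, ht'.2⟩ ⟨by linarith, ht.2⟩ htt
    linarith [he.1]
  rintro q hq q' hq' he
  have hp : q.1 = q'.1 := le_antisymm (not_lt.1 (key q' hq' q hq he.symm))
    (not_lt.1 (key q hq q' hq' he))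
  have hθ : θ q = θ q' := congrArg Prod.fst he
  have habs : |q.1| < ρ₀ := by rw [abs_of_nonneg hq.1.1]; exact hq.1.2
  have hρ : 0 < ρ₀ := hq.1.1.trans_lt hq.1.2
  have ht : q.2 = q'.2 := (h.strictAntiOn habs).injOn ⟨by linarith [hq.2.1], hq.2.2⟩
    ⟨by linarith [hq'.2.1], hq'.2.2⟩ (by
      have e1 : ((q.1, q.2) : ℝ × ℝ) = q := rfl
      have e2 : ((q.1, q'.2) : ℝ × ℝ) = q' := by rw [hp]
      simp only [e1, e2, hθ])
  exact Prod.ext hp ht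

theorem smoothNear_chart (h : IsMonotoneBox θ ρ₀) {q : ℝ × ℝ}
    (hq : q ∈ Ico 0 ρ₀ ×ˢ Ico 0 ρ₀) : SmoothNear (tangencyChart b θ) q := by
  have h1 : ContDiff ℝ ∞ fun q : ℝ × ℝ => b * q.1 * q.2 := by fun_prop
  exact (h q.1 q.2 (by rw [abs_of_nonneg hq.1.1]; exact hq.1.2)
    (by rw [abs_of_nonneg hq.2.1]; exact hq.2.2)).1.prodMk (h1.smoothNear _)

/-- The chart is an immersion on the quadrant without the origin. -/
theorem eq_zero_of_fderiv_chart_eq_zero (h : IsMonotoneBox θ ρ₀) (hb : 0 < b) {p t : ℝ} (hp : 0 ≤ p)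
    (ht : 0 ≤ t) (hp' : p < ρ₀) (ht' : t < ρ₀) (hpt : 0 < p + t) {w : ℝ × ℝ}
    (hw : fderiv ℝ (tangencyChart b θ) (p, t) w = 0) : w = 0 := by
  obtain ⟨h1, h2, h3⟩ := h p t (by rwa [abs_of_nonneg hp]) (by rwa [abs_of_nonneg ht])
  obtain ⟨x, y⟩ := w
  have hd2 : HasFDerivAt (fun q : ℝ × ℝ => b * q.1 * q.2)
      ((b * p) • ContinuousLinearMap.snd ℝ ℝ ℝ + t • (b • ContinuousLinearMap.fst ℝ ℝ ℝ)) (p, t) :=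
    ((hasFDerivAt_fst (𝕜 := ℝ) (E := ℝ) (F := ℝ) (p := (p, t))).const_mul b).fun_mul hasFDerivAt_snd
  have hd : HasFDerivAt (tangencyChart b θ) _ (p, t) :=
    h1.differentiableAt.hasFDerivAt.prodMk hd2
  rw [hd.fderiv] at hw
  have e1 : fderiv ℝ θ (p, t) (x, y) = 0 := congrArg Prod.fst hw
  have e2 : b * p * y + t * (b * x) = 0 := by simpa using congrArg Prod.snd hw
  have e3 : fderiv ℝ θ (p, t) (x, y) =
      x * fderiv ℝ θ (p, t) (1, 0) + y * fderiv ℝ θ (p, t) (0, 1) := by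
    have : ((x, y) : ℝ × ℝ) = x • (1, 0) + y • (0, 1) := by simp
    rw [this, map_add, map_smul, map_smul]
    simp
  rw [e3] at e1
  set A := fderiv ℝ θ (p, t) (1, 0)
  set B := fderiv ℝ θ (p, t) (0, 1)
  have e4 : p * y + t * x = 0 := by
    have : b * (p * y + t * x) = 0 := by linarith
    exact (mul_eq_zero.1 this).resolve_left hb.ne'
  have hdet : 0 < A * p - B * t := by
    rcases hp.eq_or_lt with h0 | h0
    · have : 0 < t := by linarith
      nlinarith
    · nlinarith [mul_pos h2 h0, mul_nonneg (neg_pos.2 h3).le ht]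
  have hy : y = 0 := by
    have : y * (A * p - B * t) = 0 := by linear_combination A * e4 - t * e1
    exact (mul_eq_zero.1 this).resolve_right hdet.ne'
  have hx : x = 0 := by
    rw [hy] at e1
    have : x * A = 0 := by linarith
    exact (mul_eq_zero.1 this).resolve_right h2.ne'
  rw [hx, hy]; rfl

end IsMonotoneBox

theorem IsTangencyReturn.exists_monotoneBox {dom : Set (ℝ × ℝ)} {G : ℝ × ℝ → ℝ × ℝ} {r : ℝ}
    {μ ν : ℝ × ℝ → ℝ} (h : IsTangencyReturn dom G τs b r θ μ ν) :
    ∃ ρ₀ > 0, IsMonotoneBox θ ρ₀ := by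
  have h1 := (h.smooth_θ.fderiv_apply (1, 0)).continuousAt.eventually (lt_mem_nhds (a := 0) (by
    beta_reduce; rw [h.θ_fst]; norm_num))
  have h2 : ∀ᶠ q in 𝓝 ((0 : ℝ), (0 : ℝ)), fderiv ℝ θ q (0, 1) < 0 :=
    (h.smooth_θ.fderiv_apply (0, 1)).continuousAt.eventually_lt continuousAt_const (by
      rw [h.θ_snd]; norm_num)
  obtain ⟨ρ₀, hρ, hball⟩ :=
    Metric.eventually_nhds_iff_ball.1 (h.smooth_θ.eventually.and (h1.and h2))
  refine ⟨ρ₀, hρ, fun p t hp ht => hball (p, t) ?_⟩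
  rw [Metric.mem_ball, Prod.dist_eq]
  simp only [Real.dist_eq, sub_zero, max_lt_iff]
  exact ⟨hp, ht⟩

/-- Every point of the closed half-plane near the tangency point is in the image of a small part of
the quadrant: along the hyperbola `b p t = v`, with the parameter `u = p - t`, the phase `θ` takes
values on both sides of `τs`. -/
theorem IsMonotoneBox.surjects (h : IsMonotoneBox θ ρ₀) (hb : 0 < b) (hθ0 : θ (0, 0) = τs) {η : ℝ}
    (hη : 0 < η) (hηρ : η ≤ ρ₀) : ∀ᶠ w in 𝓝[{w : ℝ × ℝ | 0 ≤ w.2}] (τs, 0),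
      ∃ q : ℝ × ℝ, 0 ≤ q.1 ∧ 0 ≤ q.2 ∧ q.1 + q.2 < η ∧ tangencyChart b θ q = w := by
  -- `Q u v` is the point of the quadrant with `p - t = u` and `b p t = v`
  let R : ℝ → ℝ → ℝ := fun u v => √(u ^ 2 + 4 * v / b)
  let Q : ℝ → ℝ → ℝ × ℝ := fun u v => ((R u v + u) / 2, (R u v - u) / 2)
  have hR : Continuous fun z : ℝ × ℝ => R z.1 z.2 := by fun_prop
  have hQ : Continuous fun z : ℝ × ℝ => Q z.1 z.2 := by fun_prop
  have ha : 0 < η / 4 := by linarith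
  have hR0 : ∀ u, R u 0 = |u| := fun u => by simp [R, Real.sqrt_sq_eq_abs]
  have hQ1 : Q (η / 4) 0 = (η / 4, 0) := by
    simp only [Q, hR0, abs_of_pos ha]
    ext <;> simp
  have hQ2 : Q (-(η / 4)) 0 = (0, η / 4) := by
    simp only [Q, hR0, abs_neg, abs_of_pos ha]
    ext <;> simp
  have h0ρ : |(0 : ℝ)| < ρ₀ := by simpa using hη.trans_le hηρ
  have haρ : |η / 4| < ρ₀ := by rw [abs_of_pos ha]; linarith
  have hright : τs < θ (η / 4, 0) := by
    rw [← hθ0]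
    exact h.strictMonoOn h0ρ (abs_lt.1 h0ρ) (abs_lt.1 haρ) ha
  have hleft : θ (0, η / 4) < τs := by
    rw [← hθ0]
    exact h.strictAntiOn h0ρ (abs_lt.1 h0ρ) (abs_lt.1 haρ) ha
  have hcont : ∀ u q, Q u 0 = q → ContinuousAt θ q →
      ContinuousAt (fun w : ℝ × ℝ => θ (Q u w.2)) (τs, 0) := by
    intro u q hq hθ
    have h1 : Continuous fun w : ℝ × ℝ => Q u w.2 :=
      hQ.comp (by fun_prop : Continuous fun w : ℝ × ℝ => (u, w.2))
    refine ContinuousAt.comp (f := fun w : ℝ × ℝ => Q u w.2) ?_ h1.continuousAt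
    simp only [hq]
    exact hθ
  have e1 : ∀ᶠ w : ℝ × ℝ in 𝓝 (τs, 0), w.1 < θ (Q (η / 4) w.2) := by
    refine continuousAt_fst.eventually_lt (hcont _ _ hQ1 (h _ _ haρ h0ρ).1.continuousAt) ?_
    simpa only [hQ1] using hright
  have e2 : ∀ᶠ w : ℝ × ℝ in 𝓝 (τs, 0), θ (Q (-(η / 4)) w.2) < w.1 := by
    refine (hcont _ _ hQ2 (h _ _ h0ρ haρ).1.continuousAt).eventually_lt continuousAt_fst ?_
    simpa only [hQ2] using hleft
  have e3 : ∀ᶠ w : ℝ × ℝ in 𝓝 (τs, 0), R (η / 4) w.2 < η := by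
    have h1 : Continuous fun w : ℝ × ℝ => R (η / 4) w.2 :=
      hR.comp (by fun_prop : Continuous fun w : ℝ × ℝ => (η / 4, w.2))
    refine h1.continuousAt.eventually (gt_mem_nhds ?_)
    simp only [hR0, abs_of_pos ha]
    linarith
  filter_upwards [mem_nhdsWithin_of_mem_nhds e1, mem_nhdsWithin_of_mem_nhds e2,
    mem_nhdsWithin_of_mem_nhds e3, self_mem_nhdsWithin] with w h1 h2 h3 h4
  have hv : 0 ≤ 4 * w.2 / b := div_nonneg (mul_nonneg (by norm_num) h4) hb.le
  have habs : ∀ u, |u| ≤ R u w.2 := fun u => by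
    rw [← Real.sqrt_sq_eq_abs]
    exact Real.sqrt_le_sqrt (by linarith)
  have hQnn : ∀ u, 0 ≤ (Q u w.2).1 ∧ 0 ≤ (Q u w.2).2 := fun u => by
    have := abs_le.1 (habs u)
    exact ⟨by simp only [Q]; linarith [this.1], by simp only [Q]; linarith [this.2]⟩
  have hsum : ∀ u ∈ Icc (-(η / 4)) (η / 4), (Q u w.2).1 + (Q u w.2).2 < η := by
    intro u hu
    have h5 : (Q u w.2).1 + (Q u w.2).2 = R u w.2 := by simp only [Q]; ring
    rw [h5]
    refine lt_of_le_of_lt (Real.sqrt_le_sqrt ?_) h3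
    have := sq_le_sq' hu.1 hu.2
    linarith
  have hc : ContinuousOn (fun u => θ (Q u w.2)) (Icc (-(η / 4)) (η / 4)) := by
    intro u hu
    have h5 := hsum u hu
    have h6 := hQnn u
    have h7 : ContinuousAt θ (Q u w.2) := (h (Q u w.2).1 (Q u w.2).2
      (by rw [abs_of_nonneg h6.1]; linarith [h6.2])
      (by rw [abs_of_nonneg h6.2]; linarith [h6.1])).1.continuousAt
    have h8 : Continuous fun u : ℝ => Q u w.2 :=
      hQ.comp (by fun_prop : Continuous fun u : ℝ => (u, w.2))
    exact (ContinuousAt.comp (f := fun u : ℝ => Q u w.2) h7 h8.continuousAt).continuousWithinAt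
  obtain ⟨u, hu, he⟩ := intermediate_value_Icc (by linarith) hc ⟨h2.le, h1.le⟩
  refine ⟨Q u w.2, (hQnn u).1, (hQnn u).2, hsum u hu, Prod.ext he ?_⟩
  have h5 : R u w.2 ^ 2 = u ^ 2 + 4 * w.2 / b := Real.sq_sqrt (by positivity)
  simp only [tangencyChart, Q]
  have h6 : b * ((R u w.2 + u) / 2) * ((R u w.2 - u) / 2) = b * (R u w.2 ^ 2 - u ^ 2) / 4 := by
    ring
  rw [h6, h5]
  field_simp
  ring

end Chart

section Inverse

/-- The inverse of an injective immersion between spaces of the same dimension is smooth. -/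
theorem contDiffAt_invFunOn {E : Type} [NormedAddCommGroup E] [NormedSpace ℝ E]
    [FiniteDimensional ℝ E] {F : E → E} {A : Set E} (hA : IsOpen A)
    (hinj : InjOn F A) {a : E} (ha : a ∈ A) (hs : ContDiffAt ℝ ∞ F a)
    (hd : ∀ w, fderiv ℝ F a w = 0 → w = 0) : ContDiffAt ℝ ∞ (Function.invFunOn F A) (F a) := by
  have : CompleteSpace E := FiniteDimensional.complete ℝ E
  have hi : Function.Injective (fderiv ℝ F a : E →ₗ[ℝ] E) :=
    (injective_iff_map_eq_zero _).2 hd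
  let e : E ≃L[ℝ] E := (LinearEquiv.ofInjectiveEndo (fderiv ℝ F a : E →ₗ[ℝ] E) hi)
    |>.toContinuousLinearEquiv
  have he : HasFDerivAt F (e : E →L[ℝ] E) a := by
    have h1 : (e : E →L[ℝ] E) = fderiv ℝ F a := by
      ext w; rfl
    rw [h1]
    exact (hs.differentiableAt (by simp)).hasFDerivAt
  have hne : (∞ : WithTop ℕ∞) ≠ 0 := by simp
  have hstrict := hs.hasStrictFDerivAt' he hne
  refine (hs.to_localInverse he hne).congr_of_eventuallyEq ?_
  have hloc : Tendsto (hs.localInverse he hne) (𝓝 (F a)) (𝓝 a) := by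
    have h1 := (hs.to_localInverse he hne).continuousAt
    rwa [ContinuousAt, hs.localInverse_apply_image he hne] at h1
  filter_upwards [hloc.eventually (hA.mem_nhds ha), hstrict.eventually_right_inverse] with z h1 h2
  have h3 : F (hs.localInverse he hne z) = z := h2
  have h4 : z ∈ F '' A := ⟨_, h1, h3⟩
  exact hinj (Function.invFunOn_mem h4) h1 ((Function.invFunOn_eq h4).trans h3.symm)

end Inverse

/-! ### The leaves -/

/-- In the coordinates `(s, y)` of `blowUp`, the function `Λ` is the limit phase on the rectangle
`[0, δ] × [0, 1]`. -/
structure IsLimitPhaseOn (Λ θ : ℝ × ℝ → ℝ) (τs δ : ℝ) : Prop where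
  smooth : ∀ s ∈ Icc 0 δ, ∀ y ∈ Icc (0 : ℝ) 1, SmoothNear Λ (s, y)
  deriv_pos : ∀ s ∈ Icc 0 δ, ∀ y ∈ Icc (0 : ℝ) 1, 0 < fderiv ℝ Λ (s, y) (1, 0)
  zero : ∀ y ∈ Icc (0 : ℝ) 1, Λ (0, y) = τs
  axis : ∀ s ∈ Icc 0 δ, Λ (s, 0) = θ (s, 0)
  le : ∀ s ∈ Icc 0 δ, ∀ y ∈ Icc (0 : ℝ) 1, τs + s / 4 ≤ Λ (s, y)

/-- The limit phase increases from `τs` in the direction of `s`, uniformly on the blown-up point. -/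
theorem exists_isLimitPhaseOn {Λ θ : ℝ × ℝ → ℝ} {τs ρ₀ : ℝ} {P : ℝ → ℝ → Prop} (hρ₀ : 0 < ρ₀)
    (h0 : ∀ y ∈ Icc (0 : ℝ) 1, SmoothNear Λ (0, y) ∧ Λ (0, y) = τs)
    (hax : ∀ᶠ s in 𝓝 (0 : ℝ), Λ (s, 0) = θ (s, 0))
    (hle : ∀ᶠ s in 𝓝 (0 : ℝ), ∀ y ∈ Icc (0 : ℝ) 1, 0 < s → τs + s / 4 ≤ Λ (s, y) ∧ P s y) :
    ∃ δ, 0 < δ ∧ δ < ρ₀ ∧ IsLimitPhaseOn Λ θ τs δ ∧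
      ∀ s ∈ Ioc 0 δ, ∀ y ∈ Icc (0 : ℝ) 1, P s y := by
  have hd : ∀ y ∈ Icc (0 : ℝ) 1, 0 < fderiv ℝ Λ (0, y) (1, 0) := by
    intro y hy
    have h1 : HasDerivAt (fun s => Λ (s, y)) (fderiv ℝ Λ (0, y) (1, 0)) 0 :=
      (h0 y hy).1.differentiableAt.hasFDerivAt.comp_hasDerivAt 0
        ((hasDerivAt_id (0 : ℝ)).prodMk (hasDerivAt_const 0 y))
    have h2 : Tendsto (slope (fun s => Λ (s, y)) 0) (𝓝[>] 0) (𝓝 (fderiv ℝ Λ (0, y) (1, 0))) :=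
      (hasDerivAt_iff_tendsto_slope.1 h1).mono_left (nhdsWithin_mono _ fun x hx => ne_of_gt hx)
    have h3 : (1 : ℝ) / 4 ≤ fderiv ℝ Λ (0, y) (1, 0) := by
      refine ge_of_tendsto h2 ?_
      filter_upwards [mem_nhdsWithin_of_mem_nhds hle, self_mem_nhdsWithin] with s h4 h5
      have h6 := (h4 y hy h5).1
      rw [slope_def_field, (h0 y hy).2, le_div_iff₀ (by simpa using h5)]
      linarith
    linarith
  have hnear : ∀ᶠ s in 𝓝 (0 : ℝ), ∀ y ∈ Icc (0 : ℝ) 1, SmoothNear Λ (s, y) ∧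
      0 < fderiv ℝ Λ (s, y) (1, 0) :=
    isCompact_Icc.eventually_forall_of_forall_eventually fun y hy =>
      (h0 y hy).1.eventually.and
        (((h0 y hy).1.fderiv_apply (1, 0)).continuousAt.eventually (lt_mem_nhds (hd y hy)))
  obtain ⟨ε, hε, hball⟩ := Metric.eventually_nhds_iff.1 (hnear.and (hax.and hle))
  have hδ : 0 < min ε ρ₀ / 2 := half_pos (lt_min hε hρ₀)
  have hball' : ∀ s ∈ Icc 0 (min ε ρ₀ / 2), dist s 0 < ε := by
    intro s hs
    rw [Real.dist_0_eq_abs, abs_of_nonneg hs.1]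
    linarith [hs.2, min_le_left ε ρ₀]
  refine ⟨min ε ρ₀ / 2, hδ, by linarith [min_le_right ε ρ₀], ⟨fun s hs y hy => ?_,
    fun s hs y hy => ?_, fun y hy => (h0 y hy).2, fun s hs => ?_, fun s hs y hy => ?_⟩,
    fun s hs y hy => ?_⟩
  · exact ((hball (hball' s hs)).1 y hy).1
  · exact ((hball (hball' s hs)).1 y hy).2
  · exact (hball (hball' s hs)).2.1
  · rcases hs.1.eq_or_lt with rfl | h
    · rw [(h0 y hy).2]; simp
    · exact ((hball (hball' s hs)).2.2 y hy h).1
  · exact ((hball (hball' s ⟨hs.1.le, hs.2⟩)).2.2 y hy hs.1).2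

/-- The coordinate `s` of the point with limit phase `τ` on the ray `y = const` of the quadrant,
as a function of `(τ, y)`. -/
noncomputable def leafRadius (Λ : ℝ × ℝ → ℝ) (δ : ℝ) : ℝ × ℝ → ℝ :=
  rootOn (fun z : (ℝ × ℝ) × ℝ => Λ (z.2, z.1.2) - z.1.1) 0 δ

/-- The leaf of limit phase `τ`, parametrized by `y`. -/
noncomputable def leafMap (Λ θ : ℝ × ℝ → ℝ) (b δ : ℝ) (x : ℝ × ℝ) : ℝ × ℝ :=
  tangencyChart b θ (blowUp (leafRadius Λ δ x, x.2))

/-- The part of the half-plane that is filled by the leaves of limit phase less than `τs + δ / 4`,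
together with the tangency point. -/
def leafUnion (Λ θ : ℝ × ℝ → ℝ) (b τs δ : ℝ) : Set (ℝ × ℝ) :=
  (fun x => tangencyChart b θ (blowUp x)) '' {x | x ∈ Ico 0 δ ×ˢ Icc 0 1 ∧ Λ x < τs + δ / 4}

theorem blowUp_mem {s y ρ₀ : ℝ} (hs : s ∈ Ico 0 ρ₀) (hy : y ∈ Icc (0 : ℝ) 1) :
    blowUp (s, y) ∈ Ico 0 ρ₀ ×ˢ Ico 0 ρ₀ := by
  have h1 : s * y ≤ s := mul_le_of_le_one_right hs.1 hy.2
  have h2 : 0 ≤ s * y := mul_nonneg hs.1 hy.1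
  have h3 : (blowUp (s, y)).1 = s - s * y := by simp only [blowUp]; ring
  exact ⟨⟨by rw [h3]; linarith, by rw [h3]; linarith [hs.2]⟩, ⟨h2, h1.trans_lt hs.2⟩⟩

theorem tangencyChart_snd_pos_iff {b s y : ℝ} {θ : ℝ × ℝ → ℝ} (hb : 0 < b) (hs : 0 ≤ s)
    (hy : y ∈ Icc (0 : ℝ) 1) : 0 < (tangencyChart b θ (blowUp (s, y))).2 ↔
      0 < s ∧ y ∈ Ioo (0 : ℝ) 1 := by
  simp only [tangencyChart, blowUp]
  constructor
  · intro h
    have hs' : s ≠ 0 := by rintro rfl; simp at h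
    have h0 : y ≠ 0 := by rintro rfl; simp at h
    have h1 : y ≠ 1 := by rintro rfl; simp at h
    exact ⟨lt_of_le_of_ne hs hs'.symm, lt_of_le_of_ne hy.1 h0.symm, lt_of_le_of_ne hy.2 h1⟩
  · rintro ⟨h1, h2, h3⟩
    have : 0 < 1 - y := by linarith
    positivity

theorem tangencyChart_blowUp_snd_nonneg {b s y : ℝ} {θ : ℝ × ℝ → ℝ} (hb : 0 < b) (hs : 0 ≤ s)
    (hy : y ∈ Icc (0 : ℝ) 1) : 0 ≤ (tangencyChart b θ (blowUp (s, y))).2 := by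
  simp only [tangencyChart, blowUp]
  have h1 := hy.1
  have : 0 ≤ 1 - y := by linarith [hy.2]
  positivity

namespace IsLimitPhaseOn

variable {Λ θ : ℝ × ℝ → ℝ} {b τs δ ρ₀ : ℝ}

/-- As `Λ(0, y) = τs` and `Λ(δ, y) ≥ τs + δ / 4`, the ray `y = const` meets each level of `Λ` in
`(τs, τs + δ / 4)` exactly once. -/
theorem leafRadius_spec (h : IsLimitPhaseOn Λ θ τs δ) (hδ : 0 < δ) {τ y : ℝ}
    (hτ : τ ∈ Ioo τs (τs + δ / 4)) (hy : y ∈ Icc (0 : ℝ) 1) :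
    SmoothNear (leafRadius Λ δ) (τ, y) ∧ leafRadius Λ δ (τ, y) ∈ Ioo 0 δ ∧
      Λ (leafRadius Λ δ (τ, y), y) = τ ∧
      ∀ q ∈ Icc 0 δ, Λ (q, y) = τ → q = leafRadius Λ δ (τ, y) := by
  have hs : ∀ q ∈ Icc 0 δ, SmoothNear (fun z : (ℝ × ℝ) × ℝ => Λ (z.2, z.1.2) - z.1.1)
      ((τ, y), q) := by
    intro q hq
    have h1 : ContDiff ℝ ∞ fun z : (ℝ × ℝ) × ℝ => (z.2, z.1.2) := by fun_prop
    have h2 : ContDiff ℝ ∞ fun z : (ℝ × ℝ) × ℝ => z.1.1 := by fun_prop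
    exact (SmoothNear.comp (f := fun z : (ℝ × ℝ) × ℝ => (z.2, z.1.2)) (x := ((τ, y), q))
      (h.smooth q hq y hy) (h1.smoothNear _)).sub (h2.smoothNear _)
  have hd : ∀ q ∈ Icc 0 δ,
      0 < fderiv ℝ (fun z : (ℝ × ℝ) × ℝ => Λ (z.2, z.1.2) - z.1.1) ((τ, y), q) (0, 1) := by
    intro q hq
    have h1 := (hs q hq).differentiableAt.fderiv_apply_prod_real
    have h2 : HasDerivAt (fun q => Λ (q, y) - τ) (fderiv ℝ Λ (q, y) (1, 0)) q :=
      ((h.smooth q hq y hy).differentiableAt.hasFDerivAt.comp_hasDerivAt q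
        ((hasDerivAt_id q).prodMk (hasDerivAt_const q y))).sub_const τ
    rw [h1.unique h2]
    exact h.deriv_pos q hq y hy
  obtain ⟨h1, h2⟩ := smoothNear_rootOn hδ.le hs hd
    (by simp only [h.zero y hy]; linarith [hτ.1])
    (by have := h.le δ ⟨hδ.le, le_rfl⟩ y hy; simp only; linarith [hτ.2])
  obtain ⟨h3, h4, h5⟩ := h2.self_of_nhds
  exact ⟨h1, h3, sub_eq_zero.1 h4, fun q hq hq' => h5 q hq (sub_eq_zero.2 hq')⟩

theorem smoothNear_leafMap (h : IsLimitPhaseOn Λ θ τs δ) (hbox : IsMonotoneBox θ ρ₀) (hδ : 0 < δ)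
    (hδρ : δ < ρ₀) {τ y : ℝ} (hτ : τ ∈ Ioo τs (τs + δ / 4)) (hy : y ∈ Icc (0 : ℝ) 1) :
    SmoothNear (leafMap Λ θ b δ) (τ, y) := by
  obtain ⟨h1, h2, -⟩ := h.leafRadius_spec hδ hτ hy
  have h3 := blowUp_mem (ρ₀ := ρ₀) ⟨h2.1.le, h2.2.trans hδρ⟩ hy
  have h4 : SmoothNear (tangencyChart b θ) (blowUp (leafRadius Λ δ (τ, y), y)) :=
    hbox.smoothNear_chart h3
  refine SmoothNear.comp (f := fun x : ℝ × ℝ => blowUp (leafRadius Λ δ x, x.2)) h4 ?_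
  exact SmoothNear.comp (f := fun x : ℝ × ℝ => (leafRadius Λ δ x, x.2))
    (contDiff_blowUp.smoothNear _) (h1.prodMk (contDiff_snd.smoothNear _))

/-- A leaf crosses the rays of the quadrant, so that it cannot have a stationary point: in the
coordinates `(p, t)` its velocity is `(σ' (1 - y) - σ, σ' y + σ)`, where `σ > 0` is the radius. -/
theorem isSmoothArc_leafMap (h : IsLimitPhaseOn Λ θ τs δ) (hbox : IsMonotoneBox θ ρ₀) (hb : 0 < b)
    (hδ : 0 < δ) (hδρ : δ < ρ₀) (hθ0 : θ (0, 0) = τs) {τ : ℝ} (hτ : τ ∈ Ioo τs (τs + δ / 4)) :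
    ∃ τ' < τs, IsSmoothArc (fun y => leafMap Λ θ b δ (τ, y)) (τ, 0) (τ', 0) := by
  have h0 : (0 : ℝ) ∈ Icc (0 : ℝ) 1 := ⟨le_rfl, zero_le_one⟩
  have h1 : (1 : ℝ) ∈ Icc (0 : ℝ) 1 := ⟨zero_le_one, le_rfl⟩
  have hmem : ∀ y ∈ Icc (0 : ℝ) 1, blowUp (leafRadius Λ δ (τ, y), y) ∈ Ico 0 ρ₀ ×ˢ Ico 0 ρ₀ :=
    fun y hy => by
      have := (h.leafRadius_spec hδ hτ hy).2.1
      exact blowUp_mem ⟨this.1.le, this.2.trans hδρ⟩ hy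
  refine ⟨θ (0, leafRadius Λ δ (τ, 1)), ?_, ?_, ?_, ?_, ?_, ?_⟩
  · have h2 := (h.leafRadius_spec hδ hτ h1).2.1
    rw [← hθ0]
    have h0ρ : |(0 : ℝ)| < ρ₀ := by simpa using hδ.trans hδρ
    refine hbox.strictAntiOn h0ρ (abs_lt.1 h0ρ) ⟨?_, h2.2.trans hδρ⟩ h2.1
    linarith [h2.1]
  · intro y hy
    have h2 : ContDiffAt ℝ ∞ (fun y : ℝ => (τ, y)) y := by fun_prop
    exact (ContDiffAt.comp y (h.smoothNear_leafMap (b := b) hbox hδ hδρ hτ hy).contDiffAt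
      h2).contDiffWithinAt
  · intro y hy y' hy' he
    have h2 := hbox.injOn_chart hb (hmem y hy) (hmem y' hy') he
    have hσ := (h.leafRadius_spec hδ hτ hy).2.1.1
    simp only [blowUp, Prod.mk.injEq] at h2
    have h3 : leafRadius Λ δ (τ, y) = leafRadius Λ δ (τ, y') := by linarith [h2.1, h2.2]
    rw [← h3] at h2
    exact mul_left_cancel₀ hσ.ne' h2.2
  · intro y hy hzero
    obtain ⟨h2, h3, -⟩ := h.leafRadius_spec hδ hτ hy
    have hm := hmem y hy
    set σ := leafRadius Λ δ (τ, y) with hσ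
    obtain ⟨σ', hσ'⟩ : ∃ σ', HasDerivAt (fun y => leafRadius Λ δ (τ, y)) σ' y :=
      ⟨_, h2.differentiableAt.fderiv_apply_prod_real⟩
    have hB : HasDerivAt (fun y => blowUp (leafRadius Λ δ (τ, y), y))
        (σ' * (1 - y) + σ * (-1), σ' * y + σ * 1) y :=
      (hσ'.mul ((hasDerivAt_id y).const_sub 1)).prodMk (hσ'.mul (hasDerivAt_id y))
    have hch : SmoothNear (tangencyChart b θ) (blowUp (σ, y)) :=
      hbox.smoothNear_chart hm
    have hγ : HasDerivAt (fun y => leafMap Λ θ b δ (τ, y))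
        (fderiv ℝ (tangencyChart b θ) (blowUp (σ, y))
          (σ' * (1 - y) + σ * (-1), σ' * y + σ * 1)) y :=
      hch.differentiableAt.hasFDerivAt.comp_hasDerivAt y hB
    rw [hγ.hasDerivWithinAt.derivWithin (uniqueDiffOn_Icc zero_lt_one y hy)] at hzero
    have hsum : 0 < (blowUp (σ, y)).1 + (blowUp (σ, y)).2 := by
      have : (blowUp (σ, y)).1 + (blowUp (σ, y)).2 = σ := by simp only [blowUp]; ring
      rw [this]; exact h3.1
    have h4 := hbox.eq_zero_of_fderiv_chart_eq_zero hb hm.1.1 hm.2.1 hm.1.2 hm.2.2 hsum hzero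
    rw [Prod.mk_eq_zero] at h4
    have hs0 : σ' = 0 := by linarith [h4.1, h4.2]
    rw [hs0] at h4
    linarith [h4.2, h3.1]
  · obtain ⟨-, h3, h4, -⟩ := h.leafRadius_spec hδ hτ h0
    simp only [leafMap, tangencyChart, blowUp_axis, mul_zero]
    rw [← h.axis _ ⟨h3.1.le, h3.2.le⟩, h4]
  · simp [leafMap, tangencyChart, blowUp]

theorem mem_leafUnion (h : IsLimitPhaseOn Λ θ τs δ) (hδ : 0 < δ) {τ y : ℝ}
    (hτ : τ ∈ Ioo τs (τs + δ / 4)) (hy : y ∈ Icc (0 : ℝ) 1) :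
    leafMap Λ θ b δ (τ, y) ∈ leafUnion Λ θ b τs δ := by
  obtain ⟨-, h2, h3, -⟩ := h.leafRadius_spec hδ hτ hy
  exact ⟨_, ⟨⟨⟨h2.1.le, h2.2⟩, hy⟩, by rw [h3]; exact hτ.2⟩, rfl⟩

theorem leafMap_mem_upperHalf (h : IsLimitPhaseOn Λ θ τs δ) (hb : 0 < b) (hδ : 0 < δ) {τ y : ℝ}
    (hτ : τ ∈ Ioo τs (τs + δ / 4)) (hy : y ∈ Ioo (0 : ℝ) 1) :
    leafMap Λ θ b δ (τ, y) ∈ leafUnion Λ θ b τs δ ∩ upperHalf := by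
  have hy' := Ioo_subset_Icc_self hy
  obtain ⟨-, h2, -⟩ := h.leafRadius_spec hδ hτ hy'
  exact ⟨h.mem_leafUnion hδ hτ hy', (tangencyChart_snd_pos_iff hb h2.1.le hy').2 ⟨h2.1, hy⟩⟩

/-- A point of the union of leaves with positive velocity lies on the leaf of its limit phase. -/
theorem exists_leaf (h : IsLimitPhaseOn Λ θ τs δ) (hb : 0 < b) (hδ : 0 < δ) {w : ℝ × ℝ}
    (hw : w ∈ leafUnion Λ θ b τs δ ∩ upperHalf) : ∃ s ∈ Ioo 0 δ, ∃ y ∈ Ioo (0 : ℝ) 1,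
      Λ (s, y) ∈ Ioo τs (τs + δ / 4) ∧ tangencyChart b θ (blowUp (s, y)) = w ∧
      leafMap Λ θ b δ (Λ (s, y), y) = w := by
  obtain ⟨⟨⟨s, y⟩, ⟨⟨hs, hy⟩, hlt⟩, rfl⟩, hpos⟩ := hw
  obtain ⟨hs0, hy'⟩ := (tangencyChart_snd_pos_iff hb hs.1 hy).1 hpos
  have hτ : Λ (s, y) ∈ Ioo τs (τs + δ / 4) :=
    ⟨by linarith [h.le s ⟨hs.1, hs.2.le⟩ y hy], hlt⟩
  refine ⟨s, ⟨hs0, hs.2⟩, y, hy', hτ, rfl, ?_⟩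
  have := (h.leafRadius_spec hδ hτ hy).2.2.2 s ⟨hs.1, hs.2.le⟩ rfl
  simp only [leafMap, ← this]

/-- The union of leaves contains a neighbourhood of the tangency point in the half-plane. -/
theorem leafUnion_mem_nhdsWithin (h : IsLimitPhaseOn Λ θ τs δ) (hbox : IsMonotoneBox θ ρ₀)
    (hb : 0 < b) (hδ : 0 < δ) (hδρ : δ < ρ₀) (hθ0 : θ (0, 0) = τs) :
    leafUnion Λ θ b τs δ ∈ 𝓝[closedUpperHalf] (τs, 0) := by
  have h1 : ∀ᶠ s in 𝓝 (0 : ℝ), ∀ y ∈ Icc (0 : ℝ) 1, Λ (s, y) < τs + δ / 4 :=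
    isCompact_Icc.eventually_forall_of_forall_eventually fun y hy =>
      (h.smooth 0 ⟨le_rfl, hδ.le⟩ y hy).continuousAt.eventually
        (gt_mem_nhds (by rw [h.zero y hy]; linarith))
  obtain ⟨ε, hε, hball⟩ := Metric.eventually_nhds_iff.1 h1
  filter_upwards [hbox.surjects hb hθ0 (lt_min hε hδ) ((min_le_right ε δ).trans hδρ.le)]
    with w ⟨⟨p, t⟩, hp, ht, hlt, hw⟩
  simp only at hp ht hlt
  have hs : p + t < δ := hlt.trans_le (min_le_right _ _)
  have hy : t / (p + t) ∈ Icc (0 : ℝ) 1 :=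
    ⟨by positivity, div_le_one_of_le₀ (by linarith) (by linarith)⟩
  refine ⟨(p + t, t / (p + t)), ⟨⟨⟨by simp only; linarith, hs⟩, hy⟩, hball ?_ _ hy⟩, ?_⟩
  · rw [Real.dist_0_eq_abs, abs_of_nonneg (by linarith)]
    exact hlt.trans_le (min_le_left _ _)
  · have h2 : (p + t) * (t / (p + t)) = t := by
      rcases eq_or_ne (p + t) 0 with h3 | h3
      · rw [h3]; simp; linarith
      · field_simp
    have h4 : blowUp (p + t, t / (p + t)) = (p, t) := by
      simp only [blowUp, mul_sub, h2, mul_one]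
      ext <;> simp
    simp only [h4, hw]

theorem isSmoothDiffeoOn_leafMap (h : IsLimitPhaseOn Λ θ τs δ) (hbox : IsMonotoneBox θ ρ₀)
    (hb : 0 < b) (hδ : 0 < δ) (hδρ : δ < ρ₀) :
    IsSmoothDiffeoOn (leafMap Λ θ b δ) (Ioo τs (τs + δ / 4) ×ˢ Ioo (0 : ℝ) 1)
      (leafUnion Λ θ b τs δ ∩ upperHalf) := by
  set A : Set (ℝ × ℝ) := Ioo 0 ρ₀ ×ˢ Ioo 0 ρ₀ with hA
  have hinj : InjOn (tangencyChart b θ) A := (hbox.injOn_chart hb).mono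
    (prod_mono Ioo_subset_Ico_self Ioo_subset_Ico_self)
  -- The inverse is the chart inverse `N`, followed by the inverse `V` of `blowUp` and by
  -- `(s, y) ↦ (Λ(s, y), y)`.
  let N : ℝ × ℝ → ℝ × ℝ := Function.invFunOn (tangencyChart b θ) A
  let V : ℝ × ℝ → ℝ × ℝ := fun q => (q.1 + q.2, q.2 / (q.1 + q.2))
  let Ψ : ℝ × ℝ → ℝ × ℝ := fun w => (Λ (V (N w)), (V (N w)).2)
  have hBA : ∀ s ∈ Ioo 0 δ, ∀ y ∈ Ioo (0 : ℝ) 1, blowUp (s, y) ∈ A := by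
    intro s hs y hy
    have h1 := blowUp_mem (ρ₀ := ρ₀) ⟨hs.1.le, hs.2.trans hδρ⟩ (Ioo_subset_Icc_self hy)
    exact ⟨⟨mul_pos hs.1 (by simpa using hy.2), h1.1.2⟩, ⟨mul_pos hs.1 hy.1, h1.2.2⟩⟩
  have hN : ∀ s ∈ Ioo 0 δ, ∀ y ∈ Ioo (0 : ℝ) 1,
      N (tangencyChart b θ (blowUp (s, y))) = blowUp (s, y) := fun s hs y hy =>
    hinj.leftInvOn_invFunOn (hBA s hs y hy)
  have hsum : ∀ s y, (blowUp (s, y)).1 + (blowUp (s, y)).2 = s := fun s y => by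
    simp only [blowUp]; ring
  have hV : ∀ s ∈ Ioo 0 δ, ∀ y, V (blowUp (s, y)) = (s, y) := by
    intro s hs y
    simp only [V, hsum]
    refine Prod.ext rfl ?_
    simp only [blowUp]
    exact mul_div_cancel_left₀ y hs.1.ne'
  have hΨ : ∀ s ∈ Ioo 0 δ, ∀ y ∈ Ioo (0 : ℝ) 1,
      Ψ (tangencyChart b θ (blowUp (s, y))) = (Λ (s, y), y) := by
    intro s hs y hy
    simp only [Ψ, hN s hs y hy, hV s hs y]
  have hinv : InvOn Ψ (leafMap Λ θ b δ) (Ioo τs (τs + δ / 4) ×ˢ Ioo (0 : ℝ) 1)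
      (leafUnion Λ θ b τs δ ∩ upperHalf) := by
    constructor
    · rintro ⟨τ, y⟩ ⟨hτ, hy⟩
      obtain ⟨-, h2, h3, -⟩ := h.leafRadius_spec hδ hτ (Ioo_subset_Icc_self hy)
      simp only at h2 h3
      simp only [leafMap, hΨ _ h2 y hy, h3]
    · intro w hw
      obtain ⟨s, hs, y, hy, -, h3, h4⟩ := h.exists_leaf hb hδ hw
      rw [← h3, hΨ s hs y hy, h4, h3]
  refine ⟨?_, ?_, Ψ, ?_, hinv⟩
  · rintro ⟨τ, y⟩ ⟨hτ, hy⟩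
    exact (h.smoothNear_leafMap hbox hδ hδρ hτ
      (Ioo_subset_Icc_self hy)).contDiffAt.contDiffWithinAt
  · refine hinv.bijOn ?_ ?_
    · rintro ⟨τ, y⟩ ⟨hτ, hy⟩
      exact h.leafMap_mem_upperHalf hb hδ hτ hy
    · intro w hw
      obtain ⟨s, hs, y, hy, hτ, h3, -⟩ := h.exists_leaf hb hδ hw
      rw [← h3, hΨ s hs y hy]
      exact ⟨hτ, hy⟩
  · intro w hw
    obtain ⟨s, hs, y, hy, -, rfl, -⟩ := h.exists_leaf hb hδ hw
    have hq := hBA s hs y hy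
    have hsm : SmoothNear (tangencyChart b θ) (blowUp (s, y)) :=
      hbox.smoothNear_chart ⟨Ioo_subset_Ico_self hq.1, Ioo_subset_Ico_self hq.2⟩
    have hNs : ContDiffAt ℝ ∞ N (tangencyChart b θ (blowUp (s, y))) :=
      contDiffAt_invFunOn (isOpen_Ioo.prod isOpen_Ioo) hinj hq hsm.contDiffAt fun v hv =>
        hbox.eq_zero_of_fderiv_chart_eq_zero hb hq.1.1.le hq.2.1.le hq.1.2 hq.2.2
          (add_pos hq.1.1 hq.2.1) hv
    have hVs : ContDiffAt ℝ ∞ V (N (tangencyChart b θ (blowUp (s, y)))) := by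
      rw [hN s hs y hy]
      have h1 : ContDiffAt ℝ ∞ (fun q : ℝ × ℝ => q.1 + q.2) (blowUp (s, y)) := by fun_prop
      exact h1.prodMk (contDiffAt_snd.div h1 (by rw [hsum]; exact hs.1.ne'))
    have hVN : ContDiffAt ℝ ∞ (fun w => V (N w)) (tangencyChart b θ (blowUp (s, y))) :=
      hVs.comp _ hNs
    have hΛs : ContDiffAt ℝ ∞ Λ (V (N (tangencyChart b θ (blowUp (s, y))))) := by
      rw [hN s hs y hy, hV s hs y]
      exact (h.smooth s (Ioo_subset_Icc_self hs) y (Ioo_subset_Icc_self hy)).contDiffAt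
    exact ((ContDiffAt.comp (f := fun w => V (N w)) _ hΛs hVN).prodMk hVN.snd).contDiffWithinAt

theorem leafUnion_subset (hb : 0 < b) : leafUnion Λ θ b τs δ ⊆ closedUpperHalf := by
  rintro _ ⟨⟨s, y⟩, ⟨⟨hs, hy⟩, -⟩, rfl⟩
  exact tangencyChart_blowUp_snd_nonneg hb hs.1 hy

end IsLimitPhaseOn

end ImpactOscillator

theorem theorem4p7
    -- the oscillator: smooth `f`, smooth `T`-periodic forcing `g`, clearance `c`
    (f : ℝ → ℝ → ℝ) (g : ℝ → ℝ) (T c : ℝ)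
    (hf : ContDiff ℝ ∞ (Function.uncurry f)) (hg : ContDiff ℝ ∞ g)
    (hT : 0 < T) (hgT : Function.Periodic g T)
    -- the restitution rule
    (ρ : ℝ → ℝ) (r : ℝ) (hρ : ContDiff ℝ ∞ ρ) (hρ0 : ρ 0 = 0) (hρneg : ∀ v < 0, 0 < ρ v)
    (hρ' : deriv ρ 0 = -r) (hr0 : 0 < r) (hr1 : r < 1)
    -- the tangency point
    (τs : ℝ) (hτs : ImpactOscillator.IsTangencyPoint f g c τs)
    (ha' : deriv (ImpactOscillator.initialAcceleration f g c) τs < 0) :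
    ∃ U : Set (ℝ × ℝ), U ⊆ ImpactOscillator.closedUpperHalf ∧
      U ∈ 𝓝[ImpactOscillator.closedUpperHalf] (τs, 0) ∧
      ∃ (τ₁ : ℝ) (Φ : ℝ × ℝ → ℝ × ℝ), τs < τ₁ ∧
        ImpactOscillator.IsSmoothDiffeoOn Φ (Ioo τs τ₁ ×ˢ Ioo (0 : ℝ) 1)
          (U ∩ ImpactOscillator.upperHalf) ∧
        ∀ τ ∈ Ioo τs τ₁,
          Φ '' ({τ} ×ˢ Ioo (0 : ℝ) 1) =
            U ∩ ImpactOscillator.upperHalf ∩ ImpactOscillator.stableSet f g ρ c (τ, 0) ∧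
          (∀ s ∈ Icc (0 : ℝ) 1, Φ (τ, s) ∈ ImpactOscillator.stableSet f g ρ c (τ, 0)) ∧
          ∃ τ' < τs, ImpactOscillator.IsSmoothArc (fun s => Φ (τ, s)) (τ, 0) (τ', 0) := by
  obtain ⟨b, θ, μ, ν, h⟩ := ImpactOscillator.exists_tangencyReturn hf hg hρ hρ0 hρ' hτs.1 ha'
  obtain ⟨ρ₀, hρ₀, hbox⟩ := h.exists_monotoneBox
  obtain ⟨H, hH⟩ := h.exists_blownUpReturn hr0 hr1
  obtain ⟨Λ, hΛ0, hax, hle⟩ := h.exists_limitPhase hr0 hr1 hH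
  obtain ⟨δ, hδ, hδρ, hΛ, hst⟩ := ImpactOscillator.exists_isLimitPhaseOn hρ₀ hΛ0 hax hle
  have hstable : ∀ τ ∈ Ioo τs (τs + δ / 4), ∀ y ∈ Icc (0 : ℝ) 1,
      ImpactOscillator.leafMap Λ θ b δ (τ, y) ∈ ImpactOscillator.stableSet f g ρ c (τ, 0) := by
    intro τ hτ y hy
    obtain ⟨-, h2, h3, -⟩ := hΛ.leafRadius_spec hδ hτ hy
    have h4 := hst _ ⟨h2.1, h2.2.le⟩ y hy
    rw [h3] at h4
    exact h4
  refine ⟨ImpactOscillator.leafUnion Λ θ b τs δ,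
    ImpactOscillator.IsLimitPhaseOn.leafUnion_subset h.b_pos,
    hΛ.leafUnion_mem_nhdsWithin hbox h.b_pos hδ hδρ h.θ_zero, τs + δ / 4,
    ImpactOscillator.leafMap Λ θ b δ, by linarith,
    hΛ.isSmoothDiffeoOn_leafMap hbox h.b_pos hδ hδρ, fun τ hτ => ⟨?_, hstable τ hτ,
    hΛ.isSmoothArc_leafMap hbox h.b_pos hδ hδρ h.θ_zero hτ⟩⟩
  ext w
  constructor
  · rintro ⟨⟨τ', y⟩, ⟨h1, hy⟩, rfl⟩
    obtain rfl : τ' = τ := h1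
    exact ⟨hΛ.leafMap_mem_upperHalf h.b_pos hδ hτ hy, hstable τ' hτ y (Ioo_subset_Icc_self hy)⟩
  · rintro ⟨hw, hws⟩
    obtain ⟨s, hs, y, hy, hτ', -, h4⟩ := hΛ.exists_leaf h.b_pos hδ hw
    have h5 := hstable _ hτ' y (Ioo_subset_Icc_self hy)
    rw [h4] at h5
    have h6 : Λ (s, y) = τ := congrArg Prod.fst (tendsto_nhds_unique h5.2 hws.2)
    exact ⟨(τ, y), ⟨rfl, hy⟩, by rw [← h6, h4]⟩
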